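/- **Setup.** For each sample size $n$ let $Y_i=X_i\beta+e_i$, $X_i=\Pi_i+V_i$, $i\in[n]$, with fixed instruments $Z\in\mathbb R^{n\times K}$, $P=Z(Z^\top Z)^{-1}Z^\top$, $M=I-P$. All quantities may depend on $n$. For $\beta_0\in\mathbb R$ let $\Delta=\beta-\beta_0$ and $e_i(\beta_0)=Y_i-X_i\beta_0$, and suppose $\beta$ is bounded in $n$. Let $X$, $e(\beta_0)$, $\Pi$ be the corresponding vectors, and let $M_i$ be the $i$th row of $M$. Put $\sigma_i^2=\mathbb E e_i^2$, $\eta_i^2=\mathbb E V_i^2$, $\gamma_i=\mathbb E e_iV_i$, $\omega_i=\sum_{j\ne i}P_{ij}\Pi_j$, and suppose that the following limits as $n\to\infty$ exist: $$\Phi_1=\lim\tfrac2K\sum_{i}\sum_{j\ne i}P_{ij}^2\sigma_i^2\sigma_j^2,\quad \Phi_{12}=\lim\tfrac1K\sum_{i}\sum_{j\neq i}P_{ij}^2(\gamma_j\sigma_i^2+\gamma_i\sigma_j^2),\quad \Phi_{13}=\lim\tfrac2K\sum_{i}\sum_{j\neq i}P_{ij}^2\gamma_i\gamma_j,$$ $$\Psi=\lim\Big[\tfrac1K\sum_{i}\sum_{j\neq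 i}P_{ij}^2(\eta_i^2\sigma_j^2+\gamma_i\gamma_j)+\tfrac1K\sum_i\omega_i^2\sigma_i^2\Big],\quad \tau=\lim\Big[\tfrac2K\sum_{i}\sum_{j\neq i}P_{ij}^2\eta_i^2\gamma_j+\tfrac2K\sum_i\omega_i^2\gamma_i\Big],$$ $$\Upsilon=\lim\Big[\tfrac2K\sum_{i}\sum_{j\neq i}P_{ij}^2\eta_i^2\eta_j^2+\tfrac4K\sum_i\omega_i^2\eta_i^2\Big].$$ Set $\Phi_1(\beta_0)=\Delta^4\Upsilon+4\Delta^3\tau+\Delta^2(4\Psi+2\Phi_{13})+4\Delta\Phi_{12}+\Phi_1$, $\Phi_{12}(\beta_0)=\Delta^3\Upsilon+3\Delta^2\tau+\Delta(2\Psi+\Phi_{13})+\Phi_{12}$, $\Phi_{13}(\beta_0)=\Delta^2\Upsilon+2\Delta\tau+\Phi_{13}$, $\Psi(\beta_0)=\Delta^2\Upsilon+2\Delta\tau+\Psi$, $\tau(\beta_0)=\Delta\Upsilon+\tau$, $\rho(\beta_0)=\Phi_{12}(\beta_0)/\sqrt{\Phi_1(\beta_0)\Psi(\beta_0)}$, and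 $\gamma(\beta_0)=(\Phi_1(\beta_0),\Phi_{12}(\beta_0),\Phi_{13}(\beta_0),\Psi(\beta_0),\tau(\beta_0),\Upsilon,\rho(\beta_0))$. **Estimators.** With $\widetilde P_{ij}^2=P_{ij}^2/(M_{ii}M_{jj}+M_{ij}^2)$ the cross-fit estimators are $$\widehat\Phi_1(\beta_0)=\tfrac2K\sum_i\sum_{j\ne i}\widetilde P_{ij}^2[e_i(\beta_0)M_ie(\beta_0)][e_j(\beta_0)M_je(\beta_0)],$$ $$\widehat\Phi_{12}(\beta_0)=\tfrac1K\sum_i\sum_{j\ne i}\widetilde P_{ij}^2\big(M_jX\,e_j(\beta_0)\,e_i(\beta_0)M_ie(\beta_0)+M_iX\,e_i(\beta_0)\,e_j(\beta_0)M_je(\beta_0)\big),$$ $$\widehat\Phi_{13}(\beta_0)=\tfrac2K\sum_i\sum_{j\ne i}\widetilde P_{ij}^2\,M_iX\,e_i(\beta_0)\,M_jX\,e_j(\beta_0),$$ $$\widehat\Psi(\beta_0)=\tfrac1K\Big[\sum_i\Big(\sum_{j\ne i}P_{ij}X_j\Big)^2\frac{e_i(\beta_0)M_ie(\beta_0)}{M_{ii}}+\sum_i\sum_{j\ne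 i}\widetilde P_{ij}^2\,M_iX\,e_i(\beta_0)\,M_jX\,e_j(\beta_0)\Big],$$ $$\widehat\tau(\beta_0)=\tfrac1K\sum_i\sum_{j\ne i}\widetilde P_{ij}^2(X_iM_iX)(M_jX\,e_j(\beta_0))+\tfrac1K\sum_i\Big(\sum_{j\ne i}P_{ij}X_j\Big)^2\Big(\frac{e_i(\beta_0)M_iX}{2M_{ii}}+\frac{X_iM_ie(\beta_0)}{2M_{ii}}\Big),$$ $$\widehat\Upsilon=\tfrac2K\sum_i\sum_{j\ne i}\widetilde P_{ij}^2[X_iM_iX][X_jM_jX],\qquad \widehat\rho(\beta_0)=\frac{\widehat\Phi_{12}(\beta_0)}{\sqrt{\widehat\Phi_1(\beta_0)\widehat\Psi(\beta_0)}},$$ collected in $\widehat\gamma(\beta_0)=(\widehat\Phi_1(\beta_0),\widehat\Phi_{12}(\beta_0),\widehat\Phi_{13}(\beta_0),\widehat\Psi(\beta_0),\widehat\tau(\beta_0),\widehat\Upsilon,\widehat\rho(\beta_0))$. **Theorem.** Suppose that, for each $n$, the pairs $(V_i,e_i)$, $i\in[n]$, are independent with mean zero; that $P$ has rank $K$, $K\to\infty$,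 and $P_{ii}\le\delta<1$ for a constant $\delta$; that $\max_i|\Pi_i|\le C$, $\Pi^\top\Pi/K\to0$, and $\mathbb E e_i^6$, $\mathbb E V_i^6$ are bounded uniformly in $i$ and $n$; and that $\Pi^\top M\Pi\le C\,\Pi^\top\Pi/K$ for a constant $C>0$. Let $\mathcal B\subset\mathbb R$ be compact. 1. For every $\beta_0\in\mathcal B$ the six cross-fit estimators are consistent: $\widehat\Phi_1(\beta_0)-\Phi_1(\beta_0)$, $\widehat\Phi_{12}(\beta_0)-\Phi_{12}(\beta_0)$, $\widehat\Phi_{13}(\beta_0)-\Phi_{13}(\beta_0)$, $\widehat\Psi(\beta_0)-\Psi(\beta_0)$, $\widehat\tau(\beta_0)-\tau(\beta_0)$ and $\widehat\Upsilon-\Upsilon$ are all $o_p(1)$. 2. If the limit is nondegenerate, i.e. $\Upsilon>0$ and, for each $\beta_0\in\mathcal B$, $\Phi_1(\beta_0)>0$ and $\Psi(\beta_0)>0$ (bounded away from $0$ for all large $n$, in case $\beta$ drifts with $n$), then $\inf_{\beta_0\in\mathcal B}\Phi_1(\beta_0)>0$ and $\inf_{\beta_0\in\mathcal B}\Psi(\beta_0)>0$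 (uniformly in all large $n$), $\Upsilon>0$, and $\|\widehat\gamma(\beta_0)-\gamma(\beta_0)\|_2=o_p(1)$ for every $\beta_0\in\mathcal B$. 3. In particular, the conclusion of 2 holds whenever the matrix $\begin{pmatrix}\Phi_1&\Phi_{12}&\Phi_{13}\\\Phi_{12}&\Psi&\tau\\\Phi_{13}&\tau&\Upsilon\end{pmatrix}$ is positive definite. -/

import Mathlib

open MeasureTheory ProbabilityTheory Filter Topology Matrix

noncomputable section

namespace ManyIV

/-! ## Finite-sample objects -/

/-- `P = Z (Zᵀ Z)⁻¹ Zᵀ`, for an `n × K` matrix of instruments. -/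
def projZ {n K : ℕ} (Z : Matrix (Fin n) (Fin K) ℝ) : Matrix (Fin n) (Fin n) ℝ :=
  Z * (Zᵀ * Z)⁻¹ * Zᵀ

/-- `M = I - P`. -/
def annih {n : ℕ} (P : Matrix (Fin n) (Fin n) ℝ) : Matrix (Fin n) (Fin n) ℝ := 1 - P

/-- The cross-fit weight `P̃²ᵢⱼ = P²ᵢⱼ / (Mᵢᵢ Mⱼⱼ + M²ᵢⱼ)`. -/
def cfWeight {n : ℕ} (P : Matrix (Fin n) (Fin n) ℝ) (i j : Fin n) : ℝ :=
  P i j ^ 2 / (annih P i i * annih P j j + annih P i j ^ 2)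

/-- The double sum over `i` and `j ≠ i`. -/
def offSum {n : ℕ} (f : Fin n → Fin n → ℝ) : ℝ := ∑ i, ∑ j with j ≠ i, f i j

/-- The leave-one-out fit `∑_{j ≠ i} Pᵢⱼ aⱼ`. -/
def loo {n : ℕ} (P : Matrix (Fin n) (Fin n) ℝ) (a : Fin n → ℝ) (i : Fin n) : ℝ :=
  ∑ j with j ≠ i, P i j * a j

/-! ### Cross-fit estimators

`K` is the number of instruments, `P` the projection matrix, `X` the endogenous variable and
`r` the vector of null-imposed residuals `e(β₀) = Y - X β₀`. -/

section Estimators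

variable {n : ℕ} (K : ℕ) (P : Matrix (Fin n) (Fin n) ℝ) (X r : Fin n → ℝ)

def hatPhi1 : ℝ :=
  2 / (K : ℝ) * offSum fun i j =>
    cfWeight P i j * (r i * (annih P *ᵥ r) i) * (r j * (annih P *ᵥ r) j)

def hatPhi12 : ℝ :=
  1 / (K : ℝ) * offSum fun i j =>
    cfWeight P i j *
      ((annih P *ᵥ X) j * r j * (r i * (annih P *ᵥ r) i)
        + (annih P *ᵥ X) i * r i * (r j * (annih P *ᵥ r) j))

def hatPhi13 : ℝ :=
  2 / (K : ℝ) * offSum fun i j =>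
    cfWeight P i j * ((annih P *ᵥ X) i * r i) * ((annih P *ᵥ X) j * r j)

def hatPsi : ℝ :=
  1 / (K : ℝ) *
    ((∑ i, loo P X i ^ 2 * (r i * (annih P *ᵥ r) i / annih P i i))
      + offSum fun i j =>
          cfWeight P i j * ((annih P *ᵥ X) i * r i) * ((annih P *ᵥ X) j * r j))

def hatTau : ℝ :=
  1 / (K : ℝ) * (offSum fun i j =>
      cfWeight P i j * (X i * (annih P *ᵥ X) i) * ((annih P *ᵥ X) j * r j))
    + 1 / (K : ℝ) * ∑ i, loo P X i ^ 2 *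
        (r i * (annih P *ᵥ X) i / (2 * annih P i i) + X i * (annih P *ᵥ r) i / (2 * annih P i i))

def hatUpsilon : ℝ :=
  2 / (K : ℝ) * offSum fun i j =>
    cfWeight P i j * (X i * (annih P *ᵥ X) i) * (X j * (annih P *ᵥ X) j)

/-- The plug-in estimator of the correlation `ρ(β₀) = Φ₁₂(β₀) / √(Φ₁(β₀) Ψ(β₀))`. -/
def hatRho : ℝ := hatPhi12 K P X r / √(hatPhi1 K P r * hatPsi K P X r)

/-- `γ̂(β₀) = (Φ̂₁, Φ̂₁₂, Φ̂₁₃, Ψ̂, τ̂, Υ̂, ρ̂)`. -/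
def hatGamma : EuclideanSpace ℝ (Fin 7) :=
  !₂[hatPhi1 K P r, hatPhi12 K P X r, hatPhi13 K P X r, hatPsi K P X r, hatTau K P X r,
    hatUpsilon K P X, hatRho K P X r]

end Estimators

/-! ## The drifting sequence of linear IV models -/

/-- The data generating process of every sample size `n`: `Y = X β + e`, `X = Π + V`, with fixed
instruments `Z`. The true coefficient `β` may drift with `n`. -/
structure IVArray (Ω : ℕ → Type*) where
  /-- number of instruments -/
  K : ℕ → ℕ
  /-- instruments -/
  Z : ∀ n, Matrix (Fin n) (Fin (K n)) ℝ
  /-- true structural coefficient -/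
  β : ℕ → ℝ
  /-- first-stage means -/
  Pi : ∀ n, Fin n → ℝ
  /-- structural errors -/
  e : ∀ n, Fin n → Ω n → ℝ
  /-- first-stage errors -/
  V : ∀ n, Fin n → Ω n → ℝ

namespace IVArray

variable {Ω : ℕ → Type*} (D : IVArray Ω)

/-- The projection matrix of the instruments. -/
def P (n : ℕ) : Matrix (Fin n) (Fin n) ℝ := projZ (D.Z n)

/-- The endogenous variable `X = Π + V`. -/
def X (n : ℕ) (ω : Ω n) : Fin n → ℝ := fun i => D.Pi n i + D.V n i ω

/-- The outcome `Y = X β + e`. -/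
def Y (n : ℕ) (ω : Ω n) : Fin n → ℝ := fun i => D.X n ω i * D.β n + D.e n i ω

/-- The null-imposed residuals `e(β₀) = Y - X β₀`. -/
def resid (b : ℝ) (n : ℕ) (ω : Ω n) : Fin n → ℝ := fun i => D.Y n ω i - D.X n ω i * b

/-- `Δ = β - β₀`. -/
def Del (b : ℝ) (n : ℕ) : ℝ := D.β n - b

/-- `ωᵢ = ∑_{j ≠ i} Pᵢⱼ Πⱼ`. -/
def om (n : ℕ) (i : Fin n) : ℝ := loo (D.P n) (D.Pi n) i

/-- The cross-fit estimator of `γ(β₀)` at `β₀ = b`. -/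
def crossFit (b : ℝ) (n : ℕ) (ω : Ω n) : EuclideanSpace ℝ (Fin 7) :=
  hatGamma (D.K n) (D.P n) (D.X n ω) (D.resid b n ω)

end IVArray

section Probability

variable {Ω : ℕ → Type*} [∀ n, MeasurableSpace (Ω n)] (μ : ∀ n, Measure (Ω n))

/-- `ξₙ = o_p(1)`. -/
def IsLittleOp (ξ : ∀ n, Ω n → ℝ) : Prop :=
  ∀ ε : ℝ, 0 < ε → Tendsto (fun n => μ n {ω | ε ≤ |ξ n ω|}) atTop (𝓝 0)

variable (D : IVArray Ω)

/-- `σᵢ² = E eᵢ²`. -/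
def sigSq (n : ℕ) (i : Fin n) : ℝ := ∫ ω, D.e n i ω ^ 2 ∂(μ n)

/-- `ηᵢ² = E Vᵢ²`. -/
def etaSq (n : ℕ) (i : Fin n) : ℝ := ∫ ω, D.V n i ω ^ 2 ∂(μ n)

/-- `γᵢ = E eᵢ Vᵢ`. -/
def gam (n : ℕ) (i : Fin n) : ℝ := ∫ ω, D.e n i ω * D.V n i ω ∂(μ n)

/-- Independent mean-zero errors; `P` a projection of rank `K → ∞` whose diagonal is bounded
away from one. -/
structure ErrorsAndProjection : Prop where
  meas_e : ∀ n i, Measurable (D.e n i)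
  meas_V : ∀ n i, Measurable (D.V n i)
  indep : ∀ n, iIndepFun (fun (i : Fin n) ω => (D.V n i ω, D.e n i ω)) (μ n)
  mean_e : ∀ n i, Integrable (D.e n i) (μ n) ∧ ∫ ω, D.e n i ω ∂(μ n) = 0
  mean_V : ∀ n i, Integrable (D.V n i) (μ n) ∧ ∫ ω, D.V n i ω ∂(μ n) = 0
  rank_P : ∀ n, (D.P n).rank = D.K n
  K_tendsto : Tendsto D.K atTop atTop
  diag_P : ∃ δ : ℝ, δ < 1 ∧ ∀ n i, D.P n i i ≤ δ

/-- Bounded first-stage means, `Πᵀ Π / K = o(1)` and uniformly bounded sixth moments. -/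
structure Regularity : Prop where
  bdd_Pi : ∃ C : ℝ, ∀ n i, |D.Pi n i| ≤ C
  small_Pi : Tendsto (fun n => (D.Pi n ⬝ᵥ D.Pi n) / (D.K n : ℝ)) atTop (𝓝 0)
  moment : ∃ C : ℝ, ∀ n i,
    Integrable (fun ω => D.e n i ω ^ 6) (μ n) ∧ Integrable (fun ω => D.V n i ω ^ 6) (μ n) ∧
      ∫ ω, D.e n i ω ^ 6 ∂(μ n) ≤ C ∧ ∫ ω, D.V n i ω ^ 6 ∂(μ n) ≤ C

/-- The additional condition `Πᵀ M Π ≤ C Πᵀ Π / K` (wherever there is an instrument). -/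
def ResidualCondition : Prop :=
  ∃ C : ℝ, 0 < C ∧ ∀ n, 0 < D.K n →
    D.Pi n ⬝ᵥ (annih (D.P n) *ᵥ D.Pi n) ≤ C * (D.Pi n ⬝ᵥ D.Pi n) / (D.K n : ℝ)

end Probability

/-! ## Asymptotic variance components -/

/-- Values of the six asymptotic variance components. -/
structure VarComp where
  Phi1 : ℝ
  Phi12 : ℝ
  Phi13 : ℝ
  Psi : ℝ
  tau : ℝ
  Ups : ℝ

namespace VarComp

/-- The components at `β₀`, as functions of `Δ = β - β₀` and of the components at `β`. -/
def shift (g : VarComp) (d : ℝ) : VarComp where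
  Phi1 := d ^ 4 * g.Ups + 4 * d ^ 3 * g.tau + d ^ 2 * (4 * g.Psi + 2 * g.Phi13)
    + 4 * d * g.Phi12 + g.Phi1
  Phi12 := d ^ 3 * g.Ups + 3 * d ^ 2 * g.tau + d * (2 * g.Psi + g.Phi13) + g.Phi12
  Phi13 := d ^ 2 * g.Ups + 2 * d * g.tau + g.Phi13
  Psi := d ^ 2 * g.Ups + 2 * d * g.tau + g.Psi
  tau := d * g.Ups + g.tau
  Ups := g.Ups

/-- `ρ = Φ₁₂ / √(Φ₁ Ψ)`. -/
def rho (g : VarComp) : ℝ := g.Phi12 / √(g.Phi1 * g.Psi)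

/-- `γ = (Φ₁, Φ₁₂, Φ₁₃, Ψ, τ, Υ, ρ)`. -/
def gamma (g : VarComp) : EuclideanSpace ℝ (Fin 7) :=
  !₂[g.Phi1, g.Phi12, g.Phi13, g.Psi, g.tau, g.Ups, g.rho]

/-- The asymptotic covariance matrix of `(Q_{e,e}, Q_{X,e}, Q_{X,X} - 𝒞)`. -/
def cov (g : VarComp) : Matrix (Fin 3) (Fin 3) ℝ :=
  !![g.Phi1, g.Phi12, g.Phi13; g.Phi12, g.Psi, g.tau; g.Phi13, g.tau, g.Ups]

end VarComp

section Limits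

variable {Ω : ℕ → Type*} [∀ n, MeasurableSpace (Ω n)] (μ : ∀ n, Measure (Ω n)) (D : IVArray Ω)

/-- `g` collects the limits that define `Φ₁, Φ₁₂, Φ₁₃, Ψ, τ, Υ`. -/
structure IsVarLimit (g : VarComp) : Prop where
  Phi1 : Tendsto (fun n => 2 / (D.K n : ℝ) * offSum fun i j =>
      D.P n i j ^ 2 * (sigSq μ D n i * sigSq μ D n j)) atTop (𝓝 g.Phi1)
  Phi12 : Tendsto (fun n => 1 / (D.K n : ℝ) * offSum fun i j =>
      D.P n i j ^ 2 * (gam μ D n j * sigSq μ D n i + gam μ D n i * sigSq μ D n j))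
    atTop (𝓝 g.Phi12)
  Phi13 : Tendsto (fun n => 2 / (D.K n : ℝ) * offSum fun i j =>
      D.P n i j ^ 2 * (gam μ D n i * gam μ D n j)) atTop (𝓝 g.Phi13)
  Psi : Tendsto (fun n => 1 / (D.K n : ℝ) * (offSum fun i j =>
        D.P n i j ^ 2 * (etaSq μ D n i * sigSq μ D n j + gam μ D n i * gam μ D n j))
      + 1 / (D.K n : ℝ) * ∑ i, D.om n i ^ 2 * sigSq μ D n i) atTop (𝓝 g.Psi)
  tau : Tendsto (fun n => 2 / (D.K n : ℝ) * (offSum fun i j =>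
        D.P n i j ^ 2 * (etaSq μ D n i * gam μ D n j))
      + 2 / (D.K n : ℝ) * ∑ i, D.om n i ^ 2 * gam μ D n i) atTop (𝓝 g.tau)
  Ups : Tendsto (fun n => 2 / (D.K n : ℝ) * (offSum fun i j =>
        D.P n i j ^ 2 * (etaSq μ D n i * etaSq μ D n j))
      + 4 / (D.K n : ℝ) * ∑ i, D.om n i ^ 2 * etaSq μ D n i) atTop (𝓝 g.Ups)

/-- The high-level condition on a variance estimator `est` over the parameter set `B`:
`inf_{β₀ ∈ B} Φ₁(β₀) > 0`, `inf_{β₀ ∈ B} Ψ(β₀) > 0` (for all large `n`, since `Δ` may drift),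
`Υ > 0`, and `‖γ̂(β₀) - γ(β₀)‖₂ = o_p(1)` for `β₀ ∈ B`. -/
structure ConsistentVariance (g : VarComp) (B : Set ℝ)
    (est : ℝ → ∀ n, Ω n → EuclideanSpace ℝ (Fin 7)) : Prop where
  inf_Phi1 : ∃ c : ℝ, 0 < c ∧ ∀ᶠ n in atTop, ∀ b ∈ B, c ≤ (g.shift (D.Del b n)).Phi1
  inf_Psi : ∃ c : ℝ, 0 < c ∧ ∀ᶠ n in atTop, ∀ b ∈ B, c ≤ (g.shift (D.Del b n)).Psi
  Ups_pos : 0 < g.Ups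
  consistent : ∀ b ∈ B, IsLittleOp μ fun n ω => ‖est b n ω - (g.shift (D.Del b n)).gamma‖

/-- Pointwise nondegeneracy of the limit problem at `β₀ = b`: `Φ₁(b)` and `Ψ(b)` are positive
(bounded away from zero along the sequence, if `Δ` drifts). -/
def NondegenerateAt (g : VarComp) (b : ℝ) : Prop :=
  ∃ c : ℝ, 0 < c ∧ ∀ᶠ n in atTop,
    c ≤ (g.shift (D.Del b n)).Phi1 ∧ c ≤ (g.shift (D.Del b n)).Psi

/-- Consistency at `β₀ = b` of the cross-fit estimators of the six variance components. -/
structure SixConsistent (g : VarComp) (b : ℝ) : Prop where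
  Phi1 : IsLittleOp μ fun n ω =>
    hatPhi1 (D.K n) (D.P n) (D.resid b n ω) - (g.shift (D.Del b n)).Phi1
  Phi12 : IsLittleOp μ fun n ω =>
    hatPhi12 (D.K n) (D.P n) (D.X n ω) (D.resid b n ω) - (g.shift (D.Del b n)).Phi12
  Phi13 : IsLittleOp μ fun n ω =>
    hatPhi13 (D.K n) (D.P n) (D.X n ω) (D.resid b n ω) - (g.shift (D.Del b n)).Phi13
  Psi : IsLittleOp μ fun n ω =>
    hatPsi (D.K n) (D.P n) (D.X n ω) (D.resid b n ω) - (g.shift (D.Del b n)).Psi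
  tau : IsLittleOp μ fun n ω =>
    hatTau (D.K n) (D.P n) (D.X n ω) (D.resid b n ω) - (g.shift (D.Del b n)).tau
  Ups : IsLittleOp μ fun n ω =>
    hatUpsilon (D.K n) (D.P n) (D.X n ω) - (g.shift (D.Del b n)).Ups

end Limits

end ManyIV

end

namespace ManyIV

/-! ## Multilinear forms in independent random variables -/

section Multilinear

variable {Ω : Type*} {mΩ : MeasurableSpace Ω} {μ : Measure Ω}

/-! Up to normalisation by `K`, every estimator is a combination of two forms: the cross-fit sum
over `j ≠ i` of P̃²ᵢⱼ r₁ᵢ(Mr₂)ᵢ r₃ⱼ(Mr₄)ⱼ (`crossForm`) and the leave-one-out sum of (∑_{j≠i}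
Pᵢⱼrⱼ)² r₃ᵢ(Mr₄)ᵢ/Mᵢᵢ (`looForm`). Each r is X or e(β₀), that is, a multiple of Π plus independent
centred noise. It is enough that each form lies within o(K), in L¹, of a sum of P²ᵢⱼ times products
of second moments (`pairSum`); Markov's inequality does the rest.

Means are removed first. Replacing factors one at a time leaves error terms that carry an entry of a
mean vector, of its image under M, or of its leave-one-out fit, times factors with bounded moments
(`L1Le.crossFit_perturb`, `L1Le.leaveOneOut_perturb`). Since ∑Pᵢᵢ² ≤ tr P = K, Cauchy–Schwarz bounds
these errors by a multiple of √(K·ΠᵀΠ) + ΠᵀΠ, which is o(K). The condition on ΠᵀMΠ serves to bound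
the entries of MΠ uniformly.

In pure noise, the forms are expanded according to which indices coincide. Each piece is a
multilinear form over distinct indices, and monomials with different index sets are orthogonal, so
its second moment is at most a constant times the sum of its squared weights (`sq_multilinear_le`).
The identities ∑ⱼPᵢⱼ² = Pᵢᵢ ≤ 1 and tr P = K make that sum O(K), so the piece is O(√K) in L¹ after
subtraction of its mean. Up to three noise factors can meet at one index, and the second moment of
their product is where sixth moments enter (`L1Le.crossFit_noise`, `L1Le.leaveOneOut_noise`). In the
cross-fit form, the surviving means have weights MᵢᵢMⱼⱼ and Mᵢⱼ²; when the two moment products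
agree, possibly after exchanging i and j, these add up to the denominator of P̃²ᵢⱼ and leave exactly
Pᵢⱼ².

On the side of the limits, the ω-terms vanish because ∑ωᵢ² = O(ΠᵀΠ), and the polynomials in Δ come
from bilinearity of `pairSum` (`PairLimits.shift`). For the correlation, the drifting limits stay in
a compact set on which v₁/√(v₀v₃) is continuous, which gives uniform control. Positive definiteness
yields nondegeneracy by evaluating the quadratic form at (1, 2Δ, Δ²) and (0, 1, Δ). -/

lemma iIndepFun.integrable_fun_prod {κ : Type*} [Fintype κ] {Y : κ → Ω → ℝ}
    [IsProbabilityMeasure μ] (hY : iIndepFun Y μ) (hint : ∀ s, Integrable (Y s) μ) :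
    Integrable (fun ω => ∏ s, Y s ω) μ := by
  have hm : ∀ s, AEMeasurable (Y s) μ := fun s => (hint s).aemeasurable
  -- Under independence the joint law is the product of the marginals, where integrability of a
  -- product of coordinates is Fubini.
  have h1 : Integrable (fun x : κ → ℝ => ∏ s, x s) (Measure.map (fun ω s => Y s ω) μ) := by
    rw [hY.map_fun_eq_pi_map hm]
    have : ∀ s, IsProbabilityMeasure (Measure.map (Y s) μ) :=
      fun s => Measure.isProbabilityMeasure_map (hm s)
    refine Integrable.fintype_prod (f := fun _ x => x) fun s => ?_
    exact (integrable_map_measure aestronglyMeasurable_id (hm s)).2 (hint s)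
  exact h1.comp_aemeasurable (aemeasurable_pi_iff.2 hm)

lemma iIndepFun_of_measurable {κ : Type*} {𝓕 : κ → MeasurableSpace Ω} (hind : iIndep 𝓕 μ)
    {g : κ → Ω → ℝ} (hg : ∀ k, Measurable[𝓕 k] (g k)) : iIndepFun g μ :=
  (iIndepFun_iff_iIndep ..).2 (iIndep_of_iIndep_of_le hind fun k => (hg k).comap_le)

/-- A family of square integrable random variables, the `k`th of which is measurable with respect
to `𝓕 k`, with second moments bounded by `m`. -/
structure NoiseFamily {ι : Type*} (μ : Measure Ω) (𝓕 : ι → MeasurableSpace Ω) (m : ℝ)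
    (x : ι → Ω → ℝ) : Prop where
  meas : ∀ k, Measurable[𝓕 k] (x k)
  memLp : ∀ k, MemLp (x k) 2 μ
  sq_le : ∀ k, ∫ ω, x k ω ^ 2 ∂μ ≤ m

variable {ι : Type*} {𝓕 : ι → MeasurableSpace Ω} {m : ℝ}

/-- Injectivity of `i` places the factors in different σ-algebras, so their squares are independent
and the second moment factorises. -/
lemma memLp_monomial [IsProbabilityMeasure μ] {r : ℕ} (hind : iIndep 𝓕 μ)
    {x : Fin r → ι → Ω → ℝ} (hx : ∀ s, NoiseFamily μ 𝓕 m (x s)) {i : Fin r → ι}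
    (hi : Function.Injective i) :
    MemLp (fun ω => ∏ s, x s (i s) ω) 2 μ ∧ ∫ ω, (∏ s, x s (i s) ω) ^ 2 ∂μ ≤ m ^ r := by
  have hind' : iIndepFun (fun s ω => x s (i s) ω ^ 2) μ := by
    have h1 : iIndep (fun s => 𝓕 (i s)) μ := hind.precomp hi
    exact iIndepFun_of_measurable h1 fun s => ((hx s).meas (i s)).pow_const 2
  have hint : ∀ s, Integrable (fun ω => x s (i s) ω ^ 2) μ :=
    fun s => ((hx s).memLp (i s)).integrable_sq
  have hm : AEStronglyMeasurable (fun ω => ∏ s, x s (i s) ω) μ :=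
    Finset.aestronglyMeasurable_fun_prod Finset.univ fun s _ =>
      ((hx s).memLp (i s)).aestronglyMeasurable
  constructor
  · rw [memLp_two_iff_integrable_sq hm]
    simp_rw [← Finset.prod_pow]
    exact iIndepFun.integrable_fun_prod hind' hint
  · simp_rw [← Finset.prod_pow]
    rw [hind'.integral_fun_prod_eq_prod_integral fun s => (hint s).aestronglyMeasurable]
    calc _ ≤ ∏ s : Fin r, m := Finset.prod_le_prod
          (fun s _ => integral_nonneg fun ω => sq_nonneg _) fun s _ => (hx s).sq_le (i s)
      _ = m ^ r := by simp

variable [Fintype ι] [DecidableEq ι]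

/-- Grouping the factors by index value gives independent functions `g k`. At an index that occurs
in `i` but not in `j`, injectivity of `i` leaves a single centred factor, whose mean kills the
product. -/
lemma integral_monomial_mul_eq_zero {r : ℕ} (hle : ∀ k, 𝓕 k ≤ mΩ) (hind : iIndep 𝓕 μ)
    {x : Fin r → ι → Ω → ℝ} (hx : ∀ s, NoiseFamily μ 𝓕 m (x s))
    (hx0 : ∀ s k, ∫ ω, x s k ω ∂μ = 0) {i j : Fin r → ι}
    (hi : Function.Injective i) (h : ∃ s, ∀ t, j t ≠ i s) :
    ∫ ω, (∏ s, x s (i s) ω) * ∏ s, x s (j s) ω ∂μ = 0 := by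
  obtain ⟨s₀, hs₀⟩ := h
  set g : ι → Ω → ℝ := fun k ω =>
    (∏ s with i s = k, x s k ω) * ∏ s with j s = k, x s k ω with hg
  have hgm : ∀ k, Measurable[𝓕 k] (g k) := fun k => by
    refine Measurable.mul ?_ ?_
    · exact Finset.measurable_fun_prod _ fun s _ => (hx s).meas k
    · exact Finset.measurable_fun_prod _ fun s _ => (hx s).meas k
  have h1 : ∀ ω, (∏ s, x s (i s) ω) * ∏ s, x s (j s) ω = ∏ k, g k ω := fun ω => by
    simp only [hg, Finset.prod_mul_distrib]
    congr 1
    · rw [← Finset.prod_fiberwise Finset.univ i]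
      refine Finset.prod_congr rfl fun k _ => Finset.prod_congr rfl fun s hs => ?_
      rw [(Finset.mem_filter.1 hs).2]
    · rw [← Finset.prod_fiberwise Finset.univ j]
      refine Finset.prod_congr rfl fun k _ => Finset.prod_congr rfl fun s hs => ?_
      rw [(Finset.mem_filter.1 hs).2]
  simp_rw [h1]
  rw [(iIndepFun_of_measurable hind hgm).integral_fun_prod_eq_prod_integral
    fun k => ((hgm k).mono (hle k) le_rfl).aestronglyMeasurable]
  refine Finset.prod_eq_zero (Finset.mem_univ (i s₀)) ?_
  have h2 : (Finset.univ.filter fun s => i s = i s₀) = {s₀} := by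
    ext s; simp [hi.eq_iff]
  have h3 : (Finset.univ.filter fun s => j s = i s₀) = ∅ := by
    ext s; simp [hs₀ s]
  simp only [hg, h2, h3, Finset.prod_singleton, Finset.prod_empty, mul_one]
  exact hx0 s₀ _

/-- Second moment of a multilinear form, without repeated indices, in independent centred
random variables. -/
theorem sq_multilinear_le [IsProbabilityMeasure μ] {r : ℕ} (hle : ∀ k, 𝓕 k ≤ mΩ)
    (hind : iIndep 𝓕 μ) (hm : 0 ≤ m)
    {x : Fin r → ι → Ω → ℝ} (hx : ∀ s, NoiseFamily μ 𝓕 m (x s))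
    (hx0 : ∀ s k, ∫ ω, x s k ω ∂μ = 0) (c : (Fin r → ι) → ℝ)
    (hc : ∀ i, ¬ Function.Injective i → c i = 0) :
    MemLp (fun ω => ∑ i, c i * ∏ s, x s (i s) ω) 2 μ ∧
      ∫ ω, (∑ i, c i * ∏ s, x s (i s) ω) ^ 2 ∂μ ≤ (r ^ r * m ^ r) * ∑ i, c i ^ 2 := by
  have hmem : ∀ i, MemLp (fun ω => c i * ∏ s, x s (i s) ω) 2 μ := fun i => by
    by_cases hi : Function.Injective i
    · exact (memLp_monomial hind hx hi).1.const_mul _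
    · simp [hc i hi]
  refine ⟨memLp_finsetSum _ fun i _ => hmem i, ?_⟩
  have hprod : ∀ i j, Integrable (fun ω => (c i * ∏ s, x s (i s) ω) * (c j * ∏ s, x s (j s) ω)) μ :=
    fun i j => (hmem i).integrable_mul (hmem j)
  have hexp : ∀ ω, (∑ i, c i * ∏ s, x s (i s) ω) ^ 2 =
      ∑ i, ∑ j, (c i * ∏ s, x s (i s) ω) * (c j * ∏ s, x s (j s) ω) := fun ω => by
    rw [sq, Finset.sum_mul_sum]
  simp_rw [hexp]
  rw [integral_finsetSum _ fun i _ => integrable_finsetSum _ fun j _ => hprod i j]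
  simp_rw [integral_finsetSum _ fun j _ => hprod _ j]
  have hsq : ∀ i, ∫ ω, (c i * ∏ s, x s (i s) ω) ^ 2 ∂μ ≤ m ^ r * c i ^ 2 := fun i => by
    by_cases hi : Function.Injective i
    · simp_rw [mul_pow]
      rw [integral_const_mul, mul_comm]
      exact mul_le_mul_of_nonneg_right (memLp_monomial hind hx hi).2 (sq_nonneg _)
    · simp [hc i hi]
  -- Indicator that `i` and `j` have the same range. Only such pairs can be correlated, and they are
  -- bounded by half the sum of the two second moments; symmetry of `A` then folds the two halves
  -- into one sum.
  let A : (Fin r → ι) → (Fin r → ι) → ℝ := fun i j =>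
    if ∀ s, ∃ t, i t = j s then (if ∀ s, ∃ t, j t = i s then 1 else 0) else 0
  have hA0 : ∀ i j, 0 ≤ A i j := fun i j => by simp only [A]; split_ifs <;> norm_num
  have hAs : ∀ i j, A i j = A j i := fun i j => by
    simp only [A]; split_ifs <;> rfl
  have hterm : ∀ i j, ∫ ω, (c i * ∏ s, x s (i s) ω) * (c j * ∏ s, x s (j s) ω) ∂μ ≤
      A i j * (m ^ r * c i ^ 2 / 2) + A i j * (m ^ r * c j ^ 2 / 2) := fun i j => by
    have hpos : 0 ≤ A i j * (m ^ r * c i ^ 2 / 2) + A i j * (m ^ r * c j ^ 2 / 2) := by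
      have := hA0 i j; positivity
    by_cases hi : Function.Injective i
    swap
    · simpa [hc i hi] using mul_nonneg (hA0 i j) (by positivity : 0 ≤ m ^ r * c j ^ 2 / 2)
    by_cases hj : Function.Injective j
    swap
    · simpa [hc j hj] using mul_nonneg (hA0 i j) (by positivity : 0 ≤ m ^ r * c i ^ 2 / 2)
    by_cases h1 : ∀ s, ∃ t, j t = i s
    swap
    · push Not at h1
      have h0 := integral_monomial_mul_eq_zero hle hind hx hx0 hi h1
      have : ∀ ω, (c i * ∏ s, x s (i s) ω) * (c j * ∏ s, x s (j s) ω) =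
        (c i * c j) * ((∏ s, x s (i s) ω) * (∏ s, x s (j s) ω)) := fun ω => by ring
      simp_rw [this]
      rw [integral_const_mul, h0, mul_zero]
      exact hpos
    by_cases h2 : ∀ s, ∃ t, i t = j s
    swap
    · push Not at h2
      have h0 := integral_monomial_mul_eq_zero hle hind hx hx0 hj h2
      have : ∀ ω, (c i * ∏ s, x s (i s) ω) * (c j * ∏ s, x s (j s) ω) =
        (c i * c j) * ((∏ s, x s (j s) ω) * (∏ s, x s (i s) ω)) := fun ω => by ring
      simp_rw [this]
      rw [integral_const_mul, h0, mul_zero]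
      exact hpos
    have hA1 : A i j = 1 := by simp only [A, if_pos h1, if_pos h2]
    rw [hA1, one_mul, one_mul]
    calc _ ≤ ∫ ω, ((c i * ∏ s, x s (i s) ω) ^ 2 / 2 + (c j * ∏ s, x s (j s) ω) ^ 2 / 2) ∂μ := by
          refine integral_mono (hprod i j)
            (((hmem i).integrable_sq.div_const 2).add ((hmem j).integrable_sq.div_const 2)) ?_
          intro ω
          have := sq_nonneg (c i * ∏ s, x s (i s) ω - c j * ∏ s, x s (j s) ω)
          simp only
          nlinarith
      _ ≤ _ := by
          rw [integral_add ((hmem i).integrable_sq.div_const 2)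
            ((hmem j).integrable_sq.div_const 2), integral_div, integral_div]
          have := hsq i
          have := hsq j
          linarith
  -- A crude count: each of the `r` coordinates of `j` lies in the range of `i`, which has at most
  -- `r` elements.
  have hcount : ∀ i, ∑ j, A i j ≤ (r : ℝ) ^ r := fun i => by
    calc ∑ j, A i j ≤ ∑ j, if j ∈ Fintype.piFinset fun _ : Fin r => Finset.univ.image i
          then (1 : ℝ) else 0 := by
          refine Finset.sum_le_sum fun j _ => ?_
          simp only [A, Fintype.mem_piFinset, Finset.mem_image, Finset.mem_univ, true_and]
          split_ifs <;> norm_num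
      _ = ((Finset.univ.image i).card : ℝ) ^ r := by
          rw [Finset.sum_ite_mem, Finset.univ_inter, Finset.sum_const, Fintype.card_piFinset_const]
          simp
      _ ≤ (r : ℝ) ^ r := by
          gcongr
          simpa using Finset.card_image_le (s := (Finset.univ : Finset (Fin r))) (f := i)
  calc _ ≤ ∑ i, ∑ j, (A i j * (m ^ r * c i ^ 2 / 2) + A i j * (m ^ r * c j ^ 2 / 2)) :=
        Finset.sum_le_sum fun i _ => Finset.sum_le_sum fun j _ => hterm i j
    _ = ∑ i, (∑ j, A i j) * (m ^ r * c i ^ 2) := by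
        simp_rw [Finset.sum_add_distrib]
        rw [Finset.sum_comm (f := fun i j => A i j * (m ^ r * c j ^ 2 / 2)),
          ← Finset.sum_add_distrib]
        refine Finset.sum_congr rfl fun i _ => ?_
        rw [Finset.sum_mul, ← Finset.sum_add_distrib]
        refine Finset.sum_congr rfl fun j _ => ?_
        rw [hAs j i]; ring
    _ ≤ ∑ i, (r : ℝ) ^ r * (m ^ r * c i ^ 2) :=
        Finset.sum_le_sum fun i _ => mul_le_mul_of_nonneg_right (hcount i) (by positivity)
    _ = _ := by rw [Finset.mul_sum]; exact Finset.sum_congr rfl fun i _ => by ring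

end Multilinear

/-! ### Calculus of L¹ bounds. -/

section LOne

variable {Ω : Type*} {mΩ : MeasurableSpace Ω} {μ : Measure Ω} {F G : Ω → ℝ} {a b : ℝ}

/-- `F` is integrable with `L¹`-norm at most `a`. -/
def L1Le (μ : Measure Ω) (F : Ω → ℝ) (a : ℝ) : Prop :=
  Integrable F μ ∧ ∫ ω, |F ω| ∂μ ≤ a

lemma L1Le.add (hF : L1Le μ F a) (hG : L1Le μ G b) : L1Le μ (fun ω => F ω + G ω) (a + b) := by
  refine ⟨hF.1.add hG.1, ?_⟩
  calc ∫ ω, |F ω + G ω| ∂μ ≤ ∫ ω, (|F ω| + |G ω|) ∂μ :=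
        integral_mono (hF.1.add hG.1).abs (hF.1.abs.add hG.1.abs) fun ω => abs_add_le _ _
    _ ≤ a + b := by
        rw [integral_add hF.1.abs hG.1.abs]; exact add_le_add hF.2 hG.2

lemma L1Le.const_mul (c : ℝ) (hF : L1Le μ F a) : L1Le μ (fun ω => c * F ω) (|c| * a) := by
  refine ⟨hF.1.const_mul c, ?_⟩
  simp only [abs_mul]
  rw [integral_const_mul]
  exact mul_le_mul_of_nonneg_left hF.2 (abs_nonneg _)

lemma L1Le.mono (hF : L1Le μ F a) (h : a ≤ b) : L1Le μ F b := ⟨hF.1, hF.2.trans h⟩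

lemma L1Le.congr (hF : L1Le μ F a) (h : ∀ ω, G ω = F ω) : L1Le μ G a := by
  have : G = F := funext h
  rwa [this]

lemma L1Le.sum {κ : Type*} (s : Finset κ) {F : κ → Ω → ℝ} {a : κ → ℝ}
    (h : ∀ i ∈ s, L1Le μ (F i) (a i)) : L1Le μ (fun ω => ∑ i ∈ s, F i ω) (∑ i ∈ s, a i) := by
  classical
  induction s using Finset.induction_on with
  | empty => exact ⟨by simp, by simp⟩
  | insert i s hi ih =>
    simp only [Finset.sum_insert hi]
    exact (h i (Finset.mem_insert_self _ _)).add
      (ih fun j hj => h j (Finset.mem_insert_of_mem hj))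

/-- Cauchy–Schwarz. -/
lemma L1Le.mul (hF : MemLp F 2 μ) (hG : MemLp G 2 μ) (ha : ∫ ω, F ω ^ 2 ∂μ ≤ a)
    (hb : ∫ ω, G ω ^ 2 ∂μ ≤ b) : L1Le μ (fun ω => F ω * G ω) (√a * √b) := by
  refine ⟨hF.integrable_mul hG, ?_⟩
  have h := integral_mul_norm_le_Lp_mul_Lq (μ := μ) (f := F) (g := G) Real.HolderConjugate.two_two
    (by simpa using hF) (by simpa using hG)
  simp only [Real.norm_eq_abs, Real.rpow_two, sq_abs, ← Real.sqrt_eq_rpow, ← abs_mul] at h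
  exact h.trans (mul_le_mul (Real.sqrt_le_sqrt ha) (Real.sqrt_le_sqrt hb) (Real.sqrt_nonneg _)
    (Real.sqrt_nonneg _))

lemma L1Le.of_sq [IsProbabilityMeasure μ] (hF : MemLp F 2 μ) (ha : ∫ ω, F ω ^ 2 ∂μ ≤ a) :
    L1Le μ F √a := by
  have h := L1Le.mul hF (memLp_const (1 : ℝ)) ha (b := 1) (by simp)
  simpa using h

end LOne

/-! ### Linear to quadrilinear forms, written as iterated sums. -/

section Forms

variable {Ω : Type*} {mΩ : MeasurableSpace Ω} {μ : Measure Ω} [IsProbabilityMeasure μ]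
  {ι : Type*} {𝓕 : ι → MeasurableSpace Ω} {m : ℝ}
  {x y z t : ι → Ω → ℝ}

lemma NoiseFamily.integrable (hx : NoiseFamily μ 𝓕 m x) (k : ι) : Integrable (x k) μ :=
  (hx.memLp k).integrable one_le_two

lemma NoiseFamily.sq_integral_le (hx : NoiseFamily μ 𝓕 m x) (k : ι) :
    (∫ ω, x k ω ∂μ) ^ 2 ≤ m := by
  have h := L1Le.of_sq (hx.memLp k) (hx.sq_le k)
  have h0 : 0 ≤ m := (integral_nonneg fun ω => sq_nonneg _).trans (hx.sq_le k)
  rw [← sq_abs, ← Real.sq_sqrt h0]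
  exact pow_le_pow_left₀ (abs_nonneg _) (abs_integral_le_integral_abs.trans h.2) 2

/-- The variance is at most the second moment, so centring keeps the same constant. -/
lemma NoiseFamily.center (hx : NoiseFamily μ 𝓕 m x) :
    NoiseFamily μ 𝓕 m fun k ω => x k ω - ∫ ω', x k ω' ∂μ where
  meas k := (hx.meas k).sub_const _
  memLp k := (hx.memLp k).sub (memLp_const _)
  sq_le k := by
    have h1 : ∀ ω, (x k ω - ∫ ω', x k ω' ∂μ) ^ 2 =
        x k ω ^ 2 - 2 * (∫ ω', x k ω' ∂μ) * x k ω + (∫ ω', x k ω' ∂μ) ^ 2 := fun ω => by ring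
    have i1 := (hx.memLp k).integrable_sq
    have i2 := (hx.integrable k).const_mul (2 * ∫ ω', x k ω' ∂μ)
    simp_rw [h1]
    have i3 : Integrable (fun ω => x k ω ^ 2 - 2 * (∫ ω', x k ω' ∂μ) * x k ω) μ := i1.sub i2
    rw [integral_add i3 (integrable_const _), integral_sub i1 i2, integral_const_mul]
    simp only [integral_const, probReal_univ, smul_eq_mul, one_mul]
    have := hx.sq_le k
    nlinarith [sq_nonneg (∫ ω', x k ω' ∂μ)]

lemma NoiseFamily.integral_center (hx : NoiseFamily μ 𝓕 m x) (k : ι) :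
    ∫ ω, (x k ω - ∫ ω', x k ω' ∂μ) ∂μ = 0 := by
  rw [integral_sub (hx.integrable k) (integrable_const _)]
  simp

variable [Fintype ι]

lemma sum_fin_succ_fun {r : ℕ} (g : (Fin (r + 1) → ι) → ℝ) :
    ∑ i, g i = ∑ a, ∑ i : Fin r → ι, g (Fin.cons a i) := by
  rw [← (Fin.consEquiv fun _ : Fin (r + 1) => ι).sum_comp, Fintype.sum_prod_type]
  rfl

lemma sum_fin_one_fun (g : ι → ℝ) : ∑ i : Fin 1 → ι, g (i 0) = ∑ a, g a := by
  simp [sum_fin_succ_fun]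

lemma sum_fin_two_fun (g : ι → ι → ℝ) :
    ∑ i : Fin 2 → ι, g (i 0) (i 1) = ∑ a, ∑ b, g a b := by
  rw [sum_fin_succ_fun]
  refine Finset.sum_congr rfl fun a _ => ?_
  simpa using sum_fin_one_fun (g a)

lemma sum_fin_three_fun (g : ι → ι → ι → ℝ) :
    ∑ i : Fin 3 → ι, g (i 0) (i 1) (i 2) = ∑ a, ∑ b, ∑ c, g a b c := by
  rw [sum_fin_succ_fun]
  refine Finset.sum_congr rfl fun a _ => ?_
  exact sum_fin_two_fun (g a)

lemma sum_fin_four_fun (g : ι → ι → ι → ι → ℝ) :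
    ∑ i : Fin 4 → ι, g (i 0) (i 1) (i 2) (i 3) = ∑ a, ∑ b, ∑ c, ∑ d, g a b c d := by
  rw [sum_fin_succ_fun]
  refine Finset.sum_congr rfl fun a _ => ?_
  exact sum_fin_three_fun (g a)

variable [DecidableEq ι]

lemma sq_linear_le (hle : ∀ k, 𝓕 k ≤ mΩ) (hind : iIndep 𝓕 μ) (hm : 0 ≤ m)
    (hx : NoiseFamily μ 𝓕 m x) (hx0 : ∀ k, ∫ ω, x k ω ∂μ = 0) (c : ι → ℝ) :
    MemLp (fun ω => ∑ i, c i * x i ω) 2 μ ∧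
      ∫ ω, (∑ i, c i * x i ω) ^ 2 ∂μ ≤ m * ∑ i, c i ^ 2 := by
  have h := sq_multilinear_le (r := 1) hle hind hm (x := ![x]) (by simpa using hx)
    (by simpa using hx0) (fun i => c (i 0))
    (fun i hi => absurd (Function.injective_of_subsingleton i) hi)
  simp only [Fin.prod_univ_succ, Fin.prod_univ_zero, Matrix.cons_val_zero, mul_one,
    Nat.cast_one, pow_one, one_mul] at h
  have e : ∀ ω, ∑ i : Fin 1 → ι, c (i 0) * x (i 0) ω = ∑ i, c i * x i ω :=
    fun ω => sum_fin_one_fun fun i => c i * x i ω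
  simp only [e] at h
  rwa [sum_fin_one_fun fun i => c i ^ 2] at h

lemma sq_bilinear_le (hle : ∀ k, 𝓕 k ≤ mΩ) (hind : iIndep 𝓕 μ) (hm : 0 ≤ m)
    (hx : NoiseFamily μ 𝓕 m x) (hx0 : ∀ k, ∫ ω, x k ω ∂μ = 0)
    (hy : NoiseFamily μ 𝓕 m y) (hy0 : ∀ k, ∫ ω, y k ω ∂μ = 0) (c : ι → ι → ℝ)
    (hc : ∀ i, c i i = 0) :
    MemLp (fun ω => ∑ i, ∑ j, c i j * (x i ω * y j ω)) 2 μ ∧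
      ∫ ω, (∑ i, ∑ j, c i j * (x i ω * y j ω)) ^ 2 ∂μ ≤ 4 * m ^ 2 * ∑ i, ∑ j, c i j ^ 2 := by
  have h := sq_multilinear_le (r := 2) hle hind hm (x := ![x, y])
    (by simp [Fin.forall_fin_two, hx, hy]) (by simp [Fin.forall_fin_two, hx0, hy0])
    (fun i => c (i 0) (i 1)) (fun i hi => by
      have : i 0 = i 1 := by
        by_contra hne
        refine hi fun a b hab => ?_
        fin_cases a <;> fin_cases b <;> simp_all [eq_comm]
      rw [this]; exact hc _)
  have e : ∀ ω, ∑ i : Fin 2 → ι, c (i 0) (i 1) * ∏ s, (![x, y] : Fin 2 → ι → Ω → ℝ) s (i s) ω =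
      ∑ i, ∑ j, c i j * (x i ω * y j ω) := fun ω => by
    rw [← sum_fin_two_fun fun i j => c i j * (x i ω * y j ω)]
    simp [Fin.prod_univ_succ]
  simp only [e] at h
  rw [sum_fin_two_fun fun i j => c i j ^ 2] at h
  norm_num at h
  exact h

lemma sq_trilinear_le (hle : ∀ k, 𝓕 k ≤ mΩ) (hind : iIndep 𝓕 μ) (hm : 0 ≤ m)
    (hx : NoiseFamily μ 𝓕 m x) (hx0 : ∀ k, ∫ ω, x k ω ∂μ = 0)
    (hy : NoiseFamily μ 𝓕 m y) (hy0 : ∀ k, ∫ ω, y k ω ∂μ = 0)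
    (hz : NoiseFamily μ 𝓕 m z) (hz0 : ∀ k, ∫ ω, z k ω ∂μ = 0) (c : ι → ι → ι → ℝ)
    (hc : ∀ i j k, i = j ∨ i = k ∨ j = k → c i j k = 0) :
    MemLp (fun ω => ∑ i, ∑ j, ∑ k, c i j k * (x i ω * y j ω * z k ω)) 2 μ ∧
      ∫ ω, (∑ i, ∑ j, ∑ k, c i j k * (x i ω * y j ω * z k ω)) ^ 2 ∂μ ≤
        27 * m ^ 3 * ∑ i, ∑ j, ∑ k, c i j k ^ 2 := by
  have h := sq_multilinear_le (r := 3) hle hind hm (x := ![x, y, z])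
    (by simp [Fin.forall_fin_succ, hx, hy, hz]) (by simp [Fin.forall_fin_succ, hx0, hy0, hz0])
    (fun i => c (i 0) (i 1) (i 2)) (fun i hi => by
      refine hc _ _ _ ?_
      by_contra! hne
      refine hi fun a b hab => ?_
      fin_cases a <;> fin_cases b <;> simp_all [eq_comm])
  have e : ∀ ω, ∑ i : Fin 3 → ι, c (i 0) (i 1) (i 2) *
      ∏ s, (![x, y, z] : Fin 3 → ι → Ω → ℝ) s (i s) ω =
      ∑ i, ∑ j, ∑ k, c i j k * (x i ω * y j ω * z k ω) := fun ω => by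
    rw [← sum_fin_three_fun fun i j k => c i j k * (x i ω * y j ω * z k ω)]
    simp [Fin.prod_univ_succ, mul_assoc]
  simp only [e] at h
  rw [sum_fin_three_fun fun i j k => c i j k ^ 2] at h
  norm_num at h
  exact h

lemma sq_quadrilinear_le (hle : ∀ k, 𝓕 k ≤ mΩ) (hind : iIndep 𝓕 μ) (hm : 0 ≤ m)
    (hx : NoiseFamily μ 𝓕 m x) (hx0 : ∀ k, ∫ ω, x k ω ∂μ = 0)
    (hy : NoiseFamily μ 𝓕 m y) (hy0 : ∀ k, ∫ ω, y k ω ∂μ = 0)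
    (hz : NoiseFamily μ 𝓕 m z) (hz0 : ∀ k, ∫ ω, z k ω ∂μ = 0)
    (ht : NoiseFamily μ 𝓕 m t) (ht0 : ∀ k, ∫ ω, t k ω ∂μ = 0) (c : ι → ι → ι → ι → ℝ)
    (hc : ∀ i j k l, i = j ∨ i = k ∨ i = l ∨ j = k ∨ j = l ∨ k = l → c i j k l = 0) :
    MemLp (fun ω => ∑ i, ∑ j, ∑ k, ∑ l, c i j k l * (x i ω * y j ω * z k ω * t l ω)) 2 μ ∧
      ∫ ω, (∑ i, ∑ j, ∑ k, ∑ l, c i j k l * (x i ω * y j ω * z k ω * t l ω)) ^ 2 ∂μ ≤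
        256 * m ^ 4 * ∑ i, ∑ j, ∑ k, ∑ l, c i j k l ^ 2 := by
  have h := sq_multilinear_le (r := 4) hle hind hm (x := ![x, y, z, t])
    (by simp [Fin.forall_fin_succ, hx, hy, hz, ht])
    (by simp [Fin.forall_fin_succ, hx0, hy0, hz0, ht0])
    (fun i => c (i 0) (i 1) (i 2) (i 3)) (fun i hi => by
      refine hc _ _ _ _ ?_
      by_contra! hne
      refine hi fun a b hab => ?_
      fin_cases a <;> fin_cases b <;> simp_all [eq_comm])
  have e : ∀ ω, ∑ i : Fin 4 → ι, c (i 0) (i 1) (i 2) (i 3) *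
      ∏ s, (![x, y, z, t] : Fin 4 → ι → Ω → ℝ) s (i s) ω =
      ∑ i, ∑ j, ∑ k, ∑ l, c i j k l * (x i ω * y j ω * z k ω * t l ω) := fun ω => by
    rw [← sum_fin_four_fun fun i j k l => c i j k l * (x i ω * y j ω * z k ω * t l ω)]
    simp [Fin.prod_univ_succ, mul_assoc]
  simp only [e] at h
  rw [sum_fin_four_fun fun i j k l => c i j k l ^ 2] at h
  norm_num at h
  exact h

end Forms

/-! ## Orthogonal projections -/

/-- `P` is the matrix of an orthogonal projection. -/
structure IsProjection {ι : Type*} [Fintype ι] (P : Matrix ι ι ℝ) : Prop where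
  symm : Pᵀ = P
  idem : P * P = P

namespace IsProjection

variable {ι : Type*} [Fintype ι] {P : Matrix ι ι ℝ}

lemma apply_comm (hP : IsProjection P) (i j : ι) : P i j = P j i :=
  congrFun (congrFun hP.symm j) i

/-- The diagonal of P·Pᵀ = P. This identity is the source of all summability of weights below. -/
lemma sum_sq (hP : IsProjection P) (i : ι) : ∑ j, P i j ^ 2 = P i i := by
  conv_rhs => rw [← hP.idem, Matrix.mul_apply]
  exact Finset.sum_congr rfl fun j _ => by rw [sq, hP.apply_comm j i]

lemma sum_sq' (hP : IsProjection P) (i : ι) : ∑ j, P j i ^ 2 = P i i := by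
  rw [← hP.sum_sq i]
  exact Finset.sum_congr rfl fun j _ => by rw [hP.apply_comm j i]

lemma diag_nonneg (hP : IsProjection P) (i : ι) : 0 ≤ P i i := by
  rw [← hP.sum_sq i]; exact Finset.sum_nonneg fun j _ => sq_nonneg _

lemma sq_le_diag (hP : IsProjection P) (i j : ι) : P i j ^ 2 ≤ P i i := by
  rw [← hP.sum_sq i]
  exact Finset.single_le_sum (f := fun j => P i j ^ 2) (fun j _ => sq_nonneg _)
    (Finset.mem_univ j)

lemma diag_le_one (hP : IsProjection P) (i : ι) : P i i ≤ 1 := by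
  have h1 := hP.sq_le_diag i i
  nlinarith [hP.diag_nonneg i]

lemma sq_le_one (hP : IsProjection P) (i j : ι) : P i j ^ 2 ≤ 1 :=
  (hP.sq_le_diag i j).trans (hP.diag_le_one i)

lemma abs_le_one (hP : IsProjection P) (i j : ι) : |P i j| ≤ 1 :=
  (sq_le_one_iff_abs_le_one _).1 (hP.sq_le_one i j)

lemma sum_sq_le_one (hP : IsProjection P) (i : ι) : ∑ j, P i j ^ 2 ≤ 1 :=
  (hP.sum_sq i).le.trans (hP.diag_le_one i)

lemma diag_sq_le (hP : IsProjection P) (i : ι) : P i i ^ 2 ≤ P i i := hP.sq_le_diag i i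

lemma trace_nonneg (hP : IsProjection P) : 0 ≤ P.trace :=
  Finset.sum_nonneg fun i _ => hP.diag_nonneg i

lemma sum_sq_mulVec (hP : IsProjection P) (z : ι → ℝ) :
    ∑ k, (P *ᵥ z) k ^ 2 = z ⬝ᵥ (P *ᵥ z) := by
  have h : (P *ᵥ z) ⬝ᵥ (P *ᵥ z) = z ⬝ᵥ (P *ᵥ z) := by
    rw [Matrix.dotProduct_mulVec, ← Matrix.mulVec_transpose, hP.symm, Matrix.mulVec_mulVec, hP.idem,
      dotProduct_comm]
  rw [← h]
  exact Finset.sum_congr rfl fun k _ => sq _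

variable [DecidableEq ι]

lemma compl (hP : IsProjection P) : IsProjection (1 - P) where
  symm := by rw [Matrix.transpose_sub, hP.symm, Matrix.transpose_one]
  idem := by rw [Matrix.mul_sub, Matrix.sub_mul, Matrix.sub_mul, hP.idem]; simp

/-- Pythagoras: ‖z‖² − ‖Pz‖² = ‖(1 − P)z‖² ≥ 0. -/
lemma sum_sq_mulVec_le (hP : IsProjection P) (z : ι → ℝ) :
    ∑ k, (P *ᵥ z) k ^ 2 ≤ ∑ k, z k ^ 2 := by
  have h1 := hP.compl.sum_sq_mulVec z
  have h2 : 0 ≤ ∑ k, ((1 - P) *ᵥ z) k ^ 2 := Finset.sum_nonneg fun k _ => sq_nonneg _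
  rw [h1, Matrix.sub_mulVec, Matrix.one_mulVec, dotProduct_sub] at h2
  rw [hP.sum_sq_mulVec z]
  have h3 : z ⬝ᵥ z = ∑ k, z k ^ 2 := Finset.sum_congr rfl fun k _ => (sq _).symm
  linarith

end IsProjection

/-! ## `L¹` bounds for weighted sums of products of independent random variables -/

section Patterns

variable {Ω : Type*} {mΩ : MeasurableSpace Ω} {μ : Measure Ω} [IsProbabilityMeasure μ]
  {ι : Type*} {𝓕 : ι → MeasurableSpace Ω} {m : ℝ} {x y z t : ι → Ω → ℝ}

lemma L1Le.of_sq_le {F : Ω → ℝ} {c K : ℝ} (hc : 0 ≤ c)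
    (h : MemLp F 2 μ ∧ ∫ ω, F ω ^ 2 ∂μ ≤ c ^ 2 * K) : L1Le μ F (c * √K) := by
  have := L1Le.of_sq h.1 h.2
  rwa [Real.sqrt_mul (sq_nonneg c), Real.sqrt_sq hc] at this

lemma NoiseFamily.abs_integral_le (hx : NoiseFamily μ 𝓕 m x) (k : ι) :
    |∫ ω, x k ω ∂μ| ≤ √m := Real.abs_le_sqrt (hx.sq_integral_le k)

variable [Fintype ι] {P : Matrix ι ι ℝ} {a : ℝ}

lemma sum_rotate (f : ι → ι → ι → ℝ) :
    ∑ j, ∑ k, ∑ i, f i j k = ∑ i, ∑ j, ∑ k, f i j k := by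
  rw [Finset.sum_comm (s := (Finset.univ : Finset ι)) (t := (Finset.univ : Finset ι))
    (f := fun i j => ∑ k, f i j k)]
  exact Finset.sum_congr rfl fun j _ => Finset.sum_comm

lemma sq_sum_mul_le (hm : 0 ≤ m) (c u : ι → ℝ) (hu : ∀ i, |u i| ≤ √m) :
    (∑ i, c i * u i) ^ 2 ≤ m * (∑ i, |c i|) ^ 2 := by
  have h : |∑ i, c i * u i| ≤ √m * ∑ i, |c i| := by
    refine (Finset.abs_sum_le_sum_abs _ _).trans ?_
    rw [Finset.mul_sum]
    refine Finset.sum_le_sum fun i _ => ?_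
    rw [abs_mul, mul_comm]
    exact mul_le_mul_of_nonneg_right (hu i) (abs_nonneg _)
  calc (∑ i, c i * u i) ^ 2 = |∑ i, c i * u i| ^ 2 := (sq_abs _).symm
    _ ≤ (√m * ∑ i, |c i|) ^ 2 := pow_le_pow_left₀ (abs_nonneg _) h 2
    _ = m * (∑ i, |c i|) ^ 2 := by rw [mul_pow, Real.sq_sqrt hm]

variable [DecidableEq ι]

/-- Concentration of a bilinear form with weights of the order of `Pᵢⱼ²`. -/
lemma L1Le.two_index (hP : IsProjection P) (hle : ∀ k, 𝓕 k ≤ mΩ) (hind : iIndep 𝓕 μ) (hm : 1 ≤ m)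
    (ha : 0 ≤ a) (hx : NoiseFamily μ 𝓕 m x) (hy : NoiseFamily μ 𝓕 m y) (c : ι → ι → ℝ)
    (hc : ∀ i, c i i = 0) (hb : ∀ i j, |c i j| ≤ a * P i j ^ 2) :
    L1Le μ (fun ω => ∑ i, ∑ j, c i j * (x i ω * y j ω)
      - ∑ i, ∑ j, c i j * ((∫ ω', x i ω' ∂μ) * ∫ ω', y j ω' ∂μ)) (16 * m ^ 2 * a * √P.trace) := by
  have hm0 : 0 ≤ m := zero_le_one.trans hm
  have hrow : ∀ i, (∑ j, |c i j|) ^ 2 ≤ a ^ 2 * P i i := fun i => by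
    have : ∑ j, |c i j| ≤ a * P i i := by
      rw [← hP.sum_sq i, Finset.mul_sum]; exact Finset.sum_le_sum fun j _ => hb i j
    calc _ ≤ (a * P i i) ^ 2 :=
          pow_le_pow_left₀ (Finset.sum_nonneg fun j _ => abs_nonneg _) this 2
      _ = a ^ 2 * P i i ^ 2 := by ring
      _ ≤ _ := mul_le_mul_of_nonneg_left (hP.diag_sq_le i) (sq_nonneg _)
  have hcol : ∀ j, (∑ i, |c i j|) ^ 2 ≤ a ^ 2 * P j j := fun j => by
    have : ∑ i, |c i j| ≤ a * P j j := by
      rw [← hP.sum_sq' j, Finset.mul_sum]; exact Finset.sum_le_sum fun i _ => hb i j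
    calc _ ≤ (a * P j j) ^ 2 :=
          pow_le_pow_left₀ (Finset.sum_nonneg fun j _ => abs_nonneg _) this 2
      _ = a ^ 2 * P j j ^ 2 := by ring
      _ ≤ _ := mul_le_mul_of_nonneg_left (hP.diag_sq_le j) (sq_nonneg _)
  have hsum : ∑ i, a ^ 2 * P i i = a ^ 2 * P.trace := by rw [← Finset.mul_sum]; rfl
  -- With x = x̃ + Ex and y = ỹ + Ey, the deviation xy − Ex·Ey is x̃ỹ + x̃·Ey + Ex·ỹ: one bilinear
  -- and two linear centred forms, treated in `h1`, `h2` and `h3`.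
  have h1 : L1Le μ (fun ω => ∑ i, ∑ j, c i j *
      ((x i ω - ∫ ω', x i ω' ∂μ) * (y j ω - ∫ ω', y j ω' ∂μ))) (2 * m * a * √P.trace) := by
    refine L1Le.of_sq_le (by positivity) ?_
    obtain ⟨h, h'⟩ := sq_bilinear_le hle hind hm0 hx.center hx.integral_center hy.center
      hy.integral_center c hc
    refine ⟨h, h'.trans ?_⟩
    have : ∑ i, ∑ j, c i j ^ 2 ≤ a ^ 2 * P.trace := by
      rw [← hsum]
      refine Finset.sum_le_sum fun i _ => le_trans ?_ (hrow i)
      simp_rw [← sq_abs (c i _)]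
      exact Finset.sum_sq_le_sq_sum_of_nonneg fun j _ => abs_nonneg _
    calc _ ≤ 4 * m ^ 2 * (a ^ 2 * P.trace) := by gcongr
      _ = _ := by ring
  have h2 : L1Le μ (fun ω => ∑ i, (∑ j, c i j * ∫ ω', y j ω' ∂μ) * (x i ω - ∫ ω', x i ω' ∂μ))
      (m * a * √P.trace) := by
    refine L1Le.of_sq_le (by positivity) ?_
    obtain ⟨h, h'⟩ := sq_linear_le hle hind hm0 hx.center hx.integral_center
      fun i => ∑ j, c i j * ∫ ω', y j ω' ∂μ
    refine ⟨h, h'.trans ?_⟩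
    calc _ ≤ m * ∑ i, m * (a ^ 2 * P i i) := by
          gcongr with i
          exact (sq_sum_mul_le hm0 _ _ hy.abs_integral_le).trans
            (mul_le_mul_of_nonneg_left (hrow i) hm0)
      _ = _ := by rw [← Finset.mul_sum, hsum]; ring
  have h3 : L1Le μ (fun ω => ∑ j, (∑ i, c i j * ∫ ω', x i ω' ∂μ) * (y j ω - ∫ ω', y j ω' ∂μ))
      (m * a * √P.trace) := by
    refine L1Le.of_sq_le (by positivity) ?_
    obtain ⟨h, h'⟩ := sq_linear_le hle hind hm0 hy.center hy.integral_center
      fun j => ∑ i, c i j * ∫ ω', x i ω' ∂μ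
    refine ⟨h, h'.trans ?_⟩
    calc _ ≤ m * ∑ i, m * (a ^ 2 * P i i) := by
          gcongr with i
          exact (sq_sum_mul_le hm0 _ _ hx.abs_integral_le).trans
            (mul_le_mul_of_nonneg_left (hcol i) hm0)
      _ = _ := by rw [← Finset.mul_sum, hsum]; ring
  refine (((h1.add h2).add h3).congr fun ω => ?_).mono ?_
  · simp only [Finset.sum_mul]
    rw [Finset.sum_comm (f := fun j i => c i j * (∫ ω', x i ω' ∂μ) * (y j ω - ∫ ω', y j ω' ∂μ))]
    simp only [← Finset.sum_add_distrib, ← Finset.sum_sub_distrib]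
    refine Finset.sum_congr rfl fun i _ => Finset.sum_congr rfl fun j _ => ?_
    ring
  -- The total is only 4. The constant 16 is shared by all index patterns and is dictated by
  -- `L1Le.four_index`, where 256 = 16².
  · have : m * a * √P.trace ≤ m ^ 2 * a * √P.trace := by
      gcongr; nlinarith
    have : 0 ≤ m ^ 2 * a * √P.trace := by positivity
    linarith

/-- A trilinear form in two centred and one arbitrary noise families. -/
lemma L1Le.three_index (hP : IsProjection P) (hle : ∀ k, 𝓕 k ≤ mΩ) (hind : iIndep 𝓕 μ)
    (hm : 1 ≤ m) (ha : 0 ≤ a) (hx : NoiseFamily μ 𝓕 m x)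
    (hy : NoiseFamily μ 𝓕 m y) (hy0 : ∀ k, ∫ ω, y k ω ∂μ = 0)
    (hz : NoiseFamily μ 𝓕 m z) (hz0 : ∀ k, ∫ ω, z k ω ∂μ = 0) (c : ι → ι → ι → ℝ)
    (hc : ∀ i j k, i = j ∨ i = k ∨ j = k → c i j k = 0)
    (hQ : ∑ i, ∑ j, ∑ k, c i j k ^ 2 ≤ a ^ 2 * P.trace)
    (hQ' : ∑ j, ∑ k, (∑ i, c i j k * ∫ ω, x i ω ∂μ) ^ 2 ≤ m * (4 * a ^ 2 * P.trace)) :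
    L1Le μ (fun ω => ∑ i, ∑ j, ∑ k, c i j k * (x i ω * y j ω * z k ω))
      (16 * m ^ 2 * a * √P.trace) := by
  have hm0 : 0 ≤ m := zero_le_one.trans hm
  have hT := hP.trace_nonneg
  have hm3 : m ^ 3 ≤ m ^ 4 := pow_le_pow_right₀ hm (by norm_num)
  -- The uncentred family is split into noise and mean, leaving a trilinear form and a bilinear form
  -- whose weights are summed against the mean. The two constants add up to 6 + 4 ≤ 16.
  have h1 : L1Le μ (fun ω => ∑ i, ∑ j, ∑ k, c i j k *
      ((x i ω - ∫ ω', x i ω' ∂μ) * y j ω * z k ω)) (6 * m ^ 2 * a * √P.trace) := by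
    refine L1Le.of_sq_le (by positivity) ?_
    obtain ⟨h, h'⟩ := sq_trilinear_le hle hind hm0 hx.center hx.integral_center hy hy0 hz hz0 c hc
    refine ⟨h, h'.trans ?_⟩
    calc _ ≤ 27 * m ^ 3 * (a ^ 2 * P.trace) := by gcongr
      _ ≤ 36 * m ^ 4 * (a ^ 2 * P.trace) := by gcongr; norm_num
      _ = _ := by ring
  have h2 : L1Le μ (fun ω => ∑ j, ∑ k, (∑ i, c i j k * ∫ ω', x i ω' ∂μ) * (y j ω * z k ω))
      (4 * m ^ 2 * a * √P.trace) := by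
    refine L1Le.of_sq_le (by positivity) ?_
    obtain ⟨h, h'⟩ := sq_bilinear_le hle hind hm0 hy hy0 hz hz0
      (fun j k => ∑ i, c i j k * ∫ ω', x i ω' ∂μ)
      (fun j => Finset.sum_eq_zero fun i _ => by rw [hc i j j (by simp), zero_mul])
    refine ⟨h, h'.trans ?_⟩
    calc _ ≤ 4 * m ^ 2 * (m * (4 * a ^ 2 * P.trace)) := by gcongr
      _ = 16 * m ^ 3 * (a ^ 2 * P.trace) := by ring
      _ ≤ 16 * m ^ 4 * (a ^ 2 * P.trace) := by gcongr
      _ = _ := by ring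
  refine ((h1.add h2).congr fun ω => ?_).mono ?_
  · simp only [Finset.sum_mul]
    rw [sum_rotate fun i j k => c i j k * (∫ ω', x i ω' ∂μ) * (y j ω * z k ω)]
    simp only [← Finset.sum_add_distrib]
    refine Finset.sum_congr rfl fun i _ => Finset.sum_congr rfl fun j _ =>
      Finset.sum_congr rfl fun k _ => ?_
    ring
  · have : 0 ≤ m ^ 2 * a * √P.trace := by positivity
    linarith

/-- A sum of squares of nonnegative numbers is at most the square of their sum, so one bound on the
absolute weights summed over `i` controls both the trilinear part and the part averaged over the
mean. -/
lemma L1Le.three_index_abs (hP : IsProjection P) (hle : ∀ k, 𝓕 k ≤ mΩ) (hind : iIndep 𝓕 μ)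
    (hm : 1 ≤ m) (ha : 0 ≤ a) (hx : NoiseFamily μ 𝓕 m x)
    (hy : NoiseFamily μ 𝓕 m y) (hy0 : ∀ k, ∫ ω, y k ω ∂μ = 0)
    (hz : NoiseFamily μ 𝓕 m z) (hz0 : ∀ k, ∫ ω, z k ω ∂μ = 0) (c : ι → ι → ι → ℝ)
    (hc : ∀ i j k, i = j ∨ i = k ∨ j = k → c i j k = 0)
    (hQ : ∑ j, ∑ k, (∑ i, |c i j k|) ^ 2 ≤ a ^ 2 * P.trace) :
    L1Le μ (fun ω => ∑ i, ∑ j, ∑ k, c i j k * (x i ω * y j ω * z k ω))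
      (16 * m ^ 2 * a * √P.trace) := by
  have hm0 : 0 ≤ m := zero_le_one.trans hm
  refine L1Le.three_index hP hle hind hm ha hx hy hy0 hz hz0 c hc ?_ ?_
  · rw [← sum_rotate fun i j k => c i j k ^ 2]
    refine le_trans (Finset.sum_le_sum fun j _ => Finset.sum_le_sum fun k _ => ?_) hQ
    simp_rw [← sq_abs (c _ j k)]
    exact Finset.sum_sq_le_sq_sum_of_nonneg fun j _ => abs_nonneg _
  · calc _ ≤ ∑ j, ∑ k, m * (∑ i, |c i j k|) ^ 2 := Finset.sum_le_sum fun j _ =>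
          Finset.sum_le_sum fun k _ => sq_sum_mul_le hm0 _ _ hx.abs_integral_le
      _ = m * ∑ j, ∑ k, (∑ i, |c i j k|) ^ 2 := by simp only [Finset.mul_sum]
      _ ≤ m * (a ^ 2 * P.trace) := by gcongr
      _ ≤ _ := by
        have : 0 ≤ a ^ 2 * P.trace := mul_nonneg (sq_nonneg _) hP.trace_nonneg
        exact mul_le_mul_of_nonneg_left (by linarith) hm0

omit [DecidableEq ι] in
lemma sum_diag_mul (b : ℝ) (P : Matrix ι ι ℝ) : ∑ i, b * P i i = b * P.trace := by
  rw [← Finset.mul_sum]; rfl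

/-- Weights `Pᵢⱼ² Nⱼₖ`, where `i` is the index that need not be centred. -/
lemma L1Le.three_index_chain (hP : IsProjection P) (hle : ∀ k, 𝓕 k ≤ mΩ) (hind : iIndep 𝓕 μ)
    (hm : 1 ≤ m) (ha : 0 ≤ a) (hx : NoiseFamily μ 𝓕 m x)
    (hy : NoiseFamily μ 𝓕 m y) (hy0 : ∀ k, ∫ ω, y k ω ∂μ = 0)
    (hz : NoiseFamily μ 𝓕 m z) (hz0 : ∀ k, ∫ ω, z k ω ∂μ = 0) (c : ι → ι → ι → ℝ)
    (hc : ∀ i j k, i = j ∨ i = k ∨ j = k → c i j k = 0) (N : ι → ι → ℝ)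
    (hN : ∀ j, ∑ k, N j k ^ 2 ≤ 1) (hb : ∀ i j k, |c i j k| ≤ a * P i j ^ 2 * |N j k|) :
    L1Le μ (fun ω => ∑ i, ∑ j, ∑ k, c i j k * (x i ω * y j ω * z k ω))
      (16 * m ^ 2 * a * √P.trace) := by
  refine L1Le.three_index_abs hP hle hind hm ha hx hy hy0 hz hz0 c hc ?_
  rw [← sum_diag_mul]
  refine Finset.sum_le_sum fun j _ => ?_
  calc ∑ k, (∑ i, |c i j k|) ^ 2 ≤ ∑ k, (a * P j j * |N j k|) ^ 2 := by
        refine Finset.sum_le_sum fun k _ => ?_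
        refine pow_le_pow_left₀ (Finset.sum_nonneg fun i _ => abs_nonneg _) ?_ 2
        rw [← hP.sum_sq' j, Finset.mul_sum, Finset.sum_mul]
        exact Finset.sum_le_sum fun i _ => hb i j k
    _ = (a * P j j) ^ 2 * ∑ k, N j k ^ 2 := by
        rw [Finset.mul_sum]
        exact Finset.sum_congr rfl fun k _ => by rw [mul_pow, sq_abs]
    _ ≤ (a * P j j) ^ 2 * 1 := by gcongr; exact hN j
    _ = a ^ 2 * P j j ^ 2 := by ring
    _ ≤ _ := mul_le_mul_of_nonneg_left (hP.diag_sq_le j) (sq_nonneg _)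

/-- Weights `Pᵢⱼ² Nᵢₖ`, where `i` is the index that need not be centred. -/
lemma L1Le.three_index_star (hP : IsProjection P) (hle : ∀ k, 𝓕 k ≤ mΩ) (hind : iIndep 𝓕 μ)
    (hm : 1 ≤ m) (ha : 0 ≤ a) (hx : NoiseFamily μ 𝓕 m x)
    (hy : NoiseFamily μ 𝓕 m y) (hy0 : ∀ k, ∫ ω, y k ω ∂μ = 0)
    (hz : NoiseFamily μ 𝓕 m z) (hz0 : ∀ k, ∫ ω, z k ω ∂μ = 0) (c : ι → ι → ι → ℝ)
    (hc : ∀ i j k, i = j ∨ i = k ∨ j = k → c i j k = 0) (N : ι → ι → ℝ)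
    (hN : ∀ j, ∑ k, N j k ^ 2 ≤ 1) (hb : ∀ i j k, |c i j k| ≤ a * P i j ^ 2 * |N i k|) :
    L1Le μ (fun ω => ∑ i, ∑ j, ∑ k, c i j k * (x i ω * y j ω * z k ω))
      (16 * m ^ 2 * a * √P.trace) := by
  refine L1Le.three_index_abs hP hle hind hm ha hx hy hy0 hz hz0 c hc ?_
  rw [← sum_diag_mul]
  refine Finset.sum_le_sum fun j _ => ?_
  calc ∑ k, (∑ i, |c i j k|) ^ 2
      ≤ ∑ k, a ^ 2 * ((∑ i, P i j ^ 2) * ∑ i, P i j ^ 2 * N i k ^ 2) := by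
        refine Finset.sum_le_sum fun k _ => ?_
        -- Pᵢⱼ² is shared between the two factors of Cauchy–Schwarz: one sums to Pⱼⱼ, and the other
        -- keeps Pᵢⱼ²Nᵢₖ², which can be summed over k first.
        calc _ ≤ (a * ∑ i, |P i j| * (|P i j| * |N i k|)) ^ 2 := by
              refine pow_le_pow_left₀ (Finset.sum_nonneg fun i _ => abs_nonneg _) ?_ 2
              rw [Finset.mul_sum]
              refine Finset.sum_le_sum fun i _ => (hb i j k).trans_eq ?_
              rw [← sq_abs (P i j)]; ring
          _ ≤ a ^ 2 * ((∑ i, |P i j| ^ 2) * ∑ i, (|P i j| * |N i k|) ^ 2) := by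
              rw [mul_pow]
              exact mul_le_mul_of_nonneg_left (Finset.sum_mul_sq_le_sq_mul_sq _ _ _) (sq_nonneg _)
          _ = _ := by simp only [mul_pow, sq_abs]
    _ = a ^ 2 * P j j * ∑ i, P i j ^ 2 * ∑ k, N i k ^ 2 := by
        rw [hP.sum_sq' j]
        simp only [Finset.mul_sum]
        rw [Finset.sum_comm]
        exact Finset.sum_congr rfl fun i _ => Finset.sum_congr rfl fun k _ => by ring
    _ ≤ a ^ 2 * P j j * ∑ i, P i j ^ 2 * 1 := by
        have := hP.diag_nonneg j
        gcongr with i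
        exact hN i
    _ = a ^ 2 * P j j ^ 2 := by simp only [mul_one]; rw [hP.sum_sq' j]; ring
    _ ≤ _ := mul_le_mul_of_nonneg_left (hP.diag_sq_le j) (sq_nonneg _)

/-- Weights `Pⱼₖ² Nⱼᵢ Nₖᵢ`, where `i` is the index that need not be centred. -/
lemma L1Le.three_index_triangle (hP : IsProjection P) (hle : ∀ k, 𝓕 k ≤ mΩ) (hind : iIndep 𝓕 μ)
    (hm : 1 ≤ m) (ha : 0 ≤ a) (hx : NoiseFamily μ 𝓕 m x)
    (hy : NoiseFamily μ 𝓕 m y) (hy0 : ∀ k, ∫ ω, y k ω ∂μ = 0)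
    (hz : NoiseFamily μ 𝓕 m z) (hz0 : ∀ k, ∫ ω, z k ω ∂μ = 0) (c : ι → ι → ι → ℝ)
    (hc : ∀ i j k, i = j ∨ i = k ∨ j = k → c i j k = 0) (N : ι → ι → ℝ)
    (hN : ∀ j, ∑ k, N j k ^ 2 ≤ 1)
    (hb : ∀ i j k, |c i j k| ≤ a * P j k ^ 2 * (|N j i| * |N k i|)) :
    L1Le μ (fun ω => ∑ i, ∑ j, ∑ k, c i j k * (x i ω * y j ω * z k ω))
      (16 * m ^ 2 * a * √P.trace) := by
  refine L1Le.three_index_abs hP hle hind hm ha hx hy hy0 hz hz0 c hc ?_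
  rw [← sum_diag_mul]
  refine Finset.sum_le_sum fun j _ => ?_
  rw [← hP.sum_sq j, Finset.mul_sum]
  refine Finset.sum_le_sum fun k _ => ?_
  calc (∑ i, |c i j k|) ^ 2 ≤ (a * P j k ^ 2 * ∑ i, |N j i| * |N k i|) ^ 2 := by
        refine pow_le_pow_left₀ (Finset.sum_nonneg fun i _ => abs_nonneg _) ?_ 2
        rw [Finset.mul_sum]
        exact Finset.sum_le_sum fun i _ => hb i j k
    _ ≤ (a * P j k ^ 2) ^ 2 * 1 := by
        rw [mul_pow]
        refine mul_le_mul_of_nonneg_left ?_ (sq_nonneg _)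
        refine (Finset.sum_mul_sq_le_sq_mul_sq _ _ _).trans ?_
        simp only [sq_abs]
        exact mul_le_one₀ (hN j) (Finset.sum_nonneg fun i _ => sq_nonneg _) (hN k)
    _ = a ^ 2 * (P j k ^ 2 * P j k ^ 2) := by ring
    _ ≤ a ^ 2 * (P j k ^ 2 * 1) := by gcongr; exact hP.sq_le_one j k
    _ = _ := by ring

/-- All four families are centred, so there is no mean to split off and only the sum of squared
weights matters. -/
lemma L1Le.four_index (hle : ∀ k, 𝓕 k ≤ mΩ) (hind : iIndep 𝓕 μ)
    (hm : 1 ≤ m) (ha : 0 ≤ a) (hx : NoiseFamily μ 𝓕 m x) (hx0 : ∀ k, ∫ ω, x k ω ∂μ = 0)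
    (hy : NoiseFamily μ 𝓕 m y) (hy0 : ∀ k, ∫ ω, y k ω ∂μ = 0)
    (hz : NoiseFamily μ 𝓕 m z) (hz0 : ∀ k, ∫ ω, z k ω ∂μ = 0)
    (ht : NoiseFamily μ 𝓕 m t) (ht0 : ∀ k, ∫ ω, t k ω ∂μ = 0) (c : ι → ι → ι → ι → ℝ)
    (hc : ∀ i j k l, i = j ∨ i = k ∨ i = l ∨ j = k ∨ j = l ∨ k = l → c i j k l = 0)
    (hQ : ∀ i, ∑ j, ∑ k, ∑ l, c i j k l ^ 2 ≤ a ^ 2 * P i i) :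
    L1Le μ (fun ω => ∑ i, ∑ j, ∑ k, ∑ l, c i j k l * (x i ω * y j ω * z k ω * t l ω))
      (16 * m ^ 2 * a * √P.trace) := by
  have hm0 : 0 ≤ m := zero_le_one.trans hm
  refine L1Le.of_sq_le (by positivity) ?_
  obtain ⟨h, h'⟩ := sq_quadrilinear_le hle hind hm0 hx hx0 hy hy0 hz hz0 ht ht0 c hc
  refine ⟨h, h'.trans ?_⟩
  calc _ ≤ 256 * m ^ 4 * ∑ i, a ^ 2 * P i i := by gcongr with i; exact hQ i
    _ = _ := by rw [sum_diag_mul]; ring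

/-- Weights `dᵢ Pᵢⱼ Pᵢₖ`, where `i` is the index that need not be centred. -/
lemma L1Le.three_index_proj (hP : IsProjection P) (hle : ∀ k, 𝓕 k ≤ mΩ) (hind : iIndep 𝓕 μ)
    (hm : 1 ≤ m) (hx : NoiseFamily μ 𝓕 m x)
    (hy : NoiseFamily μ 𝓕 m y) (hy0 : ∀ k, ∫ ω, y k ω ∂μ = 0)
    (hz : NoiseFamily μ 𝓕 m z) (hz0 : ∀ k, ∫ ω, z k ω ∂μ = 0) :
    L1Le μ (fun ω => ∑ i, ∑ j, ∑ k, (if i = j ∨ i = k ∨ j = k then 0 else P i j * P i k) *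
      (x i ω * y j ω * z k ω)) (16 * m ^ 2 * 1 * √P.trace) := by
  have hm0 : 0 ≤ m := zero_le_one.trans hm
  have hrow : ∀ j, ∑ i, ∑ k, (P i j * P i k) ^ 2 ≤ P j j := fun j => by
    simp_rw [mul_pow, ← Finset.mul_sum]
    calc _ ≤ ∑ i, P i j ^ 2 * 1 := by gcongr with i; exact hP.sum_sq_le_one i
      _ = P j j := by simp only [mul_one]; exact hP.sum_sq' j
  refine L1Le.three_index hP hle hind hm zero_le_one hx hy hy0 hz hz0 _
    (fun i j k h => if_pos h) ?_ ?_
  · rw [Finset.sum_comm, ← sum_diag_mul]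
    refine Finset.sum_le_sum fun j _ => ?_
    rw [one_pow, one_mul]
    refine le_trans (Finset.sum_le_sum fun i _ => Finset.sum_le_sum fun k _ => ?_) (hrow j)
    split_ifs
    · rw [zero_pow two_ne_zero]; positivity
    · exact le_rfl
  · rw [one_pow, mul_one, ← mul_assoc, ← sum_diag_mul]
    refine Finset.sum_le_sum fun j _ => ?_
    set u : ι → ℝ := fun i => ∫ ω, x i ω ∂μ
    have hu : ∀ i, u i ^ 2 ≤ m := hx.sq_integral_le
    have hz' : ∑ i, (P i j * u i) ^ 2 ≤ m * P j j := by
      rw [← hP.sum_sq' j, Finset.mul_sum]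
      refine Finset.sum_le_sum fun i _ => ?_
      rw [mul_pow, mul_comm]
      exact mul_le_mul_of_nonneg_right (hu i) (sq_nonneg _)
    -- These weights carry no square of an entry of P, so absolute values are avoided. The sum over
    -- i is the k-th entry of P applied to (Pᵢⱼuᵢ)_{i≠j}, up to the missing term i = k, and P is a
    -- contraction. The two contributions account for the factor 4 in the hypothesis `hQ'` of
    -- `L1Le.three_index`.
    have hterm : ∀ k, (∑ i, (if i = j ∨ i = k ∨ j = k then 0 else P i j * P i k) * u i) ^ 2 ≤
        2 * (P *ᵥ fun i => if i = j then 0 else P i j * u i) k ^ 2 + 2 * (P k j * u k) ^ 2 := by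
      intro k
      have h2 : (P *ᵥ fun i => if i = j then 0 else P i j * u i) k =
          ∑ i, (if i = j then 0 else P i j * P i k) * u i := by
        simp only [Matrix.mulVec, dotProduct]
        refine Finset.sum_congr rfl fun i _ => ?_
        rw [hP.apply_comm k i]
        split_ifs <;> ring
      by_cases hjk : j = k
      · rw [Finset.sum_eq_zero fun i _ => by rw [if_pos (Or.inr (Or.inr hjk)), zero_mul],
          zero_pow two_ne_zero]
        positivity
      · have h3 : ∑ i, (if i = j ∨ i = k ∨ j = k then 0 else P i j * P i k) * u i =
            (∑ i, (if i = j then 0 else P i j * P i k) * u i) - P k k * (P k j * u k) := by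
          rw [← Finset.add_sum_erase _ _ (Finset.mem_univ k),
            ← Finset.add_sum_erase _ (fun i => (if i = j then 0 else P i j * P i k) * u i)
              (Finset.mem_univ k)]
          have h4 : ∑ i ∈ Finset.univ.erase k,
              (if i = j ∨ i = k ∨ j = k then 0 else P i j * P i k) * u i =
              ∑ i ∈ Finset.univ.erase k, (if i = j then 0 else P i j * P i k) * u i := by
            refine Finset.sum_congr rfl fun i hi => ?_
            have : i ≠ k := (Finset.mem_erase.1 hi).1
            simp [this, hjk]
          rw [h4]
          simp only [true_or, or_true, if_true, if_neg (Ne.symm hjk)]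
          ring
        rw [h3, ← h2]
        have h5 : (P k k * (P k j * u k)) ^ 2 ≤ (P k j * u k) ^ 2 := by
          rw [mul_pow]
          exact mul_le_of_le_one_left (sq_nonneg _) (hP.sq_le_one k k)
        nlinarith [sq_nonneg ((P *ᵥ fun i => if i = j then 0 else P i j * u i) k
          + P k k * (P k j * u k))]
    calc _ ≤ ∑ k, (2 * (P *ᵥ fun i => if i = j then 0 else P i j * u i) k ^ 2
            + 2 * (P k j * u k) ^ 2) := Finset.sum_le_sum fun k _ => hterm k
      _ ≤ 2 * ∑ i, (P i j * u i) ^ 2 + 2 * ∑ k, (P k j * u k) ^ 2 := by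
          rw [Finset.sum_add_distrib, ← Finset.mul_sum, ← Finset.mul_sum]
          refine add_le_add_left (mul_le_mul_of_nonneg_left ?_ zero_le_two) _
          refine (hP.sum_sq_mulVec_le _).trans (Finset.sum_le_sum fun i _ => ?_)
          split_ifs
          · rw [zero_pow two_ne_zero]; positivity
          · exact le_rfl
      _ ≤ _ := by linarith

end Patterns

/-! ### The cross-fit double sum in pure noise. -/

section Noise

variable {Ω : Type*} {mΩ : MeasurableSpace Ω} {μ : Measure Ω} {ι : Type*}
  {𝓕 : ι → MeasurableSpace Ω} {m : ℝ} {x y z : ι → Ω → ℝ}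

/-- A family of random variables, the `k`th of which is measurable with respect to `𝓕 k`, with
sixth moments bounded by `m`. -/
structure SixthMoment (μ : Measure Ω) (𝓕 : ι → MeasurableSpace Ω) (m : ℝ)
    (x : ι → Ω → ℝ) : Prop where
  meas : ∀ k, Measurable[𝓕 k] (x k)
  int : ∀ k, Integrable (fun ω => x k ω ^ 6) μ
  le : ∀ k, ∫ ω, x k ω ^ 6 ∂μ ≤ m

/-- AM–GM for the squares, from A³ + B³ + C³ − 3ABC = ½(A + B + C)((A − B)² + (B − C)² + (A − C)²).
-/
lemma sq_mul_mul_le (a b c : ℝ) : (a * b * c) ^ 2 ≤ a ^ 6 / 3 + b ^ 6 / 3 + c ^ 6 / 3 := by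
  have h : ∀ A B C : ℝ, 0 ≤ A → 0 ≤ B → 0 ≤ C →
      A * B * C ≤ A ^ 3 / 3 + B ^ 3 / 3 + C ^ 3 / 3 := fun A B C hA hB hC => by
    have h1 : 0 ≤ (A + B + C) * ((A - B) ^ 2 + (B - C) ^ 2 + (A - C) ^ 2) := by positivity
    nlinarith
  have := h (a ^ 2) (b ^ 2) (c ^ 2) (sq_nonneg _) (sq_nonneg _) (sq_nonneg _)
  nlinarith

/-- The reason for sixth moments: when indices coincide, three noise factors meet at one index, and
their product must still be square integrable. -/
lemma SixthMoment.mul₃ (hle : ∀ k, 𝓕 k ≤ mΩ) (hx : SixthMoment μ 𝓕 m x)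
    (hy : SixthMoment μ 𝓕 m y) (hz : SixthMoment μ 𝓕 m z) :
    NoiseFamily μ 𝓕 m fun k ω => x k ω * y k ω * z k ω := by
  have hmeas : ∀ k, Measurable[𝓕 k] fun ω => x k ω * y k ω * z k ω :=
    fun k => ((hx.meas k).mul (hy.meas k)).mul (hz.meas k)
  have hint : ∀ k, Integrable
      (fun ω => x k ω ^ 6 / 3 + y k ω ^ 6 / 3 + z k ω ^ 6 / 3) μ := fun k =>
    (((hx.int k).div_const 3).add ((hy.int k).div_const 3)).add ((hz.int k).div_const 3)
  have hae : ∀ k, AEStronglyMeasurable (fun ω => x k ω * y k ω * z k ω) μ :=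
    fun k => ((hmeas k).mono (hle k) le_rfl).aestronglyMeasurable
  have hsq : ∀ k, Integrable (fun ω => (x k ω * y k ω * z k ω) ^ 2) μ := fun k =>
    (hint k).mono' ((hae k).pow 2) (ae_of_all _ fun ω => by
      rw [Real.norm_of_nonneg (sq_nonneg _)]; exact sq_mul_mul_le _ _ _)
  refine ⟨hmeas, fun k => (memLp_two_iff_integrable_sq (hae k)).2 (hsq k), fun k => ?_⟩
  refine (integral_mono (hsq k) (hint k) fun ω => sq_mul_mul_le _ _ _).trans ?_
  have h12 : Integrable (fun ω => x k ω ^ 6 / 3 + y k ω ^ 6 / 3) μ :=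
    ((hx.int k).div_const 3).add ((hy.int k).div_const 3)
  rw [integral_add h12 ((hz.int k).div_const 3),
    integral_add ((hx.int k).div_const 3) ((hy.int k).div_const 3), integral_div, integral_div,
    integral_div]
  have := hx.le k
  have := hy.le k
  have := hz.le k
  linarith

variable [IsProbabilityMeasure μ]

lemma SixthMoment.one (hm : 1 ≤ m) : SixthMoment μ 𝓕 m fun _ _ => 1 where
  meas _ := measurable_const
  int _ := by simp
  le _ := by simpa using hm

lemma SixthMoment.mul₂ (hle : ∀ k, 𝓕 k ≤ mΩ) (hm : 1 ≤ m) (hx : SixthMoment μ 𝓕 m x)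
    (hy : SixthMoment μ 𝓕 m y) : NoiseFamily μ 𝓕 m fun k ω => x k ω * y k ω := by
  simpa using hx.mul₃ hle hy (SixthMoment.one hm)

lemma SixthMoment.noise (hle : ∀ k, 𝓕 k ≤ mΩ) (hm : 1 ≤ m) (hx : SixthMoment μ 𝓕 m x) :
    NoiseFamily μ 𝓕 m x := by
  simpa using hx.mul₃ hle (SixthMoment.one hm) (SixthMoment.one hm)

variable [Fintype ι] [DecidableEq ι] {P : Matrix ι ι ℝ} {a : ℝ} {x₁ x₂ x₃ x₄ : ι → Ω → ℝ}

/-- `M` with the columns `i` and `j` removed. -/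
def offTwo (M : Matrix ι ι ℝ) (i j k : ι) : ℝ := if k = i ∨ k = j then 0 else M i k

omit [Fintype ι] in
lemma abs_offTwo_le (M : Matrix ι ι ℝ) (i j k : ι) : |offTwo M i j k| ≤ |M i k| := by
  unfold offTwo; split_ifs <;> simp

/-- Separates from row `i` the two entries that can coincide with the outer indices, so that the
remaining sum runs over an index distinct from both. -/
lemma mulVec_eq_offTwo (M : Matrix ι ι ℝ) (v : ι → ℝ) {i j : ι} (h : i ≠ j) :
    (M *ᵥ v) i = M i i * v i + M i j * v j + ∑ k, offTwo M i j k * v k := by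
  have h1 : ∀ k, M i k * v k = (if k = i then M i i * v i else 0) +
      (if k = j then M i j * v j else 0) + offTwo M i j k * v k := fun k => by
    unfold offTwo
    by_cases h1 : k = i
    · subst h1; simp [h]
    · by_cases h2 : k = j
      · subst h2; simp [h1]
      · simp [h1, h2]
  simp only [Matrix.mulVec, dotProduct]
  rw [Finset.sum_congr rfl fun k _ => h1 k]
  simp [Finset.sum_add_distrib]

omit [DecidableEq ι] in
lemma sum_mul_sum_split [DecidableEq ι] (f g : ι → ℝ) :
    (∑ k, f k) * ∑ l, g l =
      ∑ k, f k * g k + ∑ k, ∑ l, if k = l then 0 else f k * g l := by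
  rw [Finset.sum_mul_sum, ← Finset.sum_add_distrib]
  refine Finset.sum_congr rfl fun k _ => ?_
  have : ∀ l, f k * g l = (if k = l then f k * g k else 0) + if k = l then 0 else f k * g l :=
    fun l => by
      by_cases h : k = l
      · subst h; simp
      · simp [h]
  rw [Finset.sum_congr rfl fun l _ => this l]
  simp [Finset.sum_add_distrib]

omit [Fintype ι] [DecidableEq ι] in
lemma abs_weight_mul_le {W M N L b : ℝ} (hW : |W| ≤ b) (hM : |M| ≤ 1) (hN : |N| ≤ |L|) :
    |W * M * N| ≤ b * |L| := by
  rw [abs_mul, abs_mul]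
  have hb : 0 ≤ b := (abs_nonneg _).trans hW
  calc |W| * |M| * |N| ≤ b * 1 * |L| := by gcongr
    _ = _ := by ring

/-- Concentration of the cross-fit double sum in pure noise. -/
theorem L1Le.crossFit_noise (hP : IsProjection P) (hle : ∀ k, 𝓕 k ≤ mΩ) (hind : iIndep 𝓕 μ)
    (hm : 1 ≤ m) (ha : 0 ≤ a)
    (h₁ : SixthMoment μ 𝓕 m x₁) (h₂ : SixthMoment μ 𝓕 m x₂)
    (h₃ : SixthMoment μ 𝓕 m x₃) (h₄ : SixthMoment μ 𝓕 m x₄)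
    (h₁0 : ∀ k, ∫ ω, x₁ k ω ∂μ = 0) (h₂0 : ∀ k, ∫ ω, x₂ k ω ∂μ = 0)
    (h₃0 : ∀ k, ∫ ω, x₃ k ω ∂μ = 0) (h₄0 : ∀ k, ∫ ω, x₄ k ω ∂μ = 0)
    (W : ι → ι → ℝ) (hW0 : ∀ i, W i i = 0) (hW : ∀ i j, |W i j| ≤ a * P i j ^ 2) :
    L1Le μ (fun ω => ∑ i, ∑ j, W i j *
        (x₁ i ω * ((1 - P) *ᵥ fun k => x₂ k ω) i * (x₃ j ω * ((1 - P) *ᵥ fun k => x₄ k ω) j))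
      - ∑ i, ∑ j, W i j * ((1 - P) i i * (1 - P) j j *
            ((∫ ω', x₁ i ω' * x₂ i ω' ∂μ) * ∫ ω', x₃ j ω' * x₄ j ω' ∂μ)
          + (1 - P) i j ^ 2 *
            ((∫ ω', x₁ i ω' * x₄ i ω' ∂μ) * ∫ ω', x₂ j ω' * x₃ j ω' ∂μ)))
      (160 * m ^ 2 * a * √P.trace) := by
  have hM := hP.compl
  set M := 1 - P with hMdef
  have n₁ := h₁.noise hle hm
  have n₂ := h₂.noise hle hm
  have n₃ := h₃.noise hle hm
  have n₄ := h₄.noise hle hm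
  have hN := hM.sum_sq_le_one
  have hM1 := hM.abs_le_one
  have one : (1 : ℝ) = |(1 : ℝ)| := by simp
  -- Both (Mx₂)ᵢ and (Mx₄)ⱼ have three parts: own index, the other outer index, and the rest. Of the
  -- nine products, rest times rest splits further into k = l (`s9`) and k ≠ l (`s10`). The ten
  -- patterns, each at cost 16, give the constant 160.
  have s1 := L1Le.two_index hP hle hind hm ha (h₁.mul₂ hle hm h₂) (h₃.mul₂ hle hm h₄)
    (fun i j => W i j * M i i * M j j) (fun i => by simp [hW0]) fun i j => by
      have := abs_weight_mul_le (hW i j) (hM1 i i) ((hM1 j j).trans_eq one); simpa using this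
  have s2 := L1Le.two_index hP hle hind hm ha (h₁.mul₃ hle h₂ h₄) n₃
    (fun i j => W i j * M i i * M j i) (fun i => by simp [hW0]) fun i j => by
      have := abs_weight_mul_le (hW i j) (hM1 i i) ((hM1 j i).trans_eq one); simpa using this
  have s3 := L1Le.two_index hP hle hind hm ha n₁ (h₂.mul₃ hle h₃ h₄)
    (fun i j => W i j * M i j * M j j) (fun i => by simp [hW0]) fun i j => by
      have := abs_weight_mul_le (hW i j) (hM1 i j) ((hM1 j j).trans_eq one); simpa using this
  have s4 := L1Le.two_index hP hle hind hm ha (h₁.mul₂ hle hm h₄) (h₂.mul₂ hle hm h₃)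
    (fun i j => W i j * M i j * M j i) (fun i => by simp [hW0]) fun i j => by
      have := abs_weight_mul_le (hW i j) (hM1 i j) ((hM1 j i).trans_eq one); simpa using this
  have s5 := L1Le.three_index_chain hP hle hind hm ha (h₁.mul₂ hle hm h₂) n₃ h₃0 n₄ h₄0
    (fun i j l => W i j * M i i * offTwo M j i l)
    (fun i j l h => by rcases h with rfl | rfl | rfl <;> simp [hW0, offTwo]) M hN
    fun i j l => abs_weight_mul_le (hW i j) (hM1 i i) (abs_offTwo_le M j i l)
  -- The outer indices are exchanged here and in `s7`, since the index carrying a product of two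
  -- noises, and hence not centred, must come first.
  have s6 := L1Le.three_index_chain hP hle hind hm ha (h₃.mul₂ hle hm h₄) n₁ h₁0 n₂ h₂0
    (fun j i k => W i j * M j j * offTwo M i j k)
    (fun j i k h => by rcases h with rfl | rfl | rfl <;> simp [hW0, offTwo]) M hN
    fun j i k => by
      rw [hP.apply_comm j i]
      exact abs_weight_mul_le (hW i j) (hM1 j j) (abs_offTwo_le M i j k)
  have s7 := L1Le.three_index_star hP hle hind hm ha (h₂.mul₂ hle hm h₃) n₁ h₁0 n₄ h₄0
    (fun j i l => W i j * M i j * offTwo M j i l)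
    (fun j i l h => by rcases h with rfl | rfl | rfl <;> simp [hW0, offTwo]) M hN
    fun j i l => by
      rw [hP.apply_comm j i]
      exact abs_weight_mul_le (hW i j) (hM1 i j) (abs_offTwo_le M j i l)
  have s8 := L1Le.three_index_star hP hle hind hm ha (h₁.mul₂ hle hm h₄) n₃ h₃0 n₂ h₂0
    (fun i j k => W i j * M j i * offTwo M i j k)
    (fun i j k h => by rcases h with rfl | rfl | rfl <;> simp [hW0, offTwo]) M hN
    fun i j k => abs_weight_mul_le (hW i j) (hM1 j i) (abs_offTwo_le M i j k)
  have s9 := L1Le.three_index_triangle hP hle hind hm ha (h₂.mul₂ hle hm h₄) n₁ h₁0 n₃ h₃0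
    (fun k i j => W i j * (offTwo M i j k * offTwo M j i k))
    (fun k i j h => by rcases h with rfl | rfl | rfl <;> simp [hW0, offTwo]) M hN
    fun k i j => by
      rw [abs_mul, abs_mul]
      have := (abs_nonneg _).trans (hW i j)
      exact mul_le_mul (hW i j) (mul_le_mul (abs_offTwo_le M i j k) (abs_offTwo_le M j i k)
        (abs_nonneg _) (abs_nonneg _)) (by positivity) this
  -- The rows of M have norm at most 1, so summing the squared weights over k and l leaves a²Pᵢⱼ⁴ ≤
  -- a²Pᵢⱼ², and then a²Pᵢᵢ.
  have s10 := L1Le.four_index (P := P) hle hind hm ha n₁ h₁0 n₃ h₃0 n₂ h₂0 n₄ h₄0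
    (fun i j k l => if k = l then 0 else W i j * (offTwo M i j k * offTwo M j i l))
    (fun i j k l h => by
      rcases h with rfl | rfl | rfl | rfl | rfl | rfl <;> simp [hW0, offTwo])
    (fun i => by
      rw [← hP.sum_sq i, Finset.mul_sum]
      refine Finset.sum_le_sum fun j _ => ?_
      calc _ ≤ ∑ k, ∑ l, (a * P i j ^ 2) ^ 2 * (M i k ^ 2 * M j l ^ 2) := by
            refine Finset.sum_le_sum fun k _ => Finset.sum_le_sum fun l _ => ?_
            split_ifs
            · rw [zero_pow two_ne_zero]; positivity
            · rw [mul_pow, mul_pow]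
              exact mul_le_mul (sq_le_sq' (neg_le_of_abs_le (hW i j)) (le_of_abs_le (hW i j)))
                (mul_le_mul (sq_le_sq.2 (abs_offTwo_le M i j k))
                  (sq_le_sq.2 (abs_offTwo_le M j i l)) (sq_nonneg _) (sq_nonneg _))
                (by positivity) (sq_nonneg _)
        _ = (a * P i j ^ 2) ^ 2 * ((∑ k, M i k ^ 2) * ∑ l, M j l ^ 2) := by
            rw [Finset.sum_mul_sum]; simp only [Finset.mul_sum]
        _ ≤ (a * P i j ^ 2) ^ 2 * 1 := by
            refine mul_le_mul_of_nonneg_left ?_ (sq_nonneg _)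
            exact mul_le_one₀ (hN i) (Finset.sum_nonneg fun i _ => sq_nonneg _) (hN j)
        _ = a ^ 2 * (P i j ^ 2 * P i j ^ 2) := by ring
        _ ≤ a ^ 2 * (P i j ^ 2 * 1) := by gcongr; exact hP.sq_le_one i j
        _ = _ := by ring)
  refine ((((((((((s1.add s2).add s3).add s4).add s5).add s6).add s7).add s8).add s9).add
    s10).congr fun ω => ?_).mono (le_of_eq (by ring))
  have key : ∀ i j, W i j * (x₁ i ω * (M *ᵥ fun k => x₂ k ω) i *
      (x₃ j ω * (M *ᵥ fun k => x₄ k ω) j)) =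
      W i j * M i i * M j j * ((x₁ i ω * x₂ i ω) * (x₃ j ω * x₄ j ω))
      + W i j * M i i * M j i * ((x₁ i ω * x₂ i ω * x₄ i ω) * x₃ j ω)
      + W i j * M i j * M j j * (x₁ i ω * (x₂ j ω * x₃ j ω * x₄ j ω))
      + W i j * M i j * M j i * ((x₁ i ω * x₄ i ω) * (x₂ j ω * x₃ j ω))
      + (∑ l, W i j * M i i * offTwo M j i l * ((x₁ i ω * x₂ i ω) * x₃ j ω * x₄ l ω))
      + (∑ k, W i j * M j j * offTwo M i j k * ((x₃ j ω * x₄ j ω) * x₁ i ω * x₂ k ω))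
      + (∑ l, W i j * M i j * offTwo M j i l * ((x₂ j ω * x₃ j ω) * x₁ i ω * x₄ l ω))
      + (∑ k, W i j * M j i * offTwo M i j k * ((x₁ i ω * x₄ i ω) * x₃ j ω * x₂ k ω))
      + (∑ k, W i j * (offTwo M i j k * offTwo M j i k) *
          ((x₂ k ω * x₄ k ω) * x₁ i ω * x₃ j ω))
      + (∑ k, ∑ l, (if k = l then 0 else W i j * (offTwo M i j k * offTwo M j i l)) *
          (x₁ i ω * x₃ j ω * x₂ k ω * x₄ l ω)) := fun i j => by
    by_cases hij : i = j
    · subst hij; simp [hW0]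
    have e1 : ∀ (b u : ℝ) (f g : ι → ℝ), ∑ k, b * f k * (u * g k) = b * u * ∑ k, f k * g k :=
      fun b u f g => by rw [Finset.mul_sum]; exact Finset.sum_congr rfl fun k _ => by ring
    have e9 : (∑ k, W i j * (offTwo M i j k * offTwo M j i k) *
          ((x₂ k ω * x₄ k ω) * x₁ i ω * x₃ j ω)) = W i j * x₁ i ω * x₃ j ω *
        ∑ k, (offTwo M i j k * x₂ k ω) * (offTwo M j i k * x₄ k ω) := by
      rw [Finset.mul_sum]; exact Finset.sum_congr rfl fun k _ => by ring
    have e10 : (∑ k, ∑ l, (if k = l then 0 else W i j * (offTwo M i j k * offTwo M j i l)) *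
          (x₁ i ω * x₃ j ω * x₂ k ω * x₄ l ω)) = W i j * x₁ i ω * x₃ j ω *
        ∑ k, ∑ l, if k = l then 0 else (offTwo M i j k * x₂ k ω) * (offTwo M j i l * x₄ l ω) := by
      simp only [Finset.mul_sum]
      refine Finset.sum_congr rfl fun k _ => Finset.sum_congr rfl fun l _ => ?_
      split_ifs <;> ring
    have e11 := sum_mul_sum_split (fun k => offTwo M i j k * x₂ k ω)
      fun l => offTwo M j i l * x₄ l ω
    rw [e1, e1, e1, e1, e9, e10, mulVec_eq_offTwo M _ hij, mulVec_eq_offTwo M _ (Ne.symm hij)]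
    linear_combination (W i j * x₁ i ω * x₃ j ω) * e11
  rw [Finset.sum_congr rfl fun i _ => Finset.sum_congr rfl fun j _ => key i j]
  -- Of the four two-index patterns, only `s1` and `s4` keep a mean; the other two contain a lone
  -- centred factor.
  have z2 : ∑ i, ∑ j, W i j * M i i * M j i *
      ((∫ ω', x₁ i ω' * x₂ i ω' * x₄ i ω' ∂μ) * ∫ ω', x₃ j ω' ∂μ) = 0 := by simp [h₃0]
  have z3 : ∑ i, ∑ j, W i j * M i j * M j j *
      ((∫ ω', x₁ i ω' ∂μ) * ∫ ω', x₂ j ω' * x₃ j ω' * x₄ j ω' ∂μ) = 0 := by simp [h₁0]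
  have z14 : ∑ i, ∑ j, W i j * (M i i * M j j *
            ((∫ ω', x₁ i ω' * x₂ i ω' ∂μ) * ∫ ω', x₃ j ω' * x₄ j ω' ∂μ)
          + M i j ^ 2 * ((∫ ω', x₁ i ω' * x₄ i ω' ∂μ) * ∫ ω', x₂ j ω' * x₃ j ω' ∂μ)) =
      ∑ i, ∑ j, W i j * M i i * M j j *
        ((∫ ω', x₁ i ω' * x₂ i ω' ∂μ) * ∫ ω', x₃ j ω' * x₄ j ω' ∂μ) +
      ∑ i, ∑ j, W i j * M i j * M j i *
        ((∫ ω', x₁ i ω' * x₄ i ω' ∂μ) * ∫ ω', x₂ j ω' * x₃ j ω' ∂μ) := by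
    simp only [← Finset.sum_add_distrib]
    refine Finset.sum_congr rfl fun i _ => Finset.sum_congr rfl fun j _ => ?_
    rw [hM.apply_comm j i]; ring
  rw [z2, z3, z14]
  simp only [Finset.sum_add_distrib]
  rw [Finset.sum_comm (f := fun j i => ∑ k, W i j * M j j * offTwo M i j k *
      ((x₃ j ω * x₄ j ω) * x₁ i ω * x₂ k ω)),
    Finset.sum_comm (f := fun j i => ∑ l, W i j * M i j * offTwo M j i l *
      ((x₂ j ω * x₃ j ω) * x₁ i ω * x₄ l ω)),
    ← sum_rotate fun k i j => W i j * (offTwo M i j k * offTwo M j i k) *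
          ((x₂ k ω * x₄ k ω) * x₁ i ω * x₃ j ω)]
  ring

end Noise

/-! ### The leave-one-out sum in pure noise. -/

section LeaveOneOut

/-- `P` with its diagonal removed. -/
def offDiag {ι : Type*} [DecidableEq ι] (P : Matrix ι ι ℝ) : Matrix ι ι ℝ :=
  fun i j => if j = i then 0 else P i j

variable {Ω : Type*} {mΩ : MeasurableSpace Ω} {μ : Measure Ω} {ι : Type*}
  {𝓕 : ι → MeasurableSpace Ω} {m : ℝ} [IsProbabilityMeasure μ]
  [Fintype ι] [DecidableEq ι] {P : Matrix ι ι ℝ} {a : ℝ} {x₁ x₂ x₃ x₄ : ι → Ω → ℝ}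

omit [Fintype ι] in
lemma abs_offDiag_le (P : Matrix ι ι ℝ) (i j : ι) : |offDiag P i j| ≤ |P i j| := by
  unfold offDiag; split_ifs <;> simp

omit [Fintype ι] in
lemma sq_offDiag_le (P : Matrix ι ι ℝ) (i j : ι) : offDiag P i j ^ 2 ≤ P i j ^ 2 :=
  sq_le_sq.2 (abs_offDiag_le P i j)

lemma compl_mulVec_eq_offDiag (P : Matrix ι ι ℝ) (v : ι → ℝ) (i : ι) :
    ((1 - P) *ᵥ v) i = (1 - P) i i * v i - (offDiag P *ᵥ v) i := by
  have h1 : (P *ᵥ v) i = P i i * v i + (offDiag P *ᵥ v) i := by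
    simp only [Matrix.mulVec, dotProduct, offDiag]
    have : ∀ k, P i k * v k = (if k = i then P i i * v i else 0) +
        (if k = i then 0 else P i k) * v k := fun k => by
      by_cases h : k = i
      · subst h; simp
      · simp [h]
    rw [Finset.sum_congr rfl fun k _ => this k]
    simp [Finset.sum_add_distrib]
  rw [Matrix.sub_mulVec, Matrix.one_mulVec, Pi.sub_apply, h1, Matrix.sub_apply, Matrix.one_apply_eq]
  ring

/-- Triples (j, k, l) sorted by coincidences: all equal, exactly one of the three pairs equal, all
distinct. -/
lemma sum_mul_sum_mul_sum_split (f g h : ι → ℝ) :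
    (∑ j, f j) * (∑ k, g k) * ∑ l, h l =
      ∑ j, f j * g j * h j
      + (∑ j, ∑ l, if j = l then 0 else f j * g j * h l)
      + (∑ j, ∑ k, if j = k then 0 else f j * h j * g k)
      + (∑ k, ∑ j, if k = j then 0 else g k * h k * f j)
      + ∑ j, ∑ k, ∑ l, if j = k ∨ j = l ∨ k = l then 0 else f j * g k * h l := by
  have h1 : ∀ j k, (if j = k then 0 else f j * g k) * ∑ l, h l =
      (if j = k then 0 else f j * h j * g k) + (if k = j then 0 else g k * h k * f j) +
      ∑ l, if j = k ∨ j = l ∨ k = l then 0 else f j * g k * h l := fun j k => by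
    by_cases hjk : j = k
    · subst hjk; simp
    have h2 : ∀ l, h l = (if l = j then h j else 0) + (if l = k then h k else 0) +
        (if j = k ∨ j = l ∨ k = l then 0 else h l) := fun l => by
      by_cases hj : l = j
      · subst hj; simp [hjk]
      · by_cases hk : l = k
        · subst hk; simp [hj]
        · simp [hj, hk, hjk, Ne.symm hj, Ne.symm hk]
    rw [Finset.sum_congr rfl fun l _ => h2 l]
    simp only [Finset.sum_add_distrib, Finset.sum_ite_eq', Finset.mem_univ, if_true, if_neg hjk,
      if_neg (Ne.symm hjk), mul_add, Finset.mul_sum, mul_ite, mul_zero]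
    ring
  rw [sum_mul_sum_split f g, add_mul, sum_mul_sum_split (fun j => f j * g j) h, Finset.sum_mul]
  simp only [Finset.sum_mul, h1]
  simp only [Finset.sum_add_distrib]
  rw [Finset.sum_comm (f := fun j k => if k = j then 0 else g k * h k * f j)]
  ring

/-- Concentration of the leave-one-out sum in pure noise. -/
theorem L1Le.leaveOneOut_noise (hP : IsProjection P) (hle : ∀ k, 𝓕 k ≤ mΩ) (hind : iIndep 𝓕 μ)
    (hm : 1 ≤ m) (ha : 1 ≤ a)
    (h₁ : SixthMoment μ 𝓕 m x₁) (h₂ : SixthMoment μ 𝓕 m x₂)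
    (h₃ : SixthMoment μ 𝓕 m x₃) (h₄ : SixthMoment μ 𝓕 m x₄)
    (h₁0 : ∀ k, ∫ ω, x₁ k ω ∂μ = 0) (h₂0 : ∀ k, ∫ ω, x₂ k ω ∂μ = 0)
    (h₃0 : ∀ k, ∫ ω, x₃ k ω ∂μ = 0) (h₄0 : ∀ k, ∫ ω, x₄ k ω ∂μ = 0)
    (d : ι → ℝ) (hd : ∀ i, (1 - P) i i * d i = 1) (hda : ∀ i, |d i| ≤ a) :
    L1Le μ (fun ω => ∑ i, (offDiag P *ᵥ fun k => x₁ k ω) i * (offDiag P *ᵥ fun k => x₂ k ω) i *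
        (x₃ i ω * ((1 - P) *ᵥ fun k => x₄ k ω) i * d i)
      - ∑ i, ∑ j, offDiag P i j ^ 2 *
        ((∫ ω', x₃ i ω' * x₄ i ω' ∂μ) * ∫ ω', x₁ j ω' * x₂ j ω' ∂μ))
      (112 * m ^ 2 * a * √P.trace) := by
  have ha0 : 0 ≤ a := zero_le_one.trans ha
  have n₁ := h₁.noise hle hm
  have n₂ := h₂.noise hle hm
  have n₃ := h₃.noise hle hm
  have n₄ := h₄.noise hle hm
  set p := offDiag P with hp
  have hp0 : ∀ i, p i i = 0 := fun i => by simp [hp, offDiag]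
  have hN := hP.sum_sq_le_one
  have habs : ∀ i j, |p i j| ≤ |P i j| := abs_offDiag_le P
  have hsq : ∀ i j, p i j ^ 2 ≤ P i j ^ 2 := sq_offDiag_le P
  have hb3 : ∀ i j l, |-(d i) * (p i j ^ 2 * p i l)| ≤ a * P i j ^ 2 * |P i l| := fun i j l => by
    rw [abs_mul, abs_neg, abs_mul, abs_of_nonneg (sq_nonneg (p i j)), mul_assoc]
    exact mul_le_mul (hda i) (mul_le_mul (hsq i j) (habs i l) (abs_nonneg _) (sq_nonneg _))
      (by positivity) ha0
  have hb3' : ∀ j i l, |if j = l then 0 else -(d i) * (p i j ^ 2 * p i l)| ≤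
      a * P j i ^ 2 * |P i l| := fun j i l => by
    rw [hP.apply_comm j i]
    split_ifs
    · rw [abs_zero]; positivity
    · exact hb3 i j l
  have hz3 : ∀ j i l, j = i ∨ j = l ∨ i = l →
      (if j = l then 0 else -(d i) * (p i j ^ 2 * p i l)) = 0 := fun j i l h => by
    rcases h with rfl | rfl | rfl <;> simp [hp0]
  -- Since dᵢ inverts Mᵢᵢ, dᵢ(Mx₄)ᵢ = x₄ᵢ − dᵢ(p x₄)ᵢ. The first part gives `s1` (j = k, the only
  -- pattern with a mean) and `s2` (j ≠ k); the second is a triple product, sorted by coincidences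
  -- into `s3` to `s7`. Seven patterns at cost 16 give 112.
  have s1 := L1Le.two_index hP hle hind hm ha0 (h₃.mul₂ hle hm h₄) (h₁.mul₂ hle hm h₂)
    (fun i j => p i j ^ 2) (fun i => by simp [hp0]) fun i j => by
      rw [abs_of_nonneg (sq_nonneg _)]
      exact (hsq i j).trans (le_mul_of_one_le_left (sq_nonneg _) ha)
  -- Its bound has weight 1 in place of `a`; 1 ≤ a brings it to the common form.
  have s2 := (L1Le.three_index_proj hP hle hind hm (h₃.mul₂ hle hm h₄) n₁ h₁0 n₂ h₂0).mono
    (b := 16 * m ^ 2 * a * √P.trace) (by gcongr)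
  have s3 := L1Le.two_index hP hle hind hm ha0 n₃ (h₁.mul₃ hle h₂ h₄)
    (fun i j => -(d i) * (p i j ^ 2 * p i j)) (fun i => by simp [hp0]) fun i j =>
      (hb3 i j j).trans (mul_le_of_le_one_right (by positivity) (hP.abs_le_one i j))
  have s4 := L1Le.three_index_chain hP hle hind hm ha0 (h₁.mul₂ hle hm h₂) n₃ h₃0 n₄ h₄0
    _ hz3 P hN hb3'
  have s5 := L1Le.three_index_chain hP hle hind hm ha0 (h₁.mul₂ hle hm h₄) n₃ h₃0 n₂ h₂0
    _ hz3 P hN hb3'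
  have s6 := L1Le.three_index_chain hP hle hind hm ha0 (h₂.mul₂ hle hm h₄) n₃ h₃0 n₁ h₁0
    _ hz3 P hN hb3'
  have s7 := L1Le.four_index (P := P) hle hind hm ha0 n₃ h₃0 n₁ h₁0 n₂ h₂0 n₄ h₄0
    (fun i j k l => if j = k ∨ j = l ∨ k = l then 0 else -(d i) * (p i j * p i k * p i l))
    (fun i j k l h => by
      rcases h with rfl | rfl | rfl | rfl | rfl | rfl <;> simp [hp0])
    (fun i => by
      calc _ ≤ ∑ j, ∑ k, ∑ l, a ^ 2 * (P i j ^ 2 * P i k ^ 2 * P i l ^ 2) := by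
            refine Finset.sum_le_sum fun j _ => Finset.sum_le_sum fun k _ =>
              Finset.sum_le_sum fun l _ => ?_
            split_ifs
            · rw [zero_pow two_ne_zero]; positivity
            · rw [mul_pow, mul_pow, mul_pow, neg_sq, ← sq_abs (d i)]
              have := hsq i j
              have := hsq i k
              have := hsq i l
              have := hda i
              gcongr
        _ = a ^ 2 * ((∑ j, P i j ^ 2) * (∑ k, P i k ^ 2) * ∑ l, P i l ^ 2) := by
            rw [Finset.sum_mul_sum, Finset.sum_mul]
            simp only [Finset.mul_sum, Finset.sum_mul]
            exact Finset.sum_congr rfl fun j _ => Finset.sum_comm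
        _ ≤ a ^ 2 * (P i i * 1 * 1) := by
            rw [hP.sum_sq]
            have := hP.diag_le_one i
            have := hP.diag_nonneg i
            gcongr
        _ = _ := by ring)
  refine (((((((s1.add s2).add s3).add s4).add s5).add s6).add s7).congr fun ω => ?_).mono
    (le_of_eq (by ring))
  have key : ∀ i, (p *ᵥ fun k => x₁ k ω) i * (p *ᵥ fun k => x₂ k ω) i *
        (x₃ i ω * ((1 - P) *ᵥ fun k => x₄ k ω) i * d i) =
      (∑ j, p i j ^ 2 * ((x₃ i ω * x₄ i ω) * (x₁ j ω * x₂ j ω)))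
      + (∑ j, ∑ k, (if i = j ∨ i = k ∨ j = k then 0 else P i j * P i k) *
          ((x₃ i ω * x₄ i ω) * x₁ j ω * x₂ k ω))
      + (∑ j, -(d i) * (p i j ^ 2 * p i j) * (x₃ i ω * (x₁ j ω * x₂ j ω * x₄ j ω)))
      + (∑ j, ∑ l, (if j = l then 0 else -(d i) * (p i j ^ 2 * p i l)) *
          ((x₁ j ω * x₂ j ω) * x₃ i ω * x₄ l ω))
      + (∑ j, ∑ l, (if j = l then 0 else -(d i) * (p i j ^ 2 * p i l)) *
          ((x₁ j ω * x₄ j ω) * x₃ i ω * x₂ l ω))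
      + (∑ j, ∑ l, (if j = l then 0 else -(d i) * (p i j ^ 2 * p i l)) *
          ((x₂ j ω * x₄ j ω) * x₃ i ω * x₁ l ω))
      + ∑ j, ∑ k, ∑ l, (if j = k ∨ j = l ∨ k = l then 0 else
          -(d i) * (p i j * p i k * p i l)) * (x₃ i ω * x₁ j ω * x₂ k ω * x₄ l ω) := fun i => by
    have c1 : (∑ j, p i j ^ 2 * ((x₃ i ω * x₄ i ω) * (x₁ j ω * x₂ j ω)))
      + (∑ j, ∑ k, (if i = j ∨ i = k ∨ j = k then 0 else P i j * P i k) *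
          ((x₃ i ω * x₄ i ω) * x₁ j ω * x₂ k ω)) = (x₃ i ω * x₄ i ω) *
          ((p *ᵥ fun k => x₁ k ω) i * (p *ᵥ fun k => x₂ k ω) i) := by
      simp only [Matrix.mulVec, dotProduct]
      rw [sum_mul_sum_split, mul_add, Finset.mul_sum, Finset.mul_sum]
      congr 1
      · exact Finset.sum_congr rfl fun j _ => by ring
      · refine Finset.sum_congr rfl fun j _ => ?_
        rw [Finset.mul_sum]
        refine Finset.sum_congr rfl fun k _ => ?_
        by_cases h1 : i = j
        · subst h1; simp [hp0]
        by_cases h2 : i = k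
        · subst h2; simp [hp0]
        by_cases h3 : j = k
        · simp [h3]
        simp only [h1, h2, h3, or_self, if_false, hp, offDiag, if_neg (Ne.symm h1),
          if_neg (Ne.symm h2)]
        ring
    have c2 := sum_mul_sum_mul_sum_split (fun j => p i j * x₁ j ω) (fun j => p i j * x₂ j ω)
      fun j => p i j * x₄ j ω
    have c3 : ∀ u v w : ι → Ω → ℝ, (∑ j, ∑ l, (if j = l then 0 else -(d i) *
        (p i j ^ 2 * p i l)) * ((u j ω * v j ω) * x₃ i ω * w l ω)) = -(d i) * x₃ i ω *
        ∑ j, ∑ l, if j = l then 0 else (p i j * u j ω) * (p i j * v j ω) * (p i l * w l ω) := by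
      intro u v w
      simp only [Finset.mul_sum]
      refine Finset.sum_congr rfl fun k _ => Finset.sum_congr rfl fun l _ => ?_
      split_ifs <;> ring
    have c4 : (∑ j, -(d i) * (p i j ^ 2 * p i j) * (x₃ i ω * (x₁ j ω * x₂ j ω * x₄ j ω))) =
        -(d i) * x₃ i ω * ∑ j, (p i j * x₁ j ω) * (p i j * x₂ j ω) * (p i j * x₄ j ω) := by
      rw [Finset.mul_sum]; exact Finset.sum_congr rfl fun k _ => by ring
    have c5 : (∑ j, ∑ k, ∑ l, (if j = k ∨ j = l ∨ k = l then 0 else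
          -(d i) * (p i j * p i k * p i l)) * (x₃ i ω * x₁ j ω * x₂ k ω * x₄ l ω)) =
        -(d i) * x₃ i ω * ∑ j, ∑ k, ∑ l, if j = k ∨ j = l ∨ k = l then 0 else
          (p i j * x₁ j ω) * (p i k * x₂ k ω) * (p i l * x₄ l ω) := by
      simp only [Finset.mul_sum]
      refine Finset.sum_congr rfl fun j _ => Finset.sum_congr rfl fun k _ =>
        Finset.sum_congr rfl fun l _ => ?_
      split_ifs <;> ring
    rw [c1, c3, c3, c3, c4, c5, compl_mulVec_eq_offDiag]
    simp only [Matrix.mulVec, dotProduct] at c2 ⊢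
    linear_combination (-(d i) * x₃ i ω) * c2 + ((∑ j, p i j * x₁ j ω) * (∑ j, p i j * x₂ j ω)
      * x₃ i ω * x₄ i ω) * hd i
  rw [Finset.sum_congr rfl fun i _ => key i]
  have z3 : ∑ i, ∑ j, -(d i) * (p i j ^ 2 * p i j) *
      ((∫ ω', x₃ i ω' ∂μ) * ∫ ω', x₁ j ω' * x₂ j ω' * x₄ j ω' ∂μ) = 0 := by simp [h₃0]
  rw [z3]
  simp only [Finset.sum_add_distrib]
  have hcomm : ∀ u v w : ι → Ω → ℝ, (∑ i, ∑ j, ∑ l, (if j = l then 0 else -(d i) *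
        (p i j ^ 2 * p i l)) * ((u j ω * v j ω) * x₃ i ω * w l ω)) =
      ∑ j, ∑ i, ∑ l, (if j = l then 0 else -(d i) *
        (p i j ^ 2 * p i l)) * ((u j ω * v j ω) * x₃ i ω * w l ω) :=
    fun u v w => Finset.sum_comm
  rw [hcomm x₁ x₂ x₄, hcomm x₁ x₄ x₂, hcomm x₂ x₄ x₁]
  ring

end LeaveOneOut

/-! ### Fourth moments of single factors and of linear forms. -/

section Fourth

variable {Ω : Type*} {mΩ : MeasurableSpace Ω} {μ : Measure Ω} {X Y Z : Ω → ℝ} {q b : ℝ}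

/-- `X` has fourth moment at most `q`. -/
structure FourthMoment (μ : Measure Ω) (q : ℝ) (X : Ω → ℝ) : Prop where
  meas : AEStronglyMeasurable X μ
  int : Integrable (fun ω => X ω ^ 4) μ
  le : ∫ ω, X ω ^ 4 ∂μ ≤ q

lemma FourthMoment.mono (hX : FourthMoment μ q X) (h : q ≤ b) : FourthMoment μ b X :=
  ⟨hX.meas, hX.int, hX.le.trans h⟩

lemma FourthMoment.sq_mul (hX : FourthMoment μ q X) (hY : FourthMoment μ q Y) :
    MemLp (fun ω => X ω * Y ω) 2 μ ∧ ∫ ω, (X ω * Y ω) ^ 2 ∂μ ≤ q := by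
  have hm : AEStronglyMeasurable (fun ω => X ω * Y ω) μ := hX.meas.mul hY.meas
  have hi : Integrable (fun ω => X ω ^ 4 / 2 + Y ω ^ 4 / 2) μ :=
    (hX.int.div_const 2).add (hY.int.div_const 2)
  have hb : ∀ ω, (X ω * Y ω) ^ 2 ≤ X ω ^ 4 / 2 + Y ω ^ 4 / 2 := fun ω => by
    nlinarith [sq_nonneg (X ω ^ 2 - Y ω ^ 2)]
  have hs : Integrable (fun ω => (X ω * Y ω) ^ 2) μ := hi.mono' (hm.pow 2) (ae_of_all _ fun ω => by
    rw [Real.norm_of_nonneg (sq_nonneg _)]; exact hb ω)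
  refine ⟨(memLp_two_iff_integrable_sq hm).2 hs, (integral_mono hs hi hb).trans ?_⟩
  rw [integral_add (hX.int.div_const 2) (hY.int.div_const 2), integral_div, integral_div]
  have := hX.le
  have := hY.le
  linarith

lemma FourthMoment.of_sq (h : MemLp (fun ω => X ω ^ 2) 2 μ) (hX : AEStronglyMeasurable X μ)
    (hq : ∫ ω, (X ω ^ 2) ^ 2 ∂μ ≤ q) : FourthMoment μ q X := by
  have e : ∀ ω, (X ω ^ 2) ^ 2 = X ω ^ 4 := fun ω => by ring
  refine ⟨hX, ?_, ?_⟩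
  · simpa only [e] using h.integrable_sq
  · simpa only [e] using hq

variable [IsProbabilityMeasure μ]

lemma FourthMoment.one (hq : 1 ≤ q) : FourthMoment μ q fun _ => 1 :=
  ⟨aestronglyMeasurable_const, by simp, by simpa using hq⟩

lemma FourthMoment.sq (hq : 1 ≤ q) (hX : FourthMoment μ q X) :
    MemLp X 2 μ ∧ ∫ ω, X ω ^ 2 ∂μ ≤ q := by
  simpa using hX.sq_mul (FourthMoment.one hq)

/-- Cauchy–Schwarz between XY and Z: both have second moment at most `q`, the latter because q ≥ 1.
-/
lemma FourthMoment.mul₃ (hq : 1 ≤ q) (hX : FourthMoment μ q X) (hY : FourthMoment μ q Y)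
    (hZ : FourthMoment μ q Z) : L1Le μ (fun ω => X ω * Y ω * Z ω) q := by
  have h1 := hX.sq_mul hY
  have h2 := hZ.sq hq
  refine (L1Le.mul h1.1 h2.1 h1.2 h2.2).mono ?_
  rw [Real.mul_self_sqrt (zero_le_one.trans hq)]

lemma FourthMoment.mul₂ (hq : 1 ≤ q) (hX : FourthMoment μ q X) (hY : FourthMoment μ q Y) :
    L1Le μ (fun ω => X ω * Y ω) q := by
  simpa using hX.mul₃ hq hY (FourthMoment.one hq)

lemma FourthMoment.const_add (hX : FourthMoment μ q X) {c : ℝ} (hc : |c| ≤ b) :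
    FourthMoment μ (8 * (b ^ 4 + q)) fun ω => c + X ω := by
  have hm : AEStronglyMeasurable (fun ω => c + X ω) μ := hX.meas.const_add c
  have hi : Integrable (fun ω => 8 * (b ^ 4 + X ω ^ 4)) μ :=
    ((integrable_const _).add hX.int).const_mul 8
  have hb : ∀ ω, (c + X ω) ^ 4 ≤ 8 * (b ^ 4 + X ω ^ 4) := fun ω => by
    have h1 : c ^ 4 ≤ b ^ 4 := by
      rw [← Even.pow_abs (by decide : Even 4) c]
      exact pow_le_pow_left₀ (abs_nonneg _) hc 4
    have h2 : (c + X ω) ^ 4 ≤ 8 * (c ^ 4 + X ω ^ 4) := by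
      have h3 : (c + X ω) ^ 2 ≤ 2 * (c ^ 2 + X ω ^ 2) := by nlinarith [sq_nonneg (c - X ω)]
      have h4 : ((c + X ω) ^ 2) ^ 2 ≤ (2 * (c ^ 2 + X ω ^ 2)) ^ 2 :=
        pow_le_pow_left₀ (sq_nonneg _) h3 2
      nlinarith [sq_nonneg (c ^ 2 - X ω ^ 2)]
    linarith
  have hs : Integrable (fun ω => (c + X ω) ^ 4) μ := hi.mono' (hm.pow 4) (ae_of_all _ fun ω => by
    rw [Real.norm_of_nonneg (by positivity)]; exact hb ω)
  refine ⟨hm, hs, (integral_mono hs hi hb).trans ?_⟩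
  rw [integral_const_mul, integral_add (integrable_const _) hX.int]
  simp only [integral_const, probReal_univ, smul_eq_mul, one_mul]
  have := hX.le
  linarith

variable {ι : Type*} {𝓕 : ι → MeasurableSpace Ω} {m : ℝ} {x : ι → Ω → ℝ}

lemma SixthMoment.fourth (hle : ∀ k, 𝓕 k ≤ mΩ) (hm : 1 ≤ m) (hx : SixthMoment μ 𝓕 m x) (k : ι) :
    FourthMoment μ m (x k) := by
  have h := hx.mul₂ hle hm hx
  have e : ∀ ω, x k ω * x k ω = x k ω ^ 2 := fun ω => (sq _).symm
  refine FourthMoment.of_sq ?_ ((hx.meas k).mono (hle k) le_rfl).aestronglyMeasurable ?_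
  · simpa only [e] using h.memLp k
  · simpa only [e] using h.sq_le k

variable [Fintype ι] [DecidableEq ι]

/-- The square of the linear form is a diagonal part plus an off-diagonal bilinear form. Their
second moments are at most mS² (Cauchy–Schwarz with weights cₖ²) and 4m²S², where S = ∑cₖ²; doubling
the sum gives 10m²S². -/
lemma SixthMoment.fourth_sum (hle : ∀ k, 𝓕 k ≤ mΩ) (hind : iIndep 𝓕 μ) (hm : 1 ≤ m)
    (hx : SixthMoment μ 𝓕 m x) (hx0 : ∀ k, ∫ ω, x k ω ∂μ = 0) (c : ι → ℝ) :
    FourthMoment μ (10 * m ^ 2 * (∑ k, c k ^ 2) ^ 2) fun ω => ∑ k, c k * x k ω := by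
  have hm0 : 0 ≤ m := zero_le_one.trans hm
  have n := hx.noise hle hm
  have h2 := hx.mul₂ hle hm hx
  set S := ∑ k, c k ^ 2
  have hS : 0 ≤ S := Finset.sum_nonneg fun k _ => sq_nonneg _
  obtain ⟨hD, hD'⟩ := sq_bilinear_le hle hind hm0 n hx0 n hx0
    (fun i j => if i = j then 0 else c i * c j) (fun i => by simp)
  have hE : MemLp (fun ω => ∑ k, c k ^ 2 * (x k ω * x k ω)) 2 μ :=
    memLp_finsetSum _ fun k _ => (h2.memLp k).const_mul _
  have hE' : ∫ ω, (∑ k, c k ^ 2 * (x k ω * x k ω)) ^ 2 ∂μ ≤ m * S ^ 2 := by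
    have hb : ∀ ω, (∑ k, c k ^ 2 * (x k ω * x k ω)) ^ 2 ≤
        S * ∑ k, c k ^ 2 * (x k ω * x k ω) ^ 2 := fun ω => by
      have := Finset.sum_mul_sq_le_sq_mul_sq Finset.univ c fun k => c k * (x k ω * x k ω)
      calc _ = (∑ k, c k * (c k * (x k ω * x k ω))) ^ 2 := by
            congr 1; exact Finset.sum_congr rfl fun k _ => by ring
        _ ≤ _ := this
        _ = _ := by simp only [mul_pow, S]
    have hi : ∀ k, Integrable (fun ω => c k ^ 2 * (x k ω * x k ω) ^ 2) μ :=
      fun k => (h2.memLp k).integrable_sq.const_mul _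
    refine (integral_mono hE.integrable_sq
      ((integrable_finsetSum _ fun k _ => hi k).const_mul S) hb).trans ?_
    rw [integral_const_mul, integral_finsetSum _ fun k _ => hi k]
    calc _ ≤ S * ∑ k, c k ^ 2 * m := by
          gcongr with k
          rw [integral_const_mul]
          exact mul_le_mul_of_nonneg_left (h2.sq_le k) (sq_nonneg _)
      _ = _ := by rw [← Finset.sum_mul]; ring
  have hD2 : ∑ i, ∑ j, (if i = j then 0 else c i * c j) ^ 2 ≤ S ^ 2 := by
    rw [sq S, Finset.sum_mul_sum]
    refine Finset.sum_le_sum fun i _ => Finset.sum_le_sum fun j _ => ?_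
    split_ifs
    · rw [zero_pow two_ne_zero]; positivity
    · rw [mul_pow]
  have hsplit : ∀ ω, (∑ k, c k * x k ω) ^ 2 = (∑ k, c k ^ 2 * (x k ω * x k ω)) +
      ∑ i, ∑ j, (if i = j then 0 else c i * c j) * (x i ω * x j ω) := fun ω => by
    rw [sq, sum_mul_sum_split]
    congr 1
    · exact Finset.sum_congr rfl fun k _ => by ring
    · refine Finset.sum_congr rfl fun i _ => Finset.sum_congr rfl fun j _ => ?_
      split_ifs <;> ring
  refine FourthMoment.of_sq ?_ ?_ ?_
  · simp only [hsplit]; exact hE.add hD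
  · exact Finset.aestronglyMeasurable_fun_sum _ fun k _ =>
      (((hx.meas k).mono (hle k) le_rfl).const_mul _).aestronglyMeasurable
  · simp only [hsplit]
    have hb : ∀ ω, ((∑ k, c k ^ 2 * (x k ω * x k ω)) +
      ∑ i, ∑ j, (if i = j then 0 else c i * c j) * (x i ω * x j ω)) ^ 2 ≤
      2 * (∑ k, c k ^ 2 * (x k ω * x k ω)) ^ 2 +
      2 * (∑ i, ∑ j, (if i = j then 0 else c i * c j) * (x i ω * x j ω)) ^ 2 :=
      fun ω => by
        rw [← mul_add]; exact add_sq_le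
    refine (integral_mono (hE.add hD).integrable_sq
      ((hE.integrable_sq.const_mul 2).add (hD.integrable_sq.const_mul 2)) hb).trans ?_
    rw [integral_add' (hE.integrable_sq.const_mul 2) (hD.integrable_sq.const_mul 2),
      integral_const_mul, integral_const_mul]
    have h3 : 4 * m ^ 2 * ∑ i, ∑ j, (if i = j then 0 else c i * c j) ^ 2 ≤ 4 * m ^ 2 * S ^ 2 := by
      gcongr
    have h4 : m * S ^ 2 ≤ m ^ 2 * S ^ 2 := by gcongr; nlinarith
    linarith

end Fourth

/-! ### Removing the mean vectors. -/

section Perturbation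

variable {Ω : Type*} {mΩ : MeasurableSpace Ω} {μ : Measure Ω} [IsProbabilityMeasure μ] {ι : Type*}
  {𝓕 : ι → MeasurableSpace Ω} {m a b q : ℝ} [Fintype ι] [DecidableEq ι] {P : Matrix ι ι ℝ}
  {x x₁ x₂ x₃ x₄ : ι → Ω → ℝ} {α α₁ α₂ α₃ α₄ p : ι → ℝ}

/-- `x` is centred noise with bounded sixth moments and `α` a mean vector of the order of `p`. -/
structure MeanNoise (μ : Measure Ω) (𝓕 : ι → MeasurableSpace Ω) (m : ℝ) (P : Matrix ι ι ℝ)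
    (p : ι → ℝ) (α : ι → ℝ) (x : ι → Ω → ℝ) : Prop where
  sixth : SixthMoment μ 𝓕 m x
  mean : ∀ k, ∫ ω, x k ω ∂μ = 0
  le : ∀ k, |α k| ≤ p k
  le' : ∀ k, |((1 - P) *ᵥ α) k| ≤ p k

lemma MeanNoise.fourth_noise (hle : ∀ k, 𝓕 k ≤ mΩ) (hm : 1 ≤ m)
    (h : MeanNoise μ 𝓕 m P p α x) (i : ι) :
    FourthMoment μ (8 * (b ^ 4 + 10 * m ^ 2)) (x i) :=
  (h.sixth.fourth hle hm i).mono (by nlinarith [sq_nonneg (b ^ 2)])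

lemma MeanNoise.fourth (hle : ∀ k, 𝓕 k ≤ mΩ) (hm : 1 ≤ m) (hp : ∀ k, p k ≤ b)
    (h : MeanNoise μ 𝓕 m P p α x) (i : ι) :
    FourthMoment μ (8 * (b ^ 4 + 10 * m ^ 2)) fun ω => α i + x i ω :=
  ((h.sixth.fourth hle hm i).const_add ((h.le i).trans (hp i))).mono (by nlinarith)

/-- Rows of M = 1 − P have norm at most 1, so the bound does not depend on the dimension. -/
lemma MeanNoise.fourth_noise_mulVec (hP : IsProjection P) (hle : ∀ k, 𝓕 k ≤ mΩ)
    (hind : iIndep 𝓕 μ) (hm : 1 ≤ m) (h : MeanNoise μ 𝓕 m P p α x) (i : ι) :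
    FourthMoment μ (10 * m ^ 2) fun ω => ((1 - P) *ᵥ fun k => x k ω) i := by
  refine (h.sixth.fourth_sum hle hind hm h.mean fun k => (1 - P) i k).mono ?_
  have h1 := hP.compl.sum_sq_le_one i
  have h2 : 0 ≤ ∑ k, (1 - P) i k ^ 2 := Finset.sum_nonneg fun k _ => sq_nonneg _
  have h3 : (∑ k, (1 - P) i k ^ 2) ^ 2 ≤ 1 := pow_le_one₀ h2 h1
  nlinarith [sq_nonneg m]

omit [DecidableEq ι] in
lemma mulVec_mean_add (P : Matrix ι ι ℝ) (α : ι → ℝ) (x : ι → Ω → ℝ) (i : ι) (ω : Ω) :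
    (P *ᵥ fun k => α k + x k ω) i = (P *ᵥ α) i + (P *ᵥ fun k => x k ω) i := by
  have : (fun k => α k + x k ω) = α + fun k => x k ω := rfl
  rw [this, Matrix.mulVec_add]; rfl

lemma MeanNoise.fourth_mulVec (hP : IsProjection P) (hle : ∀ k, 𝓕 k ≤ mΩ)
    (hind : iIndep 𝓕 μ) (hm : 1 ≤ m) (hp : ∀ k, p k ≤ b) (h : MeanNoise μ 𝓕 m P p α x) (i : ι) :
    FourthMoment μ (8 * (b ^ 4 + 10 * m ^ 2))
      fun ω => ((1 - P) *ᵥ fun k => α k + x k ω) i := by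
  simp only [mulVec_mean_add]
  exact (h.fourth_noise_mulVec hP hle hind hm i).const_add ((h.le' i).trans (hp i))

omit [IsProbabilityMeasure μ] in
lemma MeanNoise.nonneg (h : MeanNoise μ 𝓕 m P p α x) (i : ι) : 0 ≤ p i :=
  (abs_nonneg _).trans (h.le i)

omit [IsProbabilityMeasure μ] in
lemma L1Le.const_mul_le {F : Ω → ℝ} {c d q : ℝ} (h : L1Le μ F q) (hc : |c| ≤ d) :
    L1Le μ (fun ω => c * F ω) (d * q) :=
  (h.const_mul c).mono (mul_le_mul_of_nonneg_right hc
    ((integral_nonneg fun _ => abs_nonneg _).trans h.2))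

/-- Removing the means from the cross-fit double sum. -/
theorem L1Le.crossFit_perturb (hP : IsProjection P) (hle : ∀ k, 𝓕 k ≤ mΩ) (hind : iIndep 𝓕 μ)
    (hm : 1 ≤ m) (hp : ∀ k, p k ≤ b)
    (h₁ : MeanNoise μ 𝓕 m P p α₁ x₁) (h₂ : MeanNoise μ 𝓕 m P p α₂ x₂)
    (h₃ : MeanNoise μ 𝓕 m P p α₃ x₃) (h₄ : MeanNoise μ 𝓕 m P p α₄ x₄)
    (W : ι → ι → ℝ) (hW : ∀ i j, |W i j| ≤ a * P i j ^ 2) :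
    L1Le μ (fun ω => ∑ i, ∑ j, W i j *
        ((α₁ i + x₁ i ω) * ((1 - P) *ᵥ fun k => α₂ k + x₂ k ω) i *
          ((α₃ j + x₃ j ω) * ((1 - P) *ᵥ fun k => α₄ k + x₄ k ω) j))
      - ∑ i, ∑ j, W i j *
        (x₁ i ω * ((1 - P) *ᵥ fun k => x₂ k ω) i * (x₃ j ω * ((1 - P) *ᵥ fun k => x₄ k ω) j)))
      (4 * a * (8 * (b ^ 4 + 10 * m ^ 2)) * ∑ i, P i i * p i) := by
  -- One constant for the fourth moments of all factors, with or without their means and with or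
  -- without M applied.
  set q := 8 * (b ^ 4 + 10 * m ^ 2) with hq
  have hq1 : 1 ≤ q := by rw [hq]; nlinarith [sq_nonneg (b ^ 2)]
  have hmq : 10 * m ^ 2 ≤ q := by rw [hq]; nlinarith [sq_nonneg (b ^ 2), sq_nonneg m]
  have hterm : ∀ i j, L1Le μ (fun ω => W i j *
        ((α₁ i + x₁ i ω) * ((1 - P) *ᵥ fun k => α₂ k + x₂ k ω) i *
          ((α₃ j + x₃ j ω) * ((1 - P) *ᵥ fun k => α₄ k + x₄ k ω) j) -
        x₁ i ω * ((1 - P) *ᵥ fun k => x₂ k ω) i * (x₃ j ω * ((1 - P) *ᵥ fun k => x₄ k ω) j)))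
      (a * P i j ^ 2 * (2 * q * p i + 2 * q * p j)) := fun i j => by
    refine L1Le.const_mul_le ?_ (hW i j)
    have f₁ := h₁.fourth_noise hle hm (b := b) i
    have f₃ := h₃.fourth_noise hle hm (b := b) j
    have f₂ := (h₂.fourth_noise_mulVec hP hle hind hm i).mono hmq
    have g₂ := h₂.fourth_mulVec hP hle hind hm hp i
    have g₃ := h₃.fourth hle hm hp j
    have g₄ := h₄.fourth_mulVec hP hle hind hm hp j
    -- Telescoping over the four factors: each term has one deterministic mean, bounded by `p` at i
    -- or j, times three random factors. The factors before it are already pure noise and those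
    -- after it still carry their means.
    have t1 := (g₂.mul₃ hq1 g₃ g₄).const_mul_le (h₁.le i)
    have t2 := (f₁.mul₃ hq1 g₃ g₄).const_mul_le (h₂.le' i)
    have t3 := (f₁.mul₃ hq1 f₂ g₄).const_mul_le (h₃.le j)
    have t4 := (f₁.mul₃ hq1 f₂ f₃).const_mul_le (h₄.le' j)
    refine ((((t1.add t2).add t3).add t4).congr fun ω => ?_).mono (le_of_eq (by ring))
    simp only [mulVec_mean_add]
    ring
  refine ((L1Le.sum Finset.univ fun i _ => L1Le.sum Finset.univ fun j _ => hterm i j).congr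
    fun ω => ?_).mono (le_of_eq ?_)
  · simp only [← Finset.sum_sub_distrib, mul_sub]
  · have e1 : ∑ i, ∑ j, a * P i j ^ 2 * (2 * q * p i) = 2 * a * q * ∑ i, P i i * p i := by
      rw [Finset.mul_sum]
      refine Finset.sum_congr rfl fun i _ => ?_
      rw [← hP.sum_sq i, Finset.sum_mul, Finset.mul_sum]
      exact Finset.sum_congr rfl fun j _ => by ring
    have e2 : ∑ i, ∑ j, a * P i j ^ 2 * (2 * q * p j) = 2 * a * q * ∑ i, P i i * p i := by
      rw [Finset.sum_comm, Finset.mul_sum]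
      refine Finset.sum_congr rfl fun i _ => ?_
      rw [← hP.sum_sq' i, Finset.sum_mul, Finset.mul_sum]
      exact Finset.sum_congr rfl fun j _ => by ring
    simp only [mul_add, Finset.sum_add_distrib]
    rw [e1, e2]
    ring

/-- Removing the means from the leave-one-out sum. -/
theorem L1Le.leaveOneOut_perturb (hP : IsProjection P) (hle : ∀ k, 𝓕 k ≤ mΩ) (hind : iIndep 𝓕 μ)
    (hm : 1 ≤ m) (hp : ∀ k, p k ≤ b)
    (h : MeanNoise μ 𝓕 m P p α x)
    (h₃ : MeanNoise μ 𝓕 m P p α₃ x₃) (h₄ : MeanNoise μ 𝓕 m P p α₄ x₄)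
    (d : ι → ℝ) (hda : ∀ i, |d i| ≤ a) :
    L1Le μ (fun ω => ∑ i, (offDiag P *ᵥ fun k => α k + x k ω) i *
          (offDiag P *ᵥ fun k => α k + x k ω) i *
        ((α₃ i + x₃ i ω) * ((1 - P) *ᵥ fun k => α₄ k + x₄ k ω) i * d i)
      - ∑ i, (offDiag P *ᵥ fun k => x k ω) i * (offDiag P *ᵥ fun k => x k ω) i *
        (x₃ i ω * ((1 - P) *ᵥ fun k => x₄ k ω) i * d i))
      (8 * a * m * (8 * (b ^ 4 + 10 * m ^ 2)) * ∑ i, ((offDiag P *ᵥ α) i ^ 2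
        + |(offDiag P *ᵥ α) i| * √(P i i) + P i i * p i)) := by
  set q := 8 * (b ^ 4 + 10 * m ^ 2) with hq
  have hq1 : 1 ≤ q := by rw [hq]; nlinarith [sq_nonneg (b ^ 2)]
  have hm0 : 0 ≤ m := zero_le_one.trans hm
  have hsqrt : ∀ t : ℝ, 1 ≤ t → √t ≤ t := fun t ht =>
    Real.sqrt_le_iff.2 ⟨by linarith, by nlinarith⟩
  have hrow : ∀ i, ∑ k, offDiag P i k ^ 2 ≤ P i i := fun i => by
    rw [← hP.sum_sq i]; exact Finset.sum_le_sum fun k _ => sq_offDiag_le P i k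
  have hterm : ∀ i, L1Le μ (fun ω => d i *
        ((offDiag P *ᵥ fun k => α k + x k ω) i * (offDiag P *ᵥ fun k => α k + x k ω) i *
          ((α₃ i + x₃ i ω) * ((1 - P) *ᵥ fun k => α₄ k + x₄ k ω) i) -
        (offDiag P *ᵥ fun k => x k ω) i * (offDiag P *ᵥ fun k => x k ω) i *
        (x₃ i ω * ((1 - P) *ᵥ fun k => x₄ k ω) i)))
      (a * (8 * m * q * ((offDiag P *ᵥ α) i ^ 2
        + |(offDiag P *ᵥ α) i| * √(P i i) + P i i * p i))) := fun i => by
    refine L1Le.const_mul_le ?_ (hda i)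
    have f₃ := h₃.fourth_noise hle hm (b := b) i
    have g₃ := h₃.fourth hle hm hp i
    have g₄ := h₄.fourth_mulVec hP hle hind hm hp i
    have hPi := hP.diag_nonneg i
    have hpi := h.nonneg i
    obtain ⟨l2, l2'⟩ := sq_linear_le hle hind hm0 (h.sixth.noise hle hm) h.mean
      fun k => offDiag P i k
    have l4 := (h.sixth.fourth_sum hle hind hm h.mean fun k => offDiag P i k)
    have l4' := l4.sq_mul l4
    have hL2 : ∫ ω, (∑ k, offDiag P i k * x k ω) ^ 2 ∂μ ≤ m * P i i :=
      l2'.trans (mul_le_mul_of_nonneg_left (hrow i) hm0)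
    have hL4 : ∫ ω, ((∑ k, offDiag P i k * x k ω) * ∑ k, offDiag P i k * x k ω) ^ 2 ∂μ ≤
        (4 * m * P i i) ^ 2 := by
      refine l4'.2.trans ?_
      have : (∑ k, offDiag P i k ^ 2) ^ 2 ≤ P i i ^ 2 :=
        pow_le_pow_left₀ (Finset.sum_nonneg fun k _ => sq_nonneg _) (hrow i) 2
      nlinarith [mul_le_mul_of_nonneg_left this (sq_nonneg m), mul_nonneg (sq_nonneg m)
        (sq_nonneg (P i i))]
    have gg := g₃.sq_mul g₄
    -- The squared fit changes by (pα)² + 2(pα)(px), which gives `t1` and `t2`; the other two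
    -- factors give `t3` and `t4`. The second moment of px is at most mPᵢᵢ and that of (px)² at most
    -- (4mPᵢᵢ)², which supplies the weights √Pᵢᵢ and Pᵢᵢ.
    have t1 := (g₃.mul₂ hq1 g₄).const_mul_le (abs_of_nonneg (sq_nonneg ((offDiag P *ᵥ α) i))).le
    have t2 := (L1Le.mul l2 gg.1 hL2 gg.2).const_mul_le
      (c := 2 * (offDiag P *ᵥ α) i) (d := 2 * |(offDiag P *ᵥ α) i|) (by rw [abs_mul]; simp)
    have t3 := (L1Le.mul l4'.1 (g₄.sq hq1).1 hL4 (g₄.sq hq1).2).const_mul_le (h₃.le i)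
    have t4 := (L1Le.mul l4'.1 (f₃.sq hq1).1 hL4 (f₃.sq hq1).2).const_mul_le (h₄.le' i)
    refine ((((t1.add t2).add t3).add t4).congr fun ω => ?_).mono ?_
    · simp only [mulVec_mean_add]
      have : (offDiag P *ᵥ fun k => x k ω) i = ∑ k, offDiag P i k * x k ω := rfl
      rw [this]
      ring
    · rw [Real.sqrt_sq (by positivity), Real.sqrt_mul hm0]
      have hsq := hsqrt q hq1
      have hsm := hsqrt m hm
      have b1 : (offDiag P *ᵥ α) i ^ 2 * q ≤ 8 * m * q * (offDiag P *ᵥ α) i ^ 2 := by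
        have : 0 ≤ (offDiag P *ᵥ α) i ^ 2 * q := by positivity
        nlinarith
      have b2 : 2 * |(offDiag P *ᵥ α) i| * (√m * √(P i i) * √q) ≤
          8 * m * q * (|(offDiag P *ᵥ α) i| * √(P i i)) := by
        calc _ ≤ 2 * |(offDiag P *ᵥ α) i| * (m * √(P i i) * q) := by gcongr
          _ = 2 * (m * q * (|(offDiag P *ᵥ α) i| * √(P i i))) := by ring
          _ ≤ 8 * (m * q * (|(offDiag P *ᵥ α) i| * √(P i i))) := by gcongr; norm_num
          _ = _ := by ring
      have b3 : p i * (4 * m * P i i * √q) ≤ 4 * m * q * (P i i * p i) := by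
        calc _ ≤ p i * (4 * m * P i i * q) := by gcongr
          _ = _ := by ring
      calc _ ≤ 8 * m * q * (offDiag P *ᵥ α) i ^ 2 +
            8 * m * q * (|(offDiag P *ᵥ α) i| * √(P i i)) + 4 * m * q * (P i i * p i)
            + 4 * m * q * (P i i * p i) := by linarith
        _ = _ := by ring
  refine ((L1Le.sum Finset.univ fun i _ => hterm i).congr fun ω => ?_).mono (le_of_eq ?_)
  · rw [← Finset.sum_sub_distrib]
    exact Finset.sum_congr rfl fun i _ => by ring
  · rw [Finset.mul_sum]
    exact Finset.sum_congr rfl fun i _ => by ring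

end Perturbation

/-! ### The projection onto the instruments. -/

section Instruments

/-- A singular ZᵀZ has inverse 0 by convention, which makes P = 0 and so K = 0; but the empty
determinant is 1. -/
lemma isUnit_det_of_rank_projZ {n K : ℕ} {Z : Matrix (Fin n) (Fin K) ℝ} (h : (projZ Z).rank = K) :
    IsUnit (Zᵀ * Z).det := by
  by_contra hdet
  have h0 : projZ Z = 0 := by
    rw [projZ, Matrix.nonsing_inv_apply_not_isUnit _ hdet, Matrix.mul_zero, Matrix.zero_mul]
  rw [h0, Matrix.rank_zero] at h
  subst h
  exact hdet (by simp)

lemma isProjection_projZ {n K : ℕ} {Z : Matrix (Fin n) (Fin K) ℝ} (h : (projZ Z).rank = K) :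
    IsProjection (projZ Z) where
  symm := by
    rw [projZ, Matrix.transpose_mul, Matrix.transpose_mul, Matrix.transpose_transpose,
      Matrix.transpose_nonsing_inv, Matrix.transpose_mul, Matrix.transpose_transpose,
      Matrix.mul_assoc]
  idem := by
    have hu := isUnit_det_of_rank_projZ h
    calc projZ Z * projZ Z = Z * ((Zᵀ * Z)⁻¹ * (Zᵀ * Z)) * (Zᵀ * Z)⁻¹ * Zᵀ := by
          simp only [projZ, Matrix.mul_assoc]
      _ = projZ Z := by rw [Matrix.nonsing_inv_mul _ hu, Matrix.mul_one, projZ]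

lemma trace_projZ {n K : ℕ} {Z : Matrix (Fin n) (Fin K) ℝ} (h : (projZ Z).rank = K) :
    (projZ Z).trace = K := by
  rw [projZ, Matrix.trace_mul_comm, ← Matrix.mul_assoc,
    Matrix.mul_nonsing_inv _ (isUnit_det_of_rank_projZ h), Matrix.trace_one, Fintype.card_fin]

end Instruments

/-! ### Finite-sample bounds for the two forms. -/

section FiniteSample

variable {n : ℕ} {P : Matrix (Fin n) (Fin n) ℝ} {κ : ℝ}

lemma offSum_eq (f : Fin n → Fin n → ℝ) : offSum f = ∑ i, ∑ j, if j ≠ i then f i j else 0 := by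
  simp only [offSum, Finset.sum_filter]

lemma loo_eq (P : Matrix (Fin n) (Fin n) ℝ) (v : Fin n → ℝ) (i : Fin n) :
    loo P v i = (offDiag P *ᵥ v) i := by
  simp only [loo, Finset.sum_filter, Matrix.mulVec, dotProduct, offDiag]
  exact Finset.sum_congr rfl fun j _ => by by_cases h : j = i <;> simp [h]

lemma cfWeight_den_pos (hκ : 0 < κ) (hd : ∀ i, κ ≤ annih P i i) (i j : Fin n) :
    κ ^ 2 ≤ annih P i i * annih P j j + annih P i j ^ 2 := by
  nlinarith [mul_le_mul (hd i) (hd j) hκ.le (hκ.le.trans (hd i)), sq_nonneg (annih P i j)]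

lemma abs_cfWeight_le (hκ : 0 < κ) (hd : ∀ i, κ ≤ annih P i i) (i j : Fin n) :
    |cfWeight P i j| ≤ (κ ^ 2)⁻¹ * P i j ^ 2 := by
  have h := cfWeight_den_pos hκ hd i j
  have h2 : 0 < κ ^ 2 := by positivity
  rw [cfWeight, abs_of_nonneg (div_nonneg (sq_nonneg _) (h2.le.trans h)), inv_mul_eq_div]
  gcongr

/-- The design of the cross-fit weight: its denominator is the factor that the noise expectation
produces. -/
lemma cfWeight_mul (hκ : 0 < κ) (hd : ∀ i, κ ≤ annih P i i) (i j : Fin n) :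
    cfWeight P i j * (annih P i i * annih P j j + annih P i j ^ 2) = P i j ^ 2 := by
  have h := cfWeight_den_pos hκ hd i j
  have h2 : 0 < κ ^ 2 := by positivity
  rw [cfWeight, div_mul_cancel₀ _ (h2.trans_le h).ne']

lemma IsProjection.cfWeight_comm (hP : IsProjection P) (i j : Fin n) :
    cfWeight P i j = cfWeight P j i := by
  have h : annih P i j = annih P j i := hP.compl.apply_comm i j
  rw [cfWeight, cfWeight, hP.apply_comm i j, h, mul_comm (annih P i i)]

/-- The cross-fit double sum, without normalisation. -/
noncomputable def crossForm (P : Matrix (Fin n) (Fin n) ℝ) (r₁ r₂ r₃ r₄ : Fin n → ℝ) : ℝ :=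
  offSum fun i j => cfWeight P i j * (r₁ i * (annih P *ᵥ r₂) i * (r₃ j * (annih P *ᵥ r₄) j))

/-- The leave-one-out sum, without normalisation. -/
noncomputable def looForm (P : Matrix (Fin n) (Fin n) ℝ) (r r₃ r₄ : Fin n → ℝ) : ℝ :=
  ∑ i, loo P r i ^ 2 * (r₃ i * (annih P *ᵥ r₄) i / annih P i i)

/-- `∑ᵢ ∑_{j ≠ i} Pᵢⱼ² fᵢ gⱼ`. -/
def pairSum (P : Matrix (Fin n) (Fin n) ℝ) (f g : Fin n → ℝ) : ℝ :=
  offSum fun i j => P i j ^ 2 * (f i * g j)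

variable {Ω : Type*} {mΩ : MeasurableSpace Ω} {μ : Measure Ω} [IsProbabilityMeasure μ]
  {𝓕 : Fin n → MeasurableSpace Ω} {m b : ℝ}
  {x x₁ x₂ x₃ x₄ : Fin n → Ω → ℝ} {α α₁ α₂ α₃ α₄ p : Fin n → ℝ}

/-- The second moments at the exchanged pairs of indices factor as those at the original pairs,
up to an exchange of the two indices. -/
def PairSymm (μ : Measure Ω) (x₁ x₂ x₃ x₄ : Fin n → Ω → ℝ) : Prop :=
  (∀ i j, (∫ ω, x₁ i ω * x₄ i ω ∂μ) * ∫ ω, x₂ j ω * x₃ j ω ∂μ =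
      (∫ ω, x₁ i ω * x₂ i ω ∂μ) * ∫ ω, x₃ j ω * x₄ j ω ∂μ) ∨
    ∀ i j, (∫ ω, x₁ i ω * x₄ i ω ∂μ) * ∫ ω, x₂ j ω * x₃ j ω ∂μ =
      (∫ ω, x₁ j ω * x₂ j ω ∂μ) * ∫ ω, x₃ i ω * x₄ i ω ∂μ

/-- Means are removed, then the noise concentrates. `PairSymm` merges the means with weights MᵢᵢMⱼⱼ
and Mᵢⱼ² into one product of moments, so that the denominator of the weight cancels. -/
theorem L1Le.crossForm (hP : IsProjection P) (hκ : 0 < κ)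
    (hd : ∀ i, κ ≤ annih P i i) (hle : ∀ k, 𝓕 k ≤ mΩ) (hind : iIndep 𝓕 μ)
    (hm : 1 ≤ m) (hp : ∀ k, p k ≤ b)
    (h₁ : MeanNoise μ 𝓕 m P p α₁ x₁) (h₂ : MeanNoise μ 𝓕 m P p α₂ x₂)
    (h₃ : MeanNoise μ 𝓕 m P p α₃ x₃) (h₄ : MeanNoise μ 𝓕 m P p α₄ x₄)
    (hs : PairSymm μ x₁ x₂ x₃ x₄) :
    L1Le μ (fun ω => crossForm P (fun k => α₁ k + x₁ k ω) (fun k => α₂ k + x₂ k ω)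
        (fun k => α₃ k + x₃ k ω) (fun k => α₄ k + x₄ k ω)
      - pairSum P (fun i => ∫ ω', x₁ i ω' * x₂ i ω' ∂μ) fun j => ∫ ω', x₃ j ω' * x₄ j ω' ∂μ)
      (4 * (κ ^ 2)⁻¹ * (8 * (b ^ 4 + 10 * m ^ 2)) * (∑ i, P i i * p i)
        + 160 * m ^ 2 * (κ ^ 2)⁻¹ * √P.trace) := by
  set W : Fin n → Fin n → ℝ := fun i j => if j ≠ i then cfWeight P i j else 0 with hWdef
  have hW0 : ∀ i, W i i = 0 := fun i => by simp [hWdef]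
  have hW : ∀ i j, |W i j| ≤ (κ ^ 2)⁻¹ * P i j ^ 2 := fun i j => by
    simp only [hWdef]
    split_ifs
    · exact abs_cfWeight_le hκ hd i j
    · rw [abs_zero]; positivity
  have ha : 0 ≤ (κ ^ 2)⁻¹ := by positivity
  refine ((L1Le.crossFit_perturb hP hle hind hm hp h₁ h₂ h₃ h₄ W hW).add
    (L1Le.crossFit_noise hP hle hind hm ha h₁.sixth h₂.sixth h₃.sixth h₄.sixth h₁.mean h₂.mean
      h₃.mean h₄.mean W hW0 hW)).congr fun ω => ?_
  rw [sub_add_sub_cancel]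
  congr 1
  · simp only [ManyIV.crossForm, offSum_eq, hWdef, ite_mul, zero_mul, annih]
  · have e1 : pairSum P (fun i => ∫ ω', x₁ i ω' * x₂ i ω' ∂μ)
        (fun j => ∫ ω', x₃ j ω' * x₄ j ω' ∂μ) =
        ∑ i, ∑ j, W i j * (((1 - P) i i * (1 - P) j j + (1 - P) i j ^ 2) *
          ((∫ ω', x₁ i ω' * x₂ i ω' ∂μ) * ∫ ω', x₃ j ω' * x₄ j ω' ∂μ)) := by
      rw [pairSum, offSum_eq]
      refine Finset.sum_congr rfl fun i _ => Finset.sum_congr rfl fun j _ => ?_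
      simp only [hWdef]
      split_ifs
      · rw [← cfWeight_mul hκ hd i j]; simp only [annih]; ring
      · rw [zero_mul]
    rw [e1]
    rcases hs with hs | hs
    · refine Finset.sum_congr rfl fun i _ => Finset.sum_congr rfl fun j _ => ?_
      rw [hs i j]; ring
    · simp only [add_mul, mul_add, Finset.sum_add_distrib]
      congr 1
      -- In the exchanged case only the Mᵢⱼ² part is relabelled, which is legitimate because the
      -- weights and M are symmetric.
      rw [Finset.sum_comm]
      refine Finset.sum_congr rfl fun i _ => Finset.sum_congr rfl fun j _ => ?_
      rw [hs i j, hP.compl.apply_comm i j]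
      simp only [hWdef, ne_eq, eq_comm (a := i) (b := j)]
      rw [hP.cfWeight_comm i j]

/-- Division by Mᵢᵢ is the choice of `d` in the noise bound, and κ ≤ 1 gives the required κ⁻¹ ≥ 1.
No moment symmetry is needed, since only one pattern has a mean. -/
theorem L1Le.looForm (hP : IsProjection P) (hκ : 0 < κ) (hκ1 : κ ≤ 1)
    (hd : ∀ i, κ ≤ annih P i i) (hle : ∀ k, 𝓕 k ≤ mΩ) (hind : iIndep 𝓕 μ)
    (hm : 1 ≤ m) (hp : ∀ k, p k ≤ b)
    (h : MeanNoise μ 𝓕 m P p α x)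
    (h₃ : MeanNoise μ 𝓕 m P p α₃ x₃) (h₄ : MeanNoise μ 𝓕 m P p α₄ x₄) :
    L1Le μ (fun ω => looForm P (fun k => α k + x k ω) (fun k => α₃ k + x₃ k ω)
        (fun k => α₄ k + x₄ k ω)
      - pairSum P (fun i => ∫ ω', x₃ i ω' * x₄ i ω' ∂μ) fun j => ∫ ω', x j ω' * x j ω' ∂μ)
      (8 * κ⁻¹ * m * (8 * (b ^ 4 + 10 * m ^ 2)) * (∑ i, (loo P α i ^ 2
        + |loo P α i| * √(P i i) + P i i * p i)) + 112 * m ^ 2 * κ⁻¹ * √P.trace) := by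
  have hd0 : ∀ i, 0 < annih P i i := fun i => hκ.trans_le (hd i)
  have hdm : ∀ i, (1 - P) i i * (annih P i i)⁻¹ = 1 := fun i => mul_inv_cancel₀ (hd0 i).ne'
  have hda : ∀ i, |(annih P i i)⁻¹| ≤ κ⁻¹ := fun i => by
    rw [abs_of_nonneg (inv_nonneg.2 (hd0 i).le)]
    exact inv_anti₀ hκ (hd i)
  have := (L1Le.leaveOneOut_perturb hP hle hind hm hp h h₃ h₄
    (fun i => (annih P i i)⁻¹) hda).add
    (L1Le.leaveOneOut_noise hP hle hind hm ((one_le_inv₀ hκ).2 hκ1) h.sixth h.sixth h₃.sixth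
      h₄.sixth h.mean h.mean h₃.mean h₄.mean (fun i => (annih P i i)⁻¹) hdm hda)
  simp only [← loo_eq] at this
  refine this.congr fun ω => ?_
  rw [sub_add_sub_cancel]
  congr 1
  · simp only [ManyIV.looForm, annih, sq, div_eq_mul_inv]
  · rw [pairSum, offSum_eq]
    refine Finset.sum_congr rfl fun i _ => Finset.sum_congr rfl fun j _ => ?_
    by_cases hj : j = i <;> simp [offDiag, hj]

end FiniteSample

/-! ### The estimators as combinations of the two forms. -/

section Estimators

variable {n : ℕ} (K : ℕ) {P : Matrix (Fin n) (Fin n) ℝ} (X r : Fin n → ℝ)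

lemma hatPhi1_eq : hatPhi1 K P r = 2 * (1 / (K : ℝ) * crossForm P r r r r) := by
  simp only [hatPhi1, crossForm, mul_assoc]; ring

lemma offSum_comm (f : Fin n → Fin n → ℝ) : offSum f = offSum fun i j => f j i := by
  rw [offSum_eq, offSum_eq, Finset.sum_comm]
  simp only [ne_eq, eq_comm]

lemma offSum_add (f g : Fin n → Fin n → ℝ) :
    (offSum fun i j => f i j + g i j) = offSum f + offSum g := by
  simp only [offSum, Finset.sum_add_distrib]

/-- The two summands are interchanged by i ↔ j, and the weight is symmetric. -/
lemma hatPhi12_eq (hP : IsProjection P) :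
    hatPhi12 K P X r = 2 * (1 / (K : ℝ) * crossForm P r r r X) := by
  have h : (offSum fun i j => cfWeight P i j *
      ((annih P *ᵥ X) j * r j * (r i * (annih P *ᵥ r) i)
        + (annih P *ᵥ X) i * r i * (r j * (annih P *ᵥ r) j))) =
      crossForm P r r r X + crossForm P r r r X := by
    simp only [mul_add, offSum_add]
    congr 1
    · rw [crossForm]
      congr 1; funext i j; ring
    · rw [offSum_comm, crossForm]
      congr 1; funext i j; rw [hP.cfWeight_comm j i]; ring
  rw [hatPhi12, h]; ring

lemma hatPhi13_eq : hatPhi13 K P X r = 2 * (1 / (K : ℝ) * crossForm P r X r X) := by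
  have h : (offSum fun i j => cfWeight P i j * ((annih P *ᵥ X) i * r i) *
      ((annih P *ᵥ X) j * r j)) = crossForm P r X r X := by
    rw [crossForm]; congr 1; funext i j; ring
  rw [hatPhi13, h]; ring

lemma hatPsi_eq : hatPsi K P X r =
    1 / (K : ℝ) * looForm P X r r + 1 / (K : ℝ) * crossForm P r X r X := by
  have h : (offSum fun i j => cfWeight P i j * ((annih P *ᵥ X) i * r i) *
      ((annih P *ᵥ X) j * r j)) = crossForm P r X r X := by
    rw [crossForm]; congr 1; funext i j; ring
  rw [hatPsi, h, looForm]; ring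

lemma hatTau_eq : hatTau K P X r = 1 / (K : ℝ) * crossForm P X X r X
    + (1 / 2) * (1 / (K : ℝ) * looForm P X r X) + (1 / 2) * (1 / (K : ℝ) * looForm P X X r) := by
  have h : (offSum fun i j => cfWeight P i j * (X i * (annih P *ᵥ X) i) *
      ((annih P *ᵥ X) j * r j)) = crossForm P X X r X := by
    rw [crossForm]; congr 1; funext i j; ring
  have h2 : ∑ i, loo P X i ^ 2 *
        (r i * (annih P *ᵥ X) i / (2 * annih P i i) + X i * (annih P *ᵥ r) i / (2 * annih P i i))
      = (1 / 2) * looForm P X r X + (1 / 2) * looForm P X X r := by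
    simp only [looForm, Finset.mul_sum, ← Finset.sum_add_distrib]
    refine Finset.sum_congr rfl fun i _ => ?_
    rw [mul_comm 2, ← div_div, ← div_div]; ring
  rw [hatTau, h, h2]; ring

lemma hatUpsilon_eq : hatUpsilon K P X = 2 * (1 / (K : ℝ) * crossForm P X X X X) := by
  simp only [hatUpsilon, crossForm, mul_assoc]; ring

end Estimators

/-! ### Convergence in L¹ along the array. -/

section Vanishing

variable {Ω : ℕ → Type*} [∀ n, MeasurableSpace (Ω n)] {μ : ∀ n, Measure (Ω n)}
  {F G : ∀ n, Ω n → ℝ}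

/-- Convergence to zero in `L¹`. -/
def VanishesL1 (μ : ∀ n, Measure (Ω n)) (F : ∀ n, Ω n → ℝ) : Prop :=
  ∃ a : ℕ → ℝ, Tendsto a atTop (𝓝 0) ∧ ∀ᶠ n in atTop, L1Le (μ n) (F n) (a n)

lemma VanishesL1.add (hF : VanishesL1 μ F) (hG : VanishesL1 μ G) :
    VanishesL1 μ fun n ω => F n ω + G n ω := by
  obtain ⟨a, ha, ha'⟩ := hF
  obtain ⟨b, hb, hb'⟩ := hG
  exact ⟨fun n => a n + b n, by simpa using ha.add hb,
    by filter_upwards [ha', hb'] with n h1 h2 using h1.add h2⟩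

lemma VanishesL1.const_mul (c : ℝ) (hF : VanishesL1 μ F) :
    VanishesL1 μ fun n ω => c * F n ω := by
  obtain ⟨a, ha, ha'⟩ := hF
  exact ⟨fun n => |c| * a n, by simpa using ha.const_mul |c|,
    by filter_upwards [ha'] with n h1 using h1.const_mul c⟩

lemma VanishesL1.congr (hF : VanishesL1 μ F) (h : ∀ n ω, G n ω = F n ω) : VanishesL1 μ G := by
  have : G = F := funext fun n => funext fun ω => h n ω
  rwa [this]

variable [∀ n, IsProbabilityMeasure (μ n)]

lemma VanishesL1.of_tendsto {u : ℕ → ℝ} (hu : Tendsto u atTop (𝓝 0)) :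
    VanishesL1 μ fun n _ => u n :=
  ⟨fun n => |u n|, by simpa using hu.abs, Eventually.of_forall fun n =>
    ⟨integrable_const _, by simp⟩⟩

/-- Markov's inequality. -/
lemma VanishesL1.isLittleOp (hF : VanishesL1 μ F) : IsLittleOp μ F := by
  obtain ⟨a, ha, ha'⟩ := hF
  intro ε hε
  have h1 : ∀ᶠ n in atTop, μ n {ω | ε ≤ |F n ω|} ≤ ENNReal.ofReal (a n / ε) := by
    filter_upwards [ha'] with n hn
    have h2 := mul_meas_ge_le_integral_of_nonneg (μ := μ n) (f := fun ω => |F n ω|)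
      (ae_of_all _ fun ω => abs_nonneg _) hn.1.abs ε
    rw [← ofReal_measureReal]
    refine ENNReal.ofReal_le_ofReal ?_
    rw [le_div_iff₀ hε, mul_comm]
    exact h2.trans hn.2
  have h3 : Tendsto (fun n => ENNReal.ofReal (a n / ε)) atTop (𝓝 0) := by
    have := ENNReal.tendsto_ofReal (ha.div_const ε)
    simpa using this
  exact tendsto_of_tendsto_of_tendsto_of_le_of_le' tendsto_const_nhds h3
    (Eventually.of_forall fun n => zero_le) h1

end Vanishing

/-! ### Bounds along the drifting sequence of models. -/

section Sequences

variable {Ω : ℕ → Type*} [∀ n, MeasurableSpace (Ω n)] {μ : ∀ n, Measure (Ω n)} {D : IVArray Ω}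

/-- The `σ`-algebra generated by the `i`th pair of errors. -/
@[reducible] def errField (D : IVArray Ω) (n : ℕ) (i : Fin n) : MeasurableSpace (Ω n) :=
  MeasurableSpace.comap (fun ω => (D.V n i ω, D.e n i ω)) inferInstance

/-- The noise in the null-imposed residuals. -/
noncomputable def residNoise (D : IVArray Ω) (b : ℝ) (n : ℕ) (i : Fin n) (ω : Ω n) : ℝ :=
  D.e n i ω + D.Del b n * D.V n i ω

/-- A bound on the mean vectors and on their projections. -/
noncomputable def meanBound (D : IVArray Ω) (c : ℝ) (n : ℕ) (i : Fin n) : ℝ :=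
  c * (|D.Pi n i| + |(annih (D.P n) *ᵥ D.Pi n) i|)

omit [∀ n, MeasurableSpace (Ω n)] in
lemma resid_eq (D : IVArray Ω) (b : ℝ) (n : ℕ) (ω : Ω n) :
    D.resid b n ω = fun i => D.Del b n * D.Pi n i + residNoise D b n i ω := by
  funext i
  simp only [IVArray.resid, IVArray.Y, IVArray.X, IVArray.Del, residNoise]
  ring

lemma ErrorsAndProjection.errField_le (h : ErrorsAndProjection μ D) (n : ℕ) (i : Fin n) :
    errField D n i ≤ (inferInstance : MeasurableSpace (Ω n)) :=
  ((h.meas_V n i).prodMk (h.meas_e n i)).comap_le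

lemma ErrorsAndProjection.iIndep_errField (h : ErrorsAndProjection μ D) (n : ℕ) :
    iIndep (errField D n) (μ n) :=
  (iIndepFun_iff_iIndep ..).1 (h.indep n)

lemma ErrorsAndProjection.isProjection (h : ErrorsAndProjection μ D) (n : ℕ) :
    IsProjection (D.P n) := isProjection_projZ (h.rank_P n)

lemma ErrorsAndProjection.trace (h : ErrorsAndProjection μ D) (n : ℕ) :
    (D.P n).trace = D.K n := trace_projZ (h.rank_P n)

lemma ErrorsAndProjection.exists_diag (h : ErrorsAndProjection μ D) :
    ∃ κ : ℝ, 0 < κ ∧ κ ≤ 1 ∧ ∀ n i, κ ≤ annih (D.P n) i i := by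
  obtain ⟨δ, hδ, h1⟩ := h.diag_P
  refine ⟨min 1 (1 - δ), lt_min one_pos (by linarith), min_le_left _ _, fun n i => ?_⟩
  refine (min_le_right _ _).trans ?_
  rw [annih, Matrix.sub_apply, Matrix.one_apply_eq]
  linarith [h1 n i]

omit [∀ n, MeasurableSpace (Ω n)] in
lemma measurable_errField_V (D : IVArray Ω) (n : ℕ) (i : Fin n) :
    Measurable[errField D n i] (D.V n i) := by
  have h : Measurable[errField D n i] fun ω => (D.V n i ω, D.e n i ω) := comap_measurable _
  exact measurable_fst.comp h

omit [∀ n, MeasurableSpace (Ω n)] in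
lemma measurable_errField_e (D : IVArray Ω) (n : ℕ) (i : Fin n) :
    Measurable[errField D n i] (D.e n i) := by
  have h : Measurable[errField D n i] fun ω => (D.V n i ω, D.e n i ω) := comap_measurable _
  exact measurable_snd.comp h

/-- The residual noise is e + ΔV, and (a + b)⁶ ≤ 2⁵(a⁶ + b⁶) explains the 32. One constant `m`
serves all three families and all sample sizes. -/
lemma sixthMoment_errors (hP : ErrorsAndProjection μ D) (hreg : Regularity μ D) {b c : ℝ}
    (hc : 1 ≤ c) (hΔ : ∀ n, |D.Del b n| ≤ c) : ∃ m, 1 ≤ m ∧ ∀ n,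
      SixthMoment (μ n) (errField D n) m (D.e n) ∧ SixthMoment (μ n) (errField D n) m (D.V n) ∧
      SixthMoment (μ n) (errField D n) m (residNoise D b n) := by
  obtain ⟨C, hC⟩ := hreg.moment
  set m₀ := max C 1
  have hm₀ : 1 ≤ m₀ := le_max_right _ _
  have hc6 : 1 ≤ c ^ 6 := one_le_pow₀ hc
  set m := 32 * (m₀ + c ^ 6 * m₀)
  have hm : m₀ ≤ m := by simp only [m]; nlinarith
  refine ⟨m, hm₀.trans hm, fun n => ⟨⟨measurable_errField_e D n, fun k => (hC n k).1, fun k =>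
    ((hC n k).2.2.1.trans (le_max_left _ _)).trans hm⟩, ⟨measurable_errField_V D n,
    fun k => (hC n k).2.1, fun k => ((hC n k).2.2.2.trans (le_max_left _ _)).trans hm⟩, ?_⟩⟩
  have hmeas : ∀ k, Measurable[errField D n k] (residNoise D b n k) := fun k =>
    (measurable_errField_e D n k).add ((measurable_errField_V D n k).const_mul _)
  have hb : ∀ k ω, residNoise D b n k ω ^ 6 ≤ 32 * (D.e n k ω ^ 6 + c ^ 6 * D.V n k ω ^ 6) := by
    intro k ω
    have h1 := Even.add_pow_le (by decide : Even 6) (a := D.e n k ω)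
      (b := D.Del b n * D.V n k ω)
    have h2 : (D.Del b n * D.V n k ω) ^ 6 ≤ c ^ 6 * D.V n k ω ^ 6 := by
      rw [mul_pow, ← Even.pow_abs (by decide : Even 6) (D.Del b n)]
      exact mul_le_mul_of_nonneg_right (pow_le_pow_left₀ (abs_nonneg _) (hΔ n) 6)
        (by positivity)
    rw [residNoise]
    norm_num at h1
    linarith
  have hi : ∀ k, Integrable (fun ω => 32 * (D.e n k ω ^ 6 + c ^ 6 * D.V n k ω ^ 6)) (μ n) :=
    fun k => ((hC n k).1.add ((hC n k).2.1.const_mul _)).const_mul _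
  have hint : ∀ k, Integrable (fun ω => residNoise D b n k ω ^ 6) (μ n) := fun k =>
    (hi k).mono' ((((hmeas k).mono (hP.errField_le n k) le_rfl).pow_const 6).aestronglyMeasurable)
      (ae_of_all _ fun ω => by rw [Real.norm_of_nonneg (by positivity)]; exact hb k ω)
  refine ⟨hmeas, hint, fun k => (integral_mono (hint k) (hi k) (hb k)).trans ?_⟩
  rw [integral_const_mul, integral_add (hC n k).1 ((hC n k).2.1.const_mul _), integral_const_mul]
  have h1 := (hC n k).2.2.1.trans (le_max_left C 1)
  have h2 := (hC n k).2.2.2.trans (le_max_left C 1)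
  simp only [m]
  gcongr

lemma meanNoise_errors (hP : ErrorsAndProjection μ D) (hreg : Regularity μ D) {b c : ℝ}
    (hc : 1 ≤ c) (hΔ : ∀ n, |D.Del b n| ≤ c) : ∃ m, 1 ≤ m ∧ ∀ n,
      MeanNoise (μ n) (errField D n) m (D.P n) (meanBound D c n) (D.Pi n) (D.V n) ∧
      MeanNoise (μ n) (errField D n) m (D.P n) (meanBound D c n)
        (fun i => D.Del b n * D.Pi n i) (residNoise D b n) := by
  obtain ⟨m, hm, h⟩ := sixthMoment_errors hP hreg hc hΔ
  have h0 : ∀ n i, 0 ≤ |D.Pi n i| + |(annih (D.P n) *ᵥ D.Pi n) i| := fun n i => by positivity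
  have h1 : ∀ n i, |D.Pi n i| ≤ meanBound D c n i := fun n i => by
    have := h0 n i
    rw [meanBound]; nlinarith [abs_nonneg ((annih (D.P n) *ᵥ D.Pi n) i)]
  have h2 : ∀ n i, |(annih (D.P n) *ᵥ D.Pi n) i| ≤ meanBound D c n i := fun n i => by
    have := h0 n i
    rw [meanBound]; nlinarith [abs_nonneg (D.Pi n i)]
  refine ⟨m, hm, fun n => ⟨⟨(h n).2.1, fun k => (hP.mean_V n k).2, h1 n, h2 n⟩,
    ⟨(h n).2.2, fun k => ?_, fun k => ?_, fun k => ?_⟩⟩⟩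
  · simp only [residNoise]
    rw [integral_add (hP.mean_e n k).1 ((hP.mean_V n k).1.const_mul _), integral_const_mul,
      (hP.mean_e n k).2, (hP.mean_V n k).2]
    simp
  · rw [abs_mul, meanBound]
    exact mul_le_mul (hΔ n) (le_add_of_nonneg_right (abs_nonneg _)) (abs_nonneg _)
      (zero_le_one.trans hc)
  · have e : (fun i => D.Del b n * D.Pi n i) = D.Del b n • D.Pi n := rfl
    rw [e, Matrix.mulVec_smul, Pi.smul_apply, smul_eq_mul, abs_mul, meanBound]
    exact mul_le_mul (hΔ n) (le_add_of_nonneg_left (abs_nonneg _)) (abs_nonneg _)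
      (zero_le_one.trans hc)

lemma sum_sq_annih_mulVec (hP : ErrorsAndProjection μ D) (n : ℕ) :
    ∑ i, (annih (D.P n) *ᵥ D.Pi n) i ^ 2 = D.Pi n ⬝ᵥ (annih (D.P n) *ᵥ D.Pi n) :=
  (hP.isProjection n).compl.sum_sq_mulVec _

lemma dotProduct_self_eq {n : ℕ} (v : Fin n → ℝ) : v ⬝ᵥ v = ∑ i, v i ^ 2 :=
  Finset.sum_congr rfl fun _ _ => (sq _).symm

/-- Here the residual condition is used: an entry of MΠ is at most ‖MΠ‖, and ‖MΠ‖² = ΠᵀMΠ ≤ C′ΠᵀΠ/K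
≤ C′ eventually. -/
lemma exists_meanBound_le (hP : ErrorsAndProjection μ D) (hreg : Regularity μ D)
    (hres : ResidualCondition D) {c : ℝ} (hc : 1 ≤ c) :
    ∃ q, ∀ᶠ n in atTop, ∀ k, meanBound D c n k ≤ q := by
  obtain ⟨C, hC⟩ := hreg.bdd_Pi
  obtain ⟨C', hC'0, hC'⟩ := hres
  have hc0 : 0 ≤ c := zero_le_one.trans hc
  refine ⟨c * (C + √(C' * 1)), ?_⟩
  filter_upwards [hreg.small_Pi.eventually_le_const one_pos, hP.K_tendsto.eventually_ge_atTop 1]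
    with n h1 h2 k
  rw [meanBound]
  refine mul_le_mul_of_nonneg_left (add_le_add (hC n k) (Real.abs_le_sqrt ?_)) hc0
  calc (annih (D.P n) *ᵥ D.Pi n) k ^ 2 ≤ ∑ i, (annih (D.P n) *ᵥ D.Pi n) i ^ 2 :=
        Finset.single_le_sum (f := fun i => (annih (D.P n) *ᵥ D.Pi n) i ^ 2)
          (fun _ _ => sq_nonneg _) (Finset.mem_univ k)
    _ ≤ C' * (D.Pi n ⬝ᵥ D.Pi n) / D.K n := by
        rw [sum_sq_annih_mulVec hP]; exact hC' n (by omega)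
    _ ≤ C' * 1 := by rw [mul_div_assoc]; gcongr

lemma sum_sq_meanBound_le (hP : ErrorsAndProjection μ D) (c : ℝ) (n : ℕ) :
    ∑ i, meanBound D c n i ^ 2 ≤ (2 * c) ^ 2 * (D.Pi n ⬝ᵥ D.Pi n) := by
  have h1 := (hP.isProjection n).compl.sum_sq_mulVec_le (D.Pi n)
  have h2 : ∀ i, meanBound D c n i ^ 2 ≤ 2 * c ^ 2 * D.Pi n i ^ 2 +
      2 * c ^ 2 * ((1 - D.P n) *ᵥ D.Pi n) i ^ 2 := fun i => by
    rw [meanBound, mul_pow, annih, ← sq_abs (D.Pi n i), ← sq_abs (((1 - D.P n) *ᵥ D.Pi n) i)]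
    nlinarith [add_sq_le (a := |D.Pi n i|) (b := |((1 - D.P n) *ᵥ D.Pi n) i|), sq_nonneg c]
  calc _ ≤ ∑ i, (2 * c ^ 2 * D.Pi n i ^ 2 + 2 * c ^ 2 * ((1 - D.P n) *ᵥ D.Pi n) i ^ 2) :=
        Finset.sum_le_sum fun i _ => h2 i
    _ = 2 * c ^ 2 * ∑ i, D.Pi n i ^ 2 + 2 * c ^ 2 * ∑ i, ((1 - D.P n) *ᵥ D.Pi n) i ^ 2 := by
        rw [Finset.sum_add_distrib, ← Finset.mul_sum, ← Finset.mul_sum]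
    _ ≤ 2 * c ^ 2 * ∑ i, D.Pi n i ^ 2 + 2 * c ^ 2 * ∑ i, D.Pi n i ^ 2 := by gcongr
    _ = _ := by rw [dotProduct_self_eq]; ring

/-- ω is PΠ minus the diagonal part PᵢᵢΠᵢ, and both maps are contractions. -/
lemma sum_sq_om_le (hP : ErrorsAndProjection μ D) (n : ℕ) :
    ∑ i, D.om n i ^ 2 ≤ 2 ^ 2 * (D.Pi n ⬝ᵥ D.Pi n) := by
  have hp := hP.isProjection n
  have h1 := hp.sum_sq_mulVec_le (D.Pi n)
  have h2 : ∀ i, D.om n i ^ 2 ≤ 2 * (D.P n *ᵥ D.Pi n) i ^ 2 + 2 * D.Pi n i ^ 2 := fun i => by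
    have h3 := compl_mulVec_eq_offDiag (D.P n) (D.Pi n) i
    rw [Matrix.sub_mulVec, Matrix.one_mulVec, Pi.sub_apply, Matrix.sub_apply,
      Matrix.one_apply_eq] at h3
    have h4 : D.om n i = (D.P n *ᵥ D.Pi n) i - D.P n i i * D.Pi n i := by
      rw [IVArray.om, loo_eq]; linarith
    have h5 : (D.P n i i * D.Pi n i) ^ 2 ≤ D.Pi n i ^ 2 := by
      rw [mul_pow]; exact mul_le_of_le_one_left (sq_nonneg _) (hp.sq_le_one i i)
    rw [h4]
    nlinarith [sq_nonneg ((D.P n *ᵥ D.Pi n) i + D.P n i i * D.Pi n i)]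
  calc _ ≤ ∑ i, (2 * (D.P n *ᵥ D.Pi n) i ^ 2 + 2 * D.Pi n i ^ 2) :=
        Finset.sum_le_sum fun i _ => h2 i
    _ = 2 * ∑ i, (D.P n *ᵥ D.Pi n) i ^ 2 + 2 * ∑ i, D.Pi n i ^ 2 := by
        rw [Finset.sum_add_distrib, ← Finset.mul_sum, ← Finset.mul_sum]
    _ ≤ 2 * ∑ i, D.Pi n i ^ 2 + 2 * ∑ i, D.Pi n i ^ 2 := by gcongr
    _ = _ := by rw [dotProduct_self_eq]; ring

/-- Cauchy–Schwarz, normalised by the dimension of the projection. -/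
lemma one_div_mul_sum_le {n : ℕ} {K c S : ℝ} (hK : 0 < K) (hc : 0 ≤ c) {u v : Fin n → ℝ}
    (hu : ∑ i, u i ^ 2 ≤ K) (hv : ∑ i, v i ^ 2 ≤ c ^ 2 * S) :
    1 / K * ∑ i, u i * v i ≤ c * √(S / K) := by
  have h1 : ∑ i, u i * v i ≤ √K * (c * √S) := by
    refine (Real.sum_mul_le_sqrt_mul_sqrt _ _ _).trans ?_
    have : √(c ^ 2 * S) = c * √S := by rw [Real.sqrt_mul (sq_nonneg c), Real.sqrt_sq hc]
    rw [← this]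
    gcongr
  calc _ ≤ 1 / K * (√K * (c * √S)) := by gcongr
    _ = c * (√S * (√K / K)) := by ring
    _ = c * √(S / K) := by rw [Real.sqrt_div_self, Real.sqrt_div' _ hK.le]; ring

lemma ErrorsAndProjection.tendsto_sqrt_div (hP : ErrorsAndProjection μ D) :
    Tendsto (fun n => 1 / (D.K n : ℝ) * √(D.K n : ℝ)) atTop (𝓝 0) := by
  have h : Tendsto (fun n => 1 / √(D.K n : ℝ)) atTop (𝓝 0) :=
    tendsto_const_nhds.div_atTop
      (Real.tendsto_sqrt_atTop.comp (tendsto_natCast_atTop_atTop.comp hP.K_tendsto))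
  refine h.congr fun n => ?_
  rw [one_div_mul_eq_div, Real.sqrt_div_self']

variable [∀ n, IsProbabilityMeasure (μ n)]

theorem vanishesL1_crossForm (hP : ErrorsAndProjection μ D) (hreg : Regularity μ D)
    (hres : ResidualCondition D) {c m : ℝ} (hc : 1 ≤ c) (hm : 1 ≤ m)
    {α₁ α₂ α₃ α₄ : ∀ n, Fin n → ℝ} {x₁ x₂ x₃ x₄ : ∀ n, Fin n → Ω n → ℝ}
    (h₁ : ∀ n, MeanNoise (μ n) (errField D n) m (D.P n) (meanBound D c n) (α₁ n) (x₁ n))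
    (h₂ : ∀ n, MeanNoise (μ n) (errField D n) m (D.P n) (meanBound D c n) (α₂ n) (x₂ n))
    (h₃ : ∀ n, MeanNoise (μ n) (errField D n) m (D.P n) (meanBound D c n) (α₃ n) (x₃ n))
    (h₄ : ∀ n, MeanNoise (μ n) (errField D n) m (D.P n) (meanBound D c n) (α₄ n) (x₄ n))
    (hs : ∀ n, PairSymm (μ n) (x₁ n) (x₂ n) (x₃ n) (x₄ n)) :
    VanishesL1 μ fun n ω => 1 / (D.K n : ℝ) * crossForm (D.P n) (fun k => α₁ n k + x₁ n k ω)
        (fun k => α₂ n k + x₂ n k ω) (fun k => α₃ n k + x₃ n k ω) (fun k => α₄ n k + x₄ n k ω)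
      - 1 / (D.K n : ℝ) * pairSum (D.P n) (fun i => ∫ ω', x₁ n i ω' * x₂ n i ω' ∂(μ n))
        fun j => ∫ ω', x₃ n j ω' * x₄ n j ω' ∂(μ n) := by
  obtain ⟨κ, hκ, hκ1, hd⟩ := hP.exists_diag
  obtain ⟨q, hq⟩ := exists_meanBound_le hP hreg hres hc
  set C₁ := 4 * (κ ^ 2)⁻¹ * (8 * (q ^ 4 + 10 * m ^ 2))
  set C₂ := 160 * m ^ 2 * (κ ^ 2)⁻¹
  refine ⟨fun n => C₁ * (2 * c * √((D.Pi n ⬝ᵥ D.Pi n) / D.K n))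
    + C₂ * (1 / (D.K n : ℝ) * √(D.K n : ℝ)), ?_, ?_⟩
  · have h1 := ((hreg.small_Pi.sqrt.const_mul (2 * c)).const_mul C₁).add
      (hP.tendsto_sqrt_div.const_mul C₂)
    simpa using h1
  · filter_upwards [hq, hP.K_tendsto.eventually_ge_atTop 1] with n hqn hKn
    have hK : (0 : ℝ) < D.K n := by exact_mod_cast hKn
    have hp := hP.isProjection n
    have h := (L1Le.crossForm hp hκ (hd n) (hP.errField_le n) (hP.iIndep_errField n) hm hqn
      (h₁ n) (h₂ n) (h₃ n) (h₄ n) (hs n)).const_mul (1 / (D.K n : ℝ))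
    refine (h.congr fun ω => by ring).mono ?_
    -- Cauchy–Schwarz with ∑Pᵢᵢ² ≤ tr P = K turns the weighted ℓ¹ norm of the means into √(ΠᵀΠ/K).
    have hsum : 1 / (D.K n : ℝ) * ∑ i, D.P n i i * meanBound D c n i ≤
        2 * c * √((D.Pi n ⬝ᵥ D.Pi n) / D.K n) := by
      refine one_div_mul_sum_le hK (by linarith) ?_ (sum_sq_meanBound_le hP c n)
      rw [← hP.trace n]
      exact Finset.sum_le_sum fun i _ => hp.diag_sq_le i
    rw [abs_of_pos (by positivity), hP.trace n]
    calc _ = C₁ * (1 / (D.K n : ℝ) * ∑ i, D.P n i i * meanBound D c n i) +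
          C₂ * (1 / (D.K n : ℝ) * √(D.K n : ℝ)) := by ring
      _ ≤ _ := by
        have : 0 ≤ C₁ := by positivity
        gcongr

theorem vanishesL1_looForm (hP : ErrorsAndProjection μ D) (hreg : Regularity μ D)
    (hres : ResidualCondition D) {c m : ℝ} (hc : 1 ≤ c) (hm : 1 ≤ m)
    {α₃ α₄ : ∀ n, Fin n → ℝ} {x₃ x₄ : ∀ n, Fin n → Ω n → ℝ}
    (h : ∀ n, MeanNoise (μ n) (errField D n) m (D.P n) (meanBound D c n) (D.Pi n) (D.V n))
    (h₃ : ∀ n, MeanNoise (μ n) (errField D n) m (D.P n) (meanBound D c n) (α₃ n) (x₃ n))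
    (h₄ : ∀ n, MeanNoise (μ n) (errField D n) m (D.P n) (meanBound D c n) (α₄ n) (x₄ n)) :
    VanishesL1 μ fun n ω => 1 / (D.K n : ℝ) * looForm (D.P n) (fun k => D.Pi n k + D.V n k ω)
        (fun k => α₃ n k + x₃ n k ω) (fun k => α₄ n k + x₄ n k ω)
      - 1 / (D.K n : ℝ) * pairSum (D.P n) (fun i => ∫ ω', x₃ n i ω' * x₄ n i ω' ∂(μ n))
        fun j => ∫ ω', D.V n j ω' * D.V n j ω' ∂(μ n) := by
  obtain ⟨κ, hκ, hκ1, hd⟩ := hP.exists_diag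
  obtain ⟨q, hq⟩ := exists_meanBound_le hP hreg hres hc
  set C₁ := 8 * κ⁻¹ * m * (8 * (q ^ 4 + 10 * m ^ 2))
  set C₂ := 112 * m ^ 2 * κ⁻¹
  refine ⟨fun n => C₁ * (2 ^ 2 * ((D.Pi n ⬝ᵥ D.Pi n) / D.K n)
    + 2 * √((D.Pi n ⬝ᵥ D.Pi n) / D.K n) + 2 * c * √((D.Pi n ⬝ᵥ D.Pi n) / D.K n))
    + C₂ * (1 / (D.K n : ℝ) * √(D.K n : ℝ)), ?_, ?_⟩
  · have h1 := ((((hreg.small_Pi.const_mul (2 ^ 2)).add (hreg.small_Pi.sqrt.const_mul 2)).add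
      (hreg.small_Pi.sqrt.const_mul (2 * c))).const_mul C₁).add
      (hP.tendsto_sqrt_div.const_mul C₂)
    simpa using h1
  · filter_upwards [hq, hP.K_tendsto.eventually_ge_atTop 1] with n hqn hKn
    have hK : (0 : ℝ) < D.K n := by exact_mod_cast hKn
    have hp := hP.isProjection n
    have h := (L1Le.looForm hp hκ hκ1 (hd n) (hP.errField_le n) (hP.iIndep_errField n) hm hqn
      (h n) (h₃ n) (h₄ n)).const_mul (1 / (D.K n : ℝ))
    refine (h.congr fun ω => by ring).mono ?_
    have hsum : 1 / (D.K n : ℝ) * ∑ i, D.P n i i * meanBound D c n i ≤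
        2 * c * √((D.Pi n ⬝ᵥ D.Pi n) / D.K n) := by
      refine one_div_mul_sum_le hK (by linarith) ?_ (sum_sq_meanBound_le hP c n)
      rw [← hP.trace n]
      exact Finset.sum_le_sum fun i _ => hp.diag_sq_le i
    -- The weights √Pᵢᵢ are as large as the argument allows: their squares sum to exactly K.
    have hsum2 : 1 / (D.K n : ℝ) * ∑ i, √(D.P n i i) * |D.om n i| ≤
        2 * √((D.Pi n ⬝ᵥ D.Pi n) / D.K n) := by
      refine one_div_mul_sum_le hK (by norm_num) ?_ ?_
      · rw [← hP.trace n]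
        exact Finset.sum_le_sum fun i _ => (Real.sq_sqrt (hp.diag_nonneg i)).le
      · simp only [sq_abs]
        exact sum_sq_om_le hP n
    have hsum3 : 1 / (D.K n : ℝ) * ∑ i, D.om n i ^ 2 ≤
        2 ^ 2 * ((D.Pi n ⬝ᵥ D.Pi n) / D.K n) := by
      rw [one_div_mul_eq_div, ← mul_div_assoc]
      exact div_le_div_of_nonneg_right (sum_sq_om_le hP n) hK.le
    rw [abs_of_pos (by positivity), hP.trace n]
    have e : ∑ i, (loo (D.P n) (D.Pi n) i ^ 2 + |loo (D.P n) (D.Pi n) i| * √(D.P n i i)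
        + D.P n i i * meanBound D c n i) = ∑ i, D.om n i ^ 2 + ∑ i, √(D.P n i i) * |D.om n i| +
        ∑ i, D.P n i i * meanBound D c n i := by
      simp only [← Finset.sum_add_distrib]
      refine Finset.sum_congr rfl fun i _ => ?_
      rw [mul_comm √(D.P n i i)]; rfl
    rw [e]
    calc _ = C₁ * (1 / (D.K n : ℝ) * ∑ i, D.om n i ^ 2
            + 1 / (D.K n : ℝ) * ∑ i, √(D.P n i i) * |D.om n i|
            + 1 / (D.K n : ℝ) * ∑ i, D.P n i i * meanBound D c n i) +
          C₂ * (1 / (D.K n : ℝ) * √(D.K n : ℝ)) := by ring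
      _ ≤ _ := by
        have : 0 ≤ C₁ := by positivity
        gcongr

end Sequences

/-! ### Bilinearity and symmetry of the pair sums. -/

section PairSum

variable {n : ℕ} {P : Matrix (Fin n) (Fin n) ℝ}

lemma pairSum_add_left (f f' g : Fin n → ℝ) :
    pairSum P (fun i => f i + f' i) g = pairSum P f g + pairSum P f' g := by
  simp only [pairSum, add_mul, mul_add, offSum_add]

lemma offSum_const_mul (c : ℝ) (f : Fin n → Fin n → ℝ) :
    (offSum fun i j => c * f i j) = c * offSum f := by
  simp only [offSum, Finset.mul_sum]

lemma pairSum_mul_left (c : ℝ) (f g : Fin n → ℝ) :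
    pairSum P (fun i => c * f i) g = c * pairSum P f g := by
  rw [pairSum, pairSum, ← offSum_const_mul]
  congr 1; funext i j; ring

lemma IsProjection.pairSum_comm (hP : IsProjection P) (f g : Fin n → ℝ) :
    pairSum P f g = pairSum P g f := by
  rw [pairSum, pairSum, offSum_comm]
  congr 1; funext i j
  rw [hP.apply_comm j i]; ring

end PairSum

/-! ### Limits of the normalised pair sums. -/

section Limits

variable {Ω : ℕ → Type*} [∀ n, MeasurableSpace (Ω n)] {μ : ∀ n, Measure (Ω n)} {D : IVArray Ω}

/-- ∑ωᵢ² ≤ 4ΠᵀΠ = o(K). Hence the ω-terms in the definitions of Ψ, τ and Υ are asymptotically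
negligible. -/
lemma tendsto_sum_om (hP : ErrorsAndProjection μ D) (hreg : Regularity μ D) {C : ℝ}
    {f : ∀ n, Fin n → ℝ} (hf : ∀ n i, |f n i| ≤ C) :
    Tendsto (fun n => 1 / (D.K n : ℝ) * ∑ i, D.om n i ^ 2 * f n i) atTop (𝓝 0) := by
  have hlim : Tendsto (fun n => |C| * (2 ^ 2 * ((D.Pi n ⬝ᵥ D.Pi n) / (D.K n : ℝ)))) atTop
      (𝓝 0) := by
    simpa using (hreg.small_Pi.const_mul (2 ^ 2)).const_mul |C|
  refine squeeze_zero_norm (fun n => ?_) hlim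
  have hb : |∑ i, D.om n i ^ 2 * f n i| ≤ |C| * ∑ i, D.om n i ^ 2 := by
    refine (Finset.abs_sum_le_sum_abs _ _).trans ?_
    rw [Finset.mul_sum]
    refine Finset.sum_le_sum fun i _ => ?_
    rw [abs_mul, abs_of_nonneg (sq_nonneg _), mul_comm]
    exact mul_le_mul_of_nonneg_right ((hf n i).trans (le_abs_self C)) (sq_nonneg _)
  rw [Real.norm_eq_abs, abs_mul, abs_of_nonneg (by positivity)]
  calc _ ≤ 1 / (D.K n : ℝ) * (|C| * (2 ^ 2 * (D.Pi n ⬝ᵥ D.Pi n))) := by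
        gcongr
        exact hb.trans (mul_le_mul_of_nonneg_left (sum_sq_om_le hP n) (abs_nonneg _))
    _ = _ := by ring

/-- The normalised sum `K⁻¹ ∑ᵢ ∑_{j ≠ i} Pᵢⱼ² fᵢ gⱼ`. -/
noncomputable def avgPair (D : IVArray Ω) (n : ℕ) (f g : Fin n → ℝ) : ℝ :=
  1 / (D.K n : ℝ) * pairSum (D.P n) f g

/-- The limits of the normalised pair sums of the second moments. -/
structure PairLimits (μ : ∀ n, Measure (Ω n)) (D : IVArray Ω) (g : VarComp) : Prop where
  ss : Tendsto (fun n => 2 * avgPair D n (sigSq μ D n) (sigSq μ D n) - g.Phi1) atTop (𝓝 0)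
  gs : Tendsto (fun n => 2 * avgPair D n (gam μ D n) (sigSq μ D n) - g.Phi12) atTop (𝓝 0)
  gg : Tendsto (fun n => 2 * avgPair D n (gam μ D n) (gam μ D n) - g.Phi13) atTop (𝓝 0)
  psi : Tendsto (fun n => avgPair D n (etaSq μ D n) (sigSq μ D n)
    + avgPair D n (gam μ D n) (gam μ D n) - g.Psi) atTop (𝓝 0)
  ng : Tendsto (fun n => 2 * avgPair D n (etaSq μ D n) (gam μ D n) - g.tau) atTop (𝓝 0)
  nn : Tendsto (fun n => 2 * avgPair D n (etaSq μ D n) (etaSq μ D n) - g.Ups) atTop (𝓝 0)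

lemma IsVarLimit.pairLimits {g : VarComp} (hg : IsVarLimit μ D g)
    (hP : ErrorsAndProjection μ D) (hreg : Regularity μ D) {C : ℝ}
    (hs : ∀ n i, |sigSq μ D n i| ≤ C) (hgam : ∀ n i, |gam μ D n i| ≤ C)
    (heta : ∀ n i, |etaSq μ D n i| ≤ C) : PairLimits μ D g where
  ss := by
    have h := hg.Phi1.sub_const g.Phi1
    rw [sub_self] at h
    refine h.congr fun n => ?_
    rw [avgPair, pairSum]; ring
  gs := by
    have h := hg.Phi12.sub_const g.Phi12
    rw [sub_self] at h
    refine h.congr fun n => ?_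
    simp only [mul_add, offSum_add]
    have e1 : (offSum fun i j => D.P n i j ^ 2 * (gam μ D n j * sigSq μ D n i)) =
        pairSum (D.P n) (gam μ D n) (sigSq μ D n) := by
      rw [(hP.isProjection n).pairSum_comm, pairSum]
      congr 1; funext i j; ring
    rw [e1, avgPair, ← pairSum]; ring
  gg := by
    have h := hg.Phi13.sub_const g.Phi13
    rw [sub_self] at h
    refine h.congr fun n => ?_
    rw [avgPair, pairSum]; ring
  psi := by
    have h := (hg.Psi.sub (tendsto_sum_om hP hreg hs)).sub_const g.Psi
    rw [sub_zero, sub_self] at h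
    refine h.congr fun n => ?_
    simp only [mul_add, offSum_add]
    rw [avgPair, avgPair, pairSum, pairSum]; ring
  ng := by
    have h := (hg.tau.sub ((tendsto_sum_om hP hreg hgam).const_mul 2)).sub_const g.tau
    rw [mul_zero, sub_zero, sub_self] at h
    refine h.congr fun n => ?_
    rw [avgPair, pairSum]; ring
  nn := by
    have h := (hg.Ups.sub ((tendsto_sum_om hP hreg heta).const_mul 4)).sub_const g.Ups
    rw [mul_zero, sub_zero, sub_self] at h
    refine h.congr fun n => ?_
    rw [avgPair, pairSum]; ring

/-- Δ may drift without converging; boundedness of its powers is all that the passage to β₀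
requires. -/
lemma tendsto_pow_mul_of_abs_le {d u : ℕ → ℝ} {c : ℝ} (hd : ∀ n, |d n| ≤ c)
    (hu : Tendsto u atTop (𝓝 0)) (k : ℕ) : Tendsto (fun n => d n ^ k * u n) atTop (𝓝 0) := by
  have h : Tendsto (fun n => c ^ k * |u n|) atTop (𝓝 0) := by simpa using hu.abs.const_mul (c ^ k)
  refine squeeze_zero_norm (fun n => ?_) h
  rw [Real.norm_eq_abs, abs_mul, abs_pow]
  exact mul_le_mul_of_nonneg_right (pow_le_pow_left₀ (abs_nonneg _) (hd n) k) (abs_nonneg _)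

/-- The variances of the null-imposed residuals. -/
noncomputable def sigSqAt (μ : ∀ n, Measure (Ω n)) (D : IVArray Ω) (b : ℝ) (n : ℕ) (i : Fin n) :
    ℝ := sigSq μ D n i + 2 * D.Del b n * gam μ D n i + D.Del b n ^ 2 * etaSq μ D n i

/-- The covariances of the null-imposed residuals with the first-stage errors. -/
noncomputable def gamAt (μ : ∀ n, Measure (Ω n)) (D : IVArray Ω) (b : ℝ) (n : ℕ) (i : Fin n) :
    ℝ := gam μ D n i + D.Del b n * etaSq μ D n i

/-- The limits of the normalised pair sums of the second moments at `β₀ = b`. -/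
structure PairLimitsAt (μ : ∀ n, Measure (Ω n)) (D : IVArray Ω) (g : VarComp) (b : ℝ) :
    Prop where
  ss : Tendsto (fun n => 2 * avgPair D n (sigSqAt μ D b n) (sigSqAt μ D b n)
    - (g.shift (D.Del b n)).Phi1) atTop (𝓝 0)
  sg : Tendsto (fun n => 2 * avgPair D n (sigSqAt μ D b n) (gamAt μ D b n)
    - (g.shift (D.Del b n)).Phi12) atTop (𝓝 0)
  gg : Tendsto (fun n => 2 * avgPair D n (gamAt μ D b n) (gamAt μ D b n)
    - (g.shift (D.Del b n)).Phi13) atTop (𝓝 0)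
  psi : Tendsto (fun n => avgPair D n (sigSqAt μ D b n) (etaSq μ D n)
    + avgPair D n (gamAt μ D b n) (gamAt μ D b n) - (g.shift (D.Del b n)).Psi) atTop (𝓝 0)
  tau : Tendsto (fun n => avgPair D n (etaSq μ D n) (gamAt μ D b n)
    + avgPair D n (gamAt μ D b n) (etaSq μ D n) - (g.shift (D.Del b n)).tau) atTop (𝓝 0)
  nn : Tendsto (fun n => 2 * avgPair D n (etaSq μ D n) (etaSq μ D n)
    - (g.shift (D.Del b n)).Ups) atTop (𝓝 0)

/-- The moments of e + ΔV are polynomial in Δ. Expanding the pair sums bilinearly gives the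
polynomials of `VarComp.shift` plus errors that are bounded powers of Δ times null sequences. -/
lemma PairLimits.shift {g : VarComp} (h : PairLimits μ D g) (hP : ErrorsAndProjection μ D)
    {b c : ℝ} (hΔ : ∀ n, |D.Del b n| ≤ c) : PairLimitsAt μ D g b := by
  have comm : ∀ n f f', avgPair D n f f' = avgPair D n f' f := fun n f f' => by
    rw [avgPair, avgPair, (hP.isProjection n).pairSum_comm]
  have b1 : ∀ n f, avgPair D n (sigSqAt μ D b n) f = avgPair D n (sigSq μ D n) f
      + 2 * D.Del b n * avgPair D n (gam μ D n) f
      + D.Del b n ^ 2 * avgPair D n (etaSq μ D n) f := by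
    intro n f
    have : sigSqAt μ D b n = fun i => sigSq μ D n i + 2 * D.Del b n * gam μ D n i
      + D.Del b n ^ 2 * etaSq μ D n i := rfl
    simp only [avgPair, this, pairSum_add_left, pairSum_mul_left]
    ring
  have b2 : ∀ n f, avgPair D n (gamAt μ D b n) f = avgPair D n (gam μ D n) f
      + D.Del b n * avgPair D n (etaSq μ D n) f := by
    intro n f
    have : gamAt μ D b n = fun i => gam μ D n i + D.Del b n * etaSq μ D n i := rfl
    simp only [avgPair, this, pairSum_add_left, pairSum_mul_left]
    ring
  have c1 := fun n => comm n (sigSq μ D n) (gam μ D n)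
  have c2 := fun n => comm n (sigSq μ D n) (etaSq μ D n)
  have c3 := fun n => comm n (gam μ D n) (etaSq μ D n)
  have p := fun {u : ℕ → ℝ} (hu : Tendsto u atTop (𝓝 0)) => tendsto_pow_mul_of_abs_le hΔ hu
  -- The combinations 4Ψ + 2Φ₁₃ and 2Ψ + Φ₁₃ are the Δ² coefficient of Φ₁(β₀) and the Δ coefficient
  -- of Φ₁₂(β₀).
  have q1 := (h.psi.const_mul 4).add (h.gg.const_mul 2)
  have q2 := (h.psi.const_mul 2).add h.gg
  simp only [mul_zero, add_zero] at q1 q2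
  refine ⟨?_, ?_, ?_, ?_, ?_, ?_⟩
  · have := (((h.ss.add ((p h.gs 1).const_mul 4)).add (p q1 2)).add
      ((p h.ng 3).const_mul 4)).add (p h.nn 4)
    simp only [mul_zero, add_zero] at this
    refine this.congr fun n => ?_
    simp only [VarComp.shift, b1, comm n _ (sigSqAt μ D b n), c1, c2, c3]
    ring
  · have := ((h.gs.add (p q2 1)).add
      ((p h.ng 2).const_mul 3)).add (p h.nn 3)
    simp only [mul_zero, add_zero] at this
    refine this.congr fun n => ?_
    simp only [VarComp.shift, b1, comm n _ (gamAt μ D b n), b2, c3]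
    ring
  · have := (h.gg.add ((p h.ng 1).const_mul 2)).add (p h.nn 2)
    simp only [mul_zero, add_zero] at this
    refine this.congr fun n => ?_
    simp only [VarComp.shift, comm n _ (gamAt μ D b n), b2, c3]
    ring
  · have := (h.psi.add ((p h.ng 1).const_mul 2)).add (p h.nn 2)
    simp only [mul_zero, add_zero] at this
    refine this.congr fun n => ?_
    simp only [VarComp.shift, b1, comm n _ (gamAt μ D b n), b2, c2, c3]
    ring
  · have := h.ng.add (p h.nn 1)
    simp only [add_zero] at this
    refine this.congr fun n => ?_
    simp only [VarComp.shift, comm n _ (gamAt μ D b n), b2, c3]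
    ring
  · exact h.nn

end Limits

/-! ### Consistency of the six estimators. -/

section Six

variable {Ω : ℕ → Type*} [∀ n, MeasurableSpace (Ω n)] {μ : ∀ n, Measure (Ω n)}
  [∀ n, IsProbabilityMeasure (μ n)] {D : IVArray Ω}

/-- Consistency of the six cross-fit estimators. -/
theorem sixConsistent (hP : ErrorsAndProjection μ D) (hreg : Regularity μ D)
    (hres : ResidualCondition D) {g : VarComp} (hg : IsVarLimit μ D g) {b c : ℝ}
    (hc : 1 ≤ c) (hΔ : ∀ n, |D.Del b n| ≤ c) : SixConsistent μ D g b := by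
  obtain ⟨m, hm, hx⟩ := meanNoise_errors hP hreg hc hΔ
  obtain ⟨m', hm', hx'⟩ := sixthMoment_errors hP hreg hc hΔ
  have hee : ∀ n, NoiseFamily (μ n) (errField D n) m' fun k ω => D.e n k ω * D.e n k ω :=
    fun n => (hx' n).1.mul₂ (hP.errField_le n) hm' (hx' n).1
  have heV : ∀ n, NoiseFamily (μ n) (errField D n) m' fun k ω => D.e n k ω * D.V n k ω :=
    fun n => (hx' n).1.mul₂ (hP.errField_le n) hm' (hx' n).2.1
  have hVV : ∀ n, NoiseFamily (μ n) (errField D n) m' fun k ω => D.V n k ω * D.V n k ω :=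
    fun n => (hx' n).2.1.mul₂ (hP.errField_le n) hm' (hx' n).2.1
  have eV : ∀ n, (fun i => ∫ ω, D.V n i ω * D.V n i ω ∂(μ n)) = etaSq μ D n := fun n => by
    funext i; simp only [etaSq, sq]
  have ee : ∀ n, (fun i => ∫ ω, D.e n i ω * D.e n i ω ∂(μ n)) = sigSq μ D n := fun n => by
    funext i; simp only [sigSq, sq]
  have erV : ∀ n, (fun i => ∫ ω, residNoise D b n i ω * D.V n i ω ∂(μ n)) = gamAt μ D b n := by
    intro n
    funext i
    simp only [residNoise, add_mul, mul_assoc]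
    rw [integral_add ((heV n).integrable i) (((hVV n).integrable i).const_mul _),
      integral_const_mul, congrFun (eV n) i]
    rfl
  have eVr : ∀ n, (fun i => ∫ ω, D.V n i ω * residNoise D b n i ω ∂(μ n)) = gamAt μ D b n := by
    intro n
    rw [← erV]
    simp only [mul_comm]
  have err : ∀ n, (fun i => ∫ ω, residNoise D b n i ω * residNoise D b n i ω ∂(μ n)) =
      sigSqAt μ D b n := by
    intro n
    funext i
    have e1 : ∀ ω, residNoise D b n i ω * residNoise D b n i ω = D.e n i ω * D.e n i ω +
        2 * D.Del b n * (D.e n i ω * D.V n i ω) + D.Del b n ^ 2 * (D.V n i ω * D.V n i ω) :=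
      fun ω => by rw [residNoise]; ring
    simp only [e1]
    have i1 := (hee n).integrable i
    have i2 := ((heV n).integrable i).const_mul (2 * D.Del b n)
    have i3 := ((hVV n).integrable i).const_mul (D.Del b n ^ 2)
    have i12 : Integrable (fun ω => D.e n i ω * D.e n i ω +
        2 * D.Del b n * (D.e n i ω * D.V n i ω)) (μ n) := i1.add i2
    rw [integral_add i12 i3, integral_add i1 i2,
      integral_const_mul, integral_const_mul, congrFun (eV n) i, congrFun (ee n) i]
    rfl
  have hL := (hg.pairLimits hP hreg (C := √m')
    (fun n i => by rw [← ee]; exact (hee n).abs_integral_le i)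
    (fun n i => (heV n).abs_integral_le i)
    (fun n i => by rw [← eV]; exact (hVV n).abs_integral_le i)).shift hP hΔ
  have hX := fun n => (hx n).1
  have hr := fun n => (hx n).2
  have sym : ∀ n, PairSymm (μ n) (residNoise D b n) (D.V n) (residNoise D b n) (D.V n) :=
    fun n => Or.inl fun i j => by
      have h1 := congrFun ((eVr n).trans (erV n).symm) j
      rw [h1]
  have cr := vanishesL1_crossForm hP hreg hres hc hm hr hr hr hr
    fun n => Or.inl fun i j => rfl
  -- With three residuals and one X, the moment products agree only after exchanging i and j. This
  -- is the one place where the second alternative of `PairSymm` is used.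
  have crX := vanishesL1_crossForm hP hreg hres hc hm hr hr hr hX
    fun n => Or.inr fun i j => mul_comm _ _
  have cXX := vanishesL1_crossForm hP hreg hres hc hm hr hX hr hX sym
  have cX := vanishesL1_crossForm hP hreg hres hc hm hX hX hX hX
    fun n => Or.inl fun i j => rfl
  have ct := vanishesL1_crossForm hP hreg hres hc hm hX hX hr hX
    fun n => Or.inl fun i j => by
      have h1 := congrFun ((eVr n).trans (erV n).symm) j
      rw [h1]
  have lrr := vanishesL1_looForm hP hreg hres hc hm hX hr hr
  have lrX := vanishesL1_looForm hP hreg hres hc hm hX hr hX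
  have lXr := vanishesL1_looForm hP hreg hres hc hm hX hX hr
  have eX : ∀ n ω, (fun k => D.Pi n k + D.V n k ω) = D.X n ω := fun _ _ => rfl
  simp only [← resid_eq, eX, err, erV, eVr, eV] at cr crX cXX cX ct lrr lrX lXr
  refine ⟨?_, ?_, ?_, ?_, ?_, ?_⟩
  · refine VanishesL1.isLittleOp ?_
    refine ((cr.const_mul 2).add (VanishesL1.of_tendsto hL.ss)).congr fun n ω => ?_
    simp only [hatPhi1_eq, avgPair]; ring
  · refine VanishesL1.isLittleOp ?_
    refine ((crX.const_mul 2).add (VanishesL1.of_tendsto hL.sg)).congr fun n ω => ?_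
    simp only [hatPhi12_eq _ _ _ (hP.isProjection n), avgPair]; ring
  · refine VanishesL1.isLittleOp ?_
    refine ((cXX.const_mul 2).add (VanishesL1.of_tendsto hL.gg)).congr fun n ω => ?_
    simp only [hatPhi13_eq, avgPair]; ring
  · refine VanishesL1.isLittleOp ?_
    refine ((lrr.add cXX).add (VanishesL1.of_tendsto hL.psi)).congr fun n ω => ?_
    simp only [hatPsi_eq, avgPair]; ring
  · refine VanishesL1.isLittleOp ?_
    refine (((ct.add (lrX.const_mul (1 / 2))).add (lXr.const_mul (1 / 2))).add
      (VanishesL1.of_tendsto hL.tau)).congr fun n ω => ?_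
    simp only [hatTau_eq, avgPair]; ring
  · refine VanishesL1.isLittleOp ?_
    refine ((cX.const_mul 2).add (VanishesL1.of_tendsto hL.nn)).congr fun n ω => ?_
    simp only [hatUpsilon_eq, avgPair]; ring

end Six

/-! ### Transfer of convergence in probability, and continuity of the correlation. -/

section LittleOp

variable {Ω : ℕ → Type*} [∀ n, MeasurableSpace (Ω n)] {μ : ∀ n, Measure (Ω n)}

/-- A union bound over finitely many bad events. The threshold `δ` must work for all large `n`,
which makes room for drifting limits. -/
lemma IsLittleOp.of_forall_lt {ι : Type*} [Fintype ι] {F : ∀ n, Ω n → ℝ}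
    {G : ι → ∀ n, Ω n → ℝ} (hG : ∀ k, IsLittleOp μ (G k))
    (h : ∀ ε : ℝ, 0 < ε → ∃ δ : ℝ, 0 < δ ∧ ∀ᶠ n in atTop, ∀ ω,
      (∀ k, |G k n ω| < δ) → |F n ω| < ε) : IsLittleOp μ F := by
  intro ε hε
  obtain ⟨δ, hδ, hn⟩ := h ε hε
  have hsum : Tendsto (fun n => ∑ k, μ n {ω | δ ≤ |G k n ω|}) atTop (𝓝 0) := by
    simpa using tendsto_finsetSum Finset.univ fun k _ => hG k δ hδ
  refine tendsto_of_tendsto_of_tendsto_of_le_of_le' tendsto_const_nhds hsum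
    (Eventually.of_forall fun n => zero_le) ?_
  filter_upwards [hn] with n hn
  calc μ n {ω | ε ≤ |F n ω|} ≤ μ n (⋃ k, {ω | δ ≤ |G k n ω|}) := by
        refine measure_mono fun ω hω => ?_
        by_contra hcon
        simp only [Set.mem_iUnion, Set.mem_ofPred_eq, not_exists, not_le] at hcon
        exact absurd (hn ω hcon) (not_lt.2 hω)
    _ ≤ _ := measure_iUnion_fintype_le _ _

end LittleOp

/-- The vector `(v₀, …, v₅, v₁ / √(v₀ v₃))` in Euclidean space. -/
noncomputable def appendRho (v : Fin 6 → ℝ) : EuclideanSpace ℝ (Fin 7) :=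
  !₂[v 0, v 1, v 2, v 3, v 4, v 5, v 1 / √(v 0 * v 3)]

lemma continuousAt_appendRho {v : Fin 6 → ℝ} (h0 : 0 < v 0) (h3 : 0 < v 3) :
    ContinuousAt appendRho v := by
  refine (PiLp.continuous_toLp 2 _).continuousAt.comp ?_
  have hc : ∀ k : Fin 6, ContinuousAt (fun w : Fin 6 → ℝ => w k) v :=
    fun k => continuousAt_apply k v
  rw [continuousAt_pi]
  intro k
  fin_cases k
  · exact hc 0
  · exact hc 1
  · exact hc 2
  · exact hc 3
  · exact hc 4
  · exact hc 5
  · exact (hc 1).div (((hc 0).mul (hc 3)).sqrt) (Real.sqrt_pos.2 (mul_pos h0 h3)).ne'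

/-- The six components of the limit variance as a vector. -/
def VarComp.toVec (g : VarComp) : Fin 6 → ℝ := ![g.Phi1, g.Phi12, g.Phi13, g.Psi, g.tau, g.Ups]

lemma VarComp.continuous_shift_Phi1 (g : VarComp) : Continuous fun d => (g.shift d).Phi1 := by
  simp only [VarComp.shift]; fun_prop

lemma VarComp.continuous_shift_Psi (g : VarComp) : Continuous fun d => (g.shift d).Psi := by
  simp only [VarComp.shift]; fun_prop

lemma VarComp.continuous_shift_toVec (g : VarComp) : Continuous fun d => (g.shift d).toVec := by
  rw [continuous_pi_iff]
  intro k
  fin_cases k <;> simp [VarComp.shift, VarComp.toVec] <;> fun_prop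

/-! ### Uniform lower bounds over compact sets. -/

section Uniform

variable {β : ℕ → ℝ} {f : ℝ → ℝ} {B : Set ℝ}

/-- Positivity along a bounded drifting sequence, pointwise over a compact set of translations,
is uniform over that set. -/
lemma exists_uniform_lower_bound (hB : IsCompact B) (hβ : ∃ C : ℝ, ∀ n, |β n| ≤ C)
    (hf : Continuous f)
    (h : ∀ b ∈ B, ∃ c : ℝ, 0 < c ∧ ∀ᶠ n in atTop, c ≤ f (β n - b)) :
    ∃ c : ℝ, 0 < c ∧ ∀ᶠ n in atTop, ∀ b ∈ B, c ≤ f (β n - b) := by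
  obtain ⟨C, hC⟩ := hβ
  refine hB.induction_on (p := fun s => ∃ c : ℝ, 0 < c ∧ ∀ᶠ n in atTop, ∀ b ∈ s, c ≤ f (β n - b))
    ⟨1, one_pos, by simp⟩ ?_ ?_ ?_
  · rintro s t hst ⟨c, hc, hn⟩
    exact ⟨c, hc, hn.mono fun n h b hb => h b (hst hb)⟩
  · rintro s t ⟨c, hc, hn⟩ ⟨c', hc', hn'⟩
    refine ⟨min c c', lt_min hc hc', ?_⟩
    filter_upwards [hn, hn'] with n h1 h2 b hb
    rcases hb with hb | hb
    · exact (min_le_left _ _).trans (h1 b hb)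
    · exact (min_le_right _ _).trans (h2 b hb)
  · intro b hb
    obtain ⟨c, hc, hn⟩ := h b hb
    -- β − b stays in this compact interval, so near `b` a single modulus of continuity, valid for
    -- all `n`, costs at most half of the bound. Compactness of `B` then needs only finitely many
    -- such neighbourhoods.
    have hu := (isCompact_Icc (a := -(C + |b|)) (b := C + |b|)).uniformContinuousAt_of_continuousAt
      f (fun a _ => hf.continuousAt) (Metric.dist_mem_uniformity (half_pos hc))
    obtain ⟨δ, hδ, hsub⟩ := Metric.mem_uniformity_dist.1 hu
    refine ⟨Metric.ball b δ, mem_nhdsWithin_of_mem_nhds (Metric.ball_mem_nhds b hδ), c / 2,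
      half_pos hc, ?_⟩
    filter_upwards [hn] with n hn b' hb'
    have hmem : β n - b ∈ Set.Icc (-(C + |b|)) (C + |b|) :=
      abs_le.1 ((abs_sub _ _).trans (by gcongr; exact hC n))
    have hdist : dist (β n - b) (β n - b') < δ := by
      rw [dist_sub_left, dist_comm]; exact hb'
    have h1 := hsub hdist hmem
    have h2 := abs_lt.1 (show |f (β n - b) - f (β n - b')| < c / 2 from h1)
    linarith [h2.2]

/-- A continuous positive function is bounded away from zero along a bounded sequence. -/
lemma exists_lower_bound_of_pos {u : ℕ → ℝ} {C : ℝ} (hu : ∀ n, |u n| ≤ C) (hf : Continuous f)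
    (hpos : ∀ x, 0 < f x) : ∃ c : ℝ, 0 < c ∧ ∀ n, c ≤ f (u n) := by
  have hmem : ∀ n, u n ∈ Set.Icc (-C) C := fun n => abs_le.1 (hu n)
  obtain ⟨x, -, hx⟩ := isCompact_Icc.exists_isMinOn ⟨_, hmem 0⟩ hf.continuousOn
  exact ⟨f x, hpos x, fun n => hx (hmem n)⟩

end Uniform

/-! ### Nondegeneracy from positive definiteness. -/

section Nondegenerate

variable {Ω : ℕ → Type*} {D : IVArray Ω}

lemma abs_Del_le {C : ℝ} (hβ : ∀ n, |D.β n| ≤ C) (b : ℝ) (n : ℕ) :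
    |D.Del b n| ≤ max 1 (C + |b|) :=
  ((abs_sub _ _).trans (by gcongr; exact hβ n)).trans (le_max_right _ _)

lemma VarComp.Ups_pos_of_posDef {g : VarComp} (h : g.cov.PosDef) : 0 < g.Ups := by
  have := h.diag_pos (i := 2)
  simpa [VarComp.cov] using this

/-- Ψ(β₀) is the quadratic form at (0, 1, Δ), the coefficients in Q_{X,e(β₀)} = Q_{X,e} + ΔQ_{X,X}.
-/
lemma VarComp.shift_Psi_pos_of_posDef {g : VarComp} (h : g.cov.PosDef) (d : ℝ) :
    0 < (g.shift d).Psi := by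
  have hne : ![0, 1, d] ≠ 0 := fun h0 => by simpa using congrFun h0 1
  have := h.dotProduct_mulVec_pos hne
  simp [VarComp.cov, Matrix.mulVec, dotProduct, Fin.sum_univ_three] at this
  simp only [VarComp.shift]
  linarith

/-- Φ₁(β₀) is the quadratic form at (1, 2Δ, Δ²), from Q_{e(β₀),e(β₀)} = Q_{e,e} + 2ΔQ_{X,e} +
Δ²Q_{X,X}. -/
lemma VarComp.shift_Phi1_pos_of_posDef {g : VarComp} (h : g.cov.PosDef) (d : ℝ) :
    0 < (g.shift d).Phi1 := by
  have hne : ![1, 2 * d, d ^ 2] ≠ 0 := fun h0 => by simpa using congrFun h0 0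
  have := h.dotProduct_mulVec_pos hne
  simp [VarComp.cov, Matrix.mulVec, dotProduct, Fin.sum_univ_three] at this
  simp only [VarComp.shift]
  linarith

lemma NondegenerateAt.of_posDef {g : VarComp} (h : g.cov.PosDef) {b c : ℝ}
    (hΔ : ∀ n, |D.Del b n| ≤ c) : NondegenerateAt D g b := by
  obtain ⟨c₁, hc₁, h₁⟩ := exists_lower_bound_of_pos hΔ g.continuous_shift_Phi1
    (VarComp.shift_Phi1_pos_of_posDef h)
  obtain ⟨c₂, hc₂, h₂⟩ := exists_lower_bound_of_pos hΔ g.continuous_shift_Psi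
    (VarComp.shift_Psi_pos_of_posDef h)
  exact ⟨min c₁ c₂, lt_min hc₁ hc₂, Eventually.of_forall fun n =>
    ⟨(min_le_left _ _).trans (h₁ n), (min_le_right _ _).trans (h₂ n)⟩⟩

end Nondegenerate

/-! ### The full vector, including the correlation. -/

section Gamma

variable {Ω : ℕ → Type*} [∀ n, MeasurableSpace (Ω n)] {μ : ∀ n, Measure (Ω n)} {D : IVArray Ω}

/-- Consistency of the full vector, including the correlation, under nondegeneracy. -/
lemma SixConsistent.gamma {g : VarComp} {b c : ℝ} (h : SixConsistent μ D g b)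
    (hΔ : ∀ n, |D.Del b n| ≤ c) (hnd : NondegenerateAt D g b) :
    IsLittleOp μ fun n ω => ‖D.crossFit b n ω - (g.shift (D.Del b n)).gamma‖ := by
  obtain ⟨c₀, hc₀, hn⟩ := hnd
  let est : ∀ n, Ω n → Fin 6 → ℝ := fun n ω =>
    ![hatPhi1 (D.K n) (D.P n) (D.resid b n ω), hatPhi12 (D.K n) (D.P n) (D.X n ω) (D.resid b n ω),
      hatPhi13 (D.K n) (D.P n) (D.X n ω) (D.resid b n ω),
      hatPsi (D.K n) (D.P n) (D.X n ω) (D.resid b n ω),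
      hatTau (D.K n) (D.P n) (D.X n ω) (D.resid b n ω), hatUpsilon (D.K n) (D.P n) (D.X n ω)]
  have hest : ∀ k, IsLittleOp μ fun n ω => est n ω k - (g.shift (D.Del b n)).toVec k := by
    intro k
    fin_cases k
    · exact h.Phi1
    · exact h.Phi12
    · exact h.Phi13
    · exact h.Psi
    · exact h.tau
    · exact h.Ups
  -- The target drifts with `n`, so continuity at one point is not enough. Eventually Δ lies in this
  -- compact set, and on its image `appendRho` is continuous with a common modulus.
  let T : Set ℝ := Set.Icc (-c) c ∩ ({d | c₀ ≤ (g.shift d).Phi1} ∩ {d | c₀ ≤ (g.shift d).Psi})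
  have hT : IsCompact T := isCompact_Icc.inter_right
    ((isClosed_le continuous_const g.continuous_shift_Phi1).inter
      (isClosed_le continuous_const g.continuous_shift_Psi))
  have hS := hT.image g.continuous_shift_toVec
  refine IsLittleOp.of_forall_lt hest fun ε hε => ?_
  have hu := hS.uniformContinuousAt_of_continuousAt appendRho (by
    rintro _ ⟨d, hd, rfl⟩
    exact continuousAt_appendRho (hc₀.trans_le hd.2.1) (hc₀.trans_le hd.2.2))
    (Metric.dist_mem_uniformity hε)
  obtain ⟨δ, hδ, hsub⟩ := Metric.mem_uniformity_dist.1 hu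
  refine ⟨δ, hδ, ?_⟩
  filter_upwards [hn] with n hn ω hω
  have hmem : (g.shift (D.Del b n)).toVec ∈ (fun d => (g.shift d).toVec) '' T :=
    ⟨_, ⟨abs_le.1 (hΔ n), hn⟩, rfl⟩
  have hdist : dist (g.shift (D.Del b n)).toVec (est n ω) < δ := by
    rw [dist_comm, dist_pi_lt_iff hδ]
    exact hω
  have h1 := hsub hdist hmem
  rw [abs_norm, ← dist_eq_norm, dist_comm]
  exact h1

lemma ConsistentVariance.of_nondegenerateAt {g : VarComp} {B : Set ℝ} (hB : IsCompact B)
    (hβ : ∃ C : ℝ, ∀ n, |D.β n| ≤ C) (h : ∀ b ∈ B, SixConsistent μ D g b)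
    (hnd : ∀ b ∈ B, NondegenerateAt D g b) (hU : 0 < g.Ups) :
    ConsistentVariance μ D g B D.crossFit where
  inf_Phi1 := exists_uniform_lower_bound hB hβ g.continuous_shift_Phi1 fun b hb =>
    let ⟨c, hc, hn⟩ := hnd b hb
    ⟨c, hc, hn.mono fun _ h => h.1⟩
  inf_Psi := exists_uniform_lower_bound hB hβ g.continuous_shift_Psi fun b hb =>
    let ⟨c, hc, hn⟩ := hnd b hb
    ⟨c, hc, hn.mono fun _ h => h.2⟩
  Ups_pos := hU
  consistent := fun b hb =>
    let ⟨_, hC⟩ := hβ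
    (h b hb).gamma (abs_Del_le hC b) (hnd b hb)

end Gamma

end ManyIV

theorem theorem8 {Ω : ℕ → Type*} [∀ n, MeasurableSpace (Ω n)]
    (μ : ∀ n, Measure (Ω n)) [∀ n, IsProbabilityMeasure (μ n)]
    (D : ManyIV.IVArray Ω)
    (hβ : ∃ C : ℝ, ∀ n, |D.β n| ≤ C)
    (hP : ManyIV.ErrorsAndProjection μ D)
    (hreg : ManyIV.Regularity μ D)
    (hres : ManyIV.ResidualCondition D)
    (g : ManyIV.VarComp) (hg : ManyIV.IsVarLimit μ D g)
    (B : Set ℝ) (hB : IsCompact B) :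
    (∀ b ∈ B, ManyIV.SixConsistent μ D g b) ∧
    ((∀ b ∈ B, ManyIV.NondegenerateAt D g b) → 0 < g.Ups →
      ManyIV.ConsistentVariance μ D g B D.crossFit) ∧
    (g.cov.PosDef → ManyIV.ConsistentVariance μ D g B D.crossFit) := by
  obtain ⟨C, hC⟩ := id hβ
  have six : ∀ b ∈ B, ManyIV.SixConsistent μ D g b := fun b _ =>
    ManyIV.sixConsistent hP hreg hres hg (le_max_left _ _) (ManyIV.abs_Del_le hC b)
  exact ⟨six, fun hnd hU => .of_nondegenerateAt hB hβ six hnd hU, fun h =>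
    .of_nondegenerateAt hB hβ six (fun b _ => .of_posDef h (ManyIV.abs_Del_le hC b))
      (ManyIV.VarComp.Ups_pos_of_posDef h)⟩
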